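/- Let $T\in\{0,1\}$ be a response indicator, $X$ a random vector in $\mathbb R^r$, $Y$ a real random variable, $Z=(X,Y)$. Let $\pi(z;\gamma)$ and $U(z)$ be known functions, measurable in $z$, let $\Gamma\subset\mathbb R^p$ and $\Theta\subset\mathbb R$ be compact, and for each $K$ let $u_K:\mathbb R^r\to\mathbb R^K$ be measurable. Put $\theta_0=\mathbb E[U(Z)]$, $$g_K(T,Z;\gamma,\theta)=\Big(\big[1-\tfrac{T}{\pi(Z;\gamma)}\big]u_K(X)^\top,\ \theta-\tfrac{T}{\pi(Z;\gamma)}U(Z)\Big)^\top .$$ **Assumptions.** 1. $\mathbb P(T=1\mid Z)=\pi(Z;\gamma_0)$, with $\gamma_0$ in the interior of $\Gamma$ and $\theta_0$ in the interior of $\Theta$; $\gamma_0$ is the only $\gamma\in\Gamma$ with $\mathbb E[1-T/\pi(Z;\gamma)\mid X]=0$ a.s. 2. $X$ has a sub-vector $X_2$, with $X_1$ the remaining coordinates, such that $X_2$ is independent of $T$ given $(X_1,Y)$ and $X_2$ is not independent of $Y$ (in particular, it may be correlated with $Y$). 3. The support $\mathcal X$ of $X$ is a product of $r$ compact nondegenerate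 intervals. 4. There are constants $0<\underline c\le\bar c<1$ with $\underline c\le\pi(x,y;\gamma)\le\bar c$ on $\mathcal X\times\mathbb R\times\Gamma$; for $(x,y)\in\mathcal X\times\mathbb R$, $\pi(x,y;\cdot)$ is continuous on $\Gamma$ and twice continuously differentiable in the interior of $\Gamma$, with first and second derivatives bounded uniformly in $(x,y,\gamma)$. 5. Call $f:\mathcal X\to\mathbb R$ $s$-smooth if, writing $s=s_0+\delta$ with $s_0\in\mathbb Z_{\ge0}$ and $0<\delta\le1$, $f$ is $s_0$ times continuously differentiable on $\mathcal X$ and its partial derivatives of order $s_0$ are Hölder with exponent $\delta$. With $O(Z)=\frac{1-\pi(Z;\gamma_0)}{\pi(Z;\gamma_0)}$ and $S_0(Z)=-\frac{\nabla_\gamma\pi(Z;\gamma_0)}{1-\pi(Z;\gamma_0)}$, for some $s>0$ the functions $\mathbb E[OS_0\mid X=x]$, $\mathbb E[OU\mid X=x]$, $\mathbb E[O\mid X=x]$, and, for every $\gamma$ in $\Gamma$ (respectively in its interior), $\mathbb E[1-T/\pi(Z;\gamma)\mid X=x]$ (respectively $\mathbb E[\nabla_\gamma\pi(Z;\gamma)/\pi(Z;\gamma)\mid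 X=x]$) have $s$-smooth versions. 6. The eigenvalues of $\mathbb E[u_K(X)u_K(X)^\top]$, $K\ge p$, lie in a fixed interval $[\underline a,\overline a]$ with $0<\underline a\le\overline a<\infty$; $\sup_{x\in\mathcal X}\|u_K(x)\|\le CK$ for a constant $C$ and all $K\ge p$; and for every $f$ with $\mathbb E[f(X)^2]<\infty$, $\inf_{\beta\in\mathbb R^K}\mathbb E[(f(X)-\beta^\top u_K(X))^2]\to0$ as $K\to\infty$. 7. $\mathbb E[U(Z)^2]<\infty$ and $U(Z)$ is not almost surely constant. 8. With $m(X)=\frac{\mathbb E[OS_0\mid X]}{\mathbb E[O\mid X]}$, $R(X)=\frac{\mathbb E[OU\mid X]}{\mathbb E[O\mid X]}$ and $S_{eff}(T,Z;\gamma,\theta)=\Big(\big(1-\tfrac{T}{\pi(Z;\gamma)}\big)m(X)^\top,\ -\tfrac{T}{\pi(Z;\gamma)}U(Z)+\theta-\big(1-\tfrac{T}{\pi(Z;\gamma)}\big)R(X)\Big)^\top$, the function $S_{eff}$ is a.s. continuously differentiable at each $(\gamma,\theta)$ in the interior of $\Gamma\times\Theta$, and $J=\mathbb E[\partial S_{eff}/\partial(\gamma^\top,\theta)]$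 at $(\gamma_0,\theta_0)$ is nonsingular. 9. $(T_i,X_i,Y_i)$, $i\ge1$, are i.i.d. copies of $(T,X,Y)$, and $K=K_N\to\infty$ with $K_N^3/N\to0$. Let $G_K(\gamma,\theta)=\sum_{i\le N}g_K(T_i,Z_i;\gamma,\theta)$ and $D=\mathbb E[g_Kg_K^\top]$ at $(\gamma_0,\theta_0)$. For $K=K_N$, let the following be random variables that minimize, over $\Gamma\times\Theta$, the criterion $G_K^\top A^{-1}G_K$ (where $A^{-1}$ is read as $0$ if $A$ is singular): - the first-step estimator $(\check\gamma,\check\theta)$, with $A=\widehat W_0=\mathrm{diag}\big(\frac1N\sum_{i\le N} u_K(X_i)u_K(X_i)^\top,\,1\big)$; - the infeasible best estimator $(\bar\gamma,\bar\theta)$, with $A=D$; - the feasible two-step estimator $(\hat\gamma,\hat\theta)$, with $A=\widehat D=\frac1N\sum_{i\le N} g_K(T_i,Z_i;\check\gamma,\check\theta)\,g_K(T_i,Z_i;\check\gamma,\check\theta)^\top$. **Theorem.** Under these assumptions, $$\sqrt N\begin{pmatrix}\bar\gamma-\hat\gamma\\ \bar\theta-\hat\theta\end{pmatrix}=o_p(1).$$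 Moreover the feasible estimator attains the efficiency bound: the matrix $V_{eff}=J^{-1}\,\mathbb E[S_{eff}S_{eff}^\top]\,(J^{-1})^\top$, with $S_{eff}$ at $(\gamma_0,\theta_0)$, is positive definite, and $$\sqrt N\begin{pmatrix}\hat\gamma-\gamma_0\\ \hat\theta-\theta_0\end{pmatrix}\to N(0,V_{eff})\quad\text{in distribution.}$$ -/

import Mathlib

open MeasureTheory ProbabilityTheory Filter Topology Set
open scoped Matrix

noncomputable section

namespace MNAR

/-- A full observation `(T, (X, Y))`: response indicator, covariate vector in `ℝ^r`, outcome. -/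
abbrev Obs (r : ℕ) : Type := Bool × ((Fin r → ℝ) × ℝ)

/-- The response indicator `T` as a number in `{0, 1}`. -/
def tInd {r : ℕ} (w : Obs r) : ℝ := if w.1 then 1 else 0

/-- The covariate vector `X`. -/
def xVec {r : ℕ} (w : Obs r) : Fin r → ℝ := w.2.1

/-- The outcome `Y`. -/
def yVal {r : ℕ} (w : Obs r) : ℝ := w.2.2

/-- The vector `Z = (X, Y)`. -/
def zVec {r : ℕ} (w : Obs r) : (Fin r → ℝ) × ℝ := w.2

/-- The sub-vector `X₂` of the covariates with coordinates in `J` (the instruments). -/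
def xIn {r : ℕ} (J : Finset (Fin r)) (w : Obs r) : {j : Fin r // j ∈ J} → ℝ :=
  fun j => xVec w j.1

/-- `(X₁, Y)`, where `X₁` consists of the covariates with coordinates outside `J`. -/
def xOutY {r : ℕ} (J : Finset (Fin r)) (w : Obs r) : ({j : Fin r // j ∉ J} → ℝ) × ℝ :=
  (fun j => xVec w j.1, yVal w)

lemma measurable_xOutY {r : ℕ} (J : Finset (Fin r)) : Measurable (xOutY J) := by
  unfold xOutY xVec yVal
  fun_prop

/-- The σ-algebra generated by `X`. -/
abbrev sigmaX (r : ℕ) : MeasurableSpace (Obs r) := MeasurableSpace.comap xVec inferInstance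

/-- The σ-algebra generated by `Z`. -/
abbrev sigmaZ (r : ℕ) : MeasurableSpace (Obs r) := MeasurableSpace.comap zVec inferInstance

/-- `s`-smoothness on the box `[a, b] ⊆ ℝ^r`: writing `s = s₀ + δ` with `s₀ ∈ ℕ` and `0 < δ ≤ 1`,
`f` is `s₀` times continuously differentiable and all partial derivatives of order `s₀`
(the one along `i 0, …, i (s₀ - 1)` for each tuple `i` of coordinates) are Hölder with exponent
`δ`. The choice of the norm of `ℝ^r` only affects the constant `L`. -/
def IsSSmooth {r : ℕ} (s : ℝ) (a b : Fin r → ℝ) (f : (Fin r → ℝ) → ℝ) : Prop :=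
  ∃ (s₀ : ℕ) (δ : ℝ), 0 < δ ∧ δ ≤ 1 ∧ s = s₀ + δ ∧
    ContDiffOn ℝ (s₀ : ℕ∞) f (Icc a b) ∧
    ∃ L : ℝ, 0 < L ∧ ∀ x₁ ∈ Icc a b, ∀ x₂ ∈ Icc a b, ∀ i : Fin s₀ → Fin r,
      |iteratedFDerivWithin ℝ s₀ f (Icc a b) x₁ (fun k => Pi.single (i k) 1)
        - iteratedFDerivWithin ℝ s₀ f (Icc a b) x₂ (fun k => Pi.single (i k) 1)|
        ≤ L * ‖x₁ - x₂‖ ^ δ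

/-- The data of the estimation problem: the law of `(T, X, Y)`, the parametric response
probability `π(z; γ)`, the known function `U`, the true `γ₀`, the parameter spaces `Γ` and `Θ`,
and the matching functions `u_K : ℝ^r → ℝ^K`. -/
structure Model (r p : ℕ) where
  P : Measure (Obs r)
  prob : (Fin r → ℝ) × ℝ → EuclideanSpace ℝ (Fin p) → ℝ
  U : (Fin r → ℝ) × ℝ → ℝ
  γ₀ : EuclideanSpace ℝ (Fin p)
  Γ : Set (EuclideanSpace ℝ (Fin p))
  Θ : Set ℝ
  u : (K : ℕ) → (Fin r → ℝ) → (Fin K → ℝ)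

namespace Model

variable {r p : ℕ} (M : Model r p)

/-- The parameter of interest `θ₀ = E[U(Z)]`. -/
def θ₀ : ℝ := ∫ w, M.U (zVec w) ∂M.P

/-- `1 - T / π(Z; γ)`. -/
def resid (γ : EuclideanSpace ℝ (Fin p)) (w : Obs r) : ℝ := 1 - tInd w / M.prob (zVec w) γ

/-- The `j`-th component of `∇_γ π(z; γ)`. -/
def gradProb (z : (Fin r → ℝ) × ℝ) (γ : EuclideanSpace ℝ (Fin p)) (j : Fin p) : ℝ :=
  fderiv ℝ (M.prob z) γ (EuclideanSpace.single j 1)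

/-- `E[u_K(X) u_K(X)ᵀ]`. -/
def gram (K : ℕ) : Matrix (Fin K) (Fin K) ℝ :=
  Matrix.of fun i j => ∫ w, M.u K (xVec w) i * M.u K (xVec w) j ∂M.P

/-- `O(Z) = (1 - π(Z; γ₀)) / π(Z; γ₀)`. -/
def odds (w : Obs r) : ℝ := (1 - M.prob (zVec w) M.γ₀) / M.prob (zVec w) M.γ₀

/-- `S₀(Z) = - ∇_γ π(Z; γ₀) / (1 - π(Z; γ₀))`. -/
def S0 (w : Obs r) (j : Fin p) : ℝ :=
  -(M.gradProb (zVec w) M.γ₀ j) / (1 - M.prob (zVec w) M.γ₀)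

/-- `m(X) = E[O S₀ | X] / E[O | X]`. -/
def mFun (w : Obs r) (j : Fin p) : ℝ :=
  (M.P[fun v => M.odds v * M.S0 v j | sigmaX r]) w / (M.P[M.odds | sigmaX r]) w

/-- `R(X) = E[O U | X] / E[O | X]`. -/
def rFun (w : Obs r) : ℝ :=
  (M.P[fun v => M.odds v * M.U (zVec v) | sigmaX r]) w / (M.P[M.odds | sigmaX r]) w

/-- `S_eff(T, Z; γ, θ) = (S₁ᵀ, S₂)ᵀ` with `S₁ = (1 - T/π(Z; γ)) m(X)` and
`S₂ = - T U(Z)/π(Z; γ) + θ - (1 - T/π(Z; γ)) R(X)`. -/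
def Seff (w : Obs r) (η : EuclideanSpace ℝ (Fin p) × ℝ) : Fin p ⊕ Unit → ℝ :=
  Sum.elim (fun j => M.resid η.1 w * M.mFun w j)
    (fun _ => -(tInd w / M.prob (zVec w) η.1 * M.U (zVec w)) + η.2 - M.resid η.1 w * M.rFun w)

/-- The coordinate directions of the parameter space `ℝ^p × ℝ`. -/
def dir (p : ℕ) : Fin p ⊕ Unit → EuclideanSpace ℝ (Fin p) × ℝ :=
  Sum.elim (fun j => (EuclideanSpace.single j 1, 0)) (fun _ => (0, 1))

/-- `E[∂S_eff / ∂(γᵀ, θ)]` at `(γ₀, θ₀)`. -/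
def effJac : Matrix (Fin p ⊕ Unit) (Fin p ⊕ Unit) ℝ :=
  Matrix.of fun i j => ∫ w, fderiv ℝ (fun η => M.Seff w η i) (M.γ₀, M.θ₀) (dir p j) ∂M.P

/-- `E[S_eff S_effᵀ]` at `(γ₀, θ₀)`. -/
def effCov : Matrix (Fin p ⊕ Unit) (Fin p ⊕ Unit) ℝ :=
  Matrix.of fun i j => ∫ w, M.Seff w (M.γ₀, M.θ₀) i * M.Seff w (M.γ₀, M.θ₀) j ∂M.P

/-- The efficiency bound `V_eff` of `(γ₀, θ₀)`: the second moment matrix of the efficient influence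
function `-(E[∂S_eff/∂(γᵀ, θ)])⁻¹ S_eff`. -/
def Veff : Matrix (Fin p ⊕ Unit) (Fin p ⊕ Unit) ℝ :=
  M.effJac⁻¹ * M.effCov * (M.effJac⁻¹)ᵀ

/-- The standing assumptions on the data of the problem. -/
structure Assumptions : Prop where
  isProb : IsProbabilityMeasure M.P
  /- Regularity taken for granted: measurability, and `U(Z)` square integrable and not a.s.
  constant (the matrices inverted below are finite and nonsingular in the limit). -/
  prob_meas : ∀ γ ∈ M.Γ, Measurable fun z => M.prob z γ
  U_meas : Measurable M.U
  u_meas : ∀ K, Measurable (M.u K)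
  U_sq : MemLp (fun w => M.U (zVec w)) 2 M.P
  U_nonconst : ¬ ∀ᵐ w ∂M.P, M.U (zVec w) = M.θ₀
  /- `P(T = 1 | Z) = π(Z; γ₀)`. -/
  response : M.P[tInd | sigmaZ r] =ᵐ[M.P] fun w => M.prob (zVec w) M.γ₀
  /- Some sub-vector `X₂` of `X` is independent of `T` given `(X₁, Y)`, and is related to `Y`. -/
  instrument : ∃ J : Finset (Fin r),
    CondIndepFun (MeasurableSpace.comap (xOutY J) inferInstance) (measurable_xOutY J).comap_le
      (xIn J) (fun w : Obs r => w.1) M.P ∧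
    ¬ IndepFun (xIn J) (yVal (r := r)) M.P
  /- Parameter spaces and identification by `E[1 - T/π(Z; γ) | X] = 0`. -/
  Γ_compact : IsCompact M.Γ
  γ₀_mem : M.γ₀ ∈ interior M.Γ
  Θ_compact : IsCompact M.Θ
  θ₀_mem : M.θ₀ ∈ interior M.Θ
  identified : ∀ γ ∈ M.Γ, M.P[M.resid γ | sigmaX r] =ᵐ[M.P] 0 → γ = M.γ₀
  /- The support of `X` is a box, with the smoothness and boundedness conditions on it. -/
  box : ∃ a b : Fin r → ℝ, (∀ j, a j < b j) ∧ (M.P.map xVec).support = Icc a b ∧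
    (∃ s : ℝ, 0 < s ∧
      (∀ j, ∃ f, IsSSmooth s a b f ∧
        (fun w => f (xVec w)) =ᵐ[M.P] M.P[fun w => M.odds w * M.S0 w j | sigmaX r]) ∧
      (∃ f, IsSSmooth s a b f ∧
        (fun w => f (xVec w)) =ᵐ[M.P] M.P[fun w => M.odds w * M.U (zVec w) | sigmaX r]) ∧
      (∃ f, IsSSmooth s a b f ∧
        (fun w => f (xVec w)) =ᵐ[M.P] M.P[M.odds | sigmaX r]) ∧
      (∀ γ ∈ M.Γ, ∃ f, IsSSmooth s a b f ∧
        (fun w => f (xVec w)) =ᵐ[M.P] M.P[M.resid γ | sigmaX r]) ∧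
      (∀ γ ∈ interior M.Γ, ∀ j, ∃ f, IsSSmooth s a b f ∧
        (fun w => f (xVec w)) =ᵐ[M.P]
          M.P[fun w => M.gradProb (zVec w) γ j / M.prob (zVec w) γ | sigmaX r])) ∧
    (∃ c c' : ℝ, 0 < c ∧ c' < 1 ∧ ∀ x ∈ Icc a b, ∀ y : ℝ, ∀ γ ∈ M.Γ,
      c ≤ M.prob (x, y) γ ∧ M.prob (x, y) γ ≤ c') ∧
    (∀ x ∈ Icc a b, ∀ y : ℝ, ContinuousOn (M.prob (x, y)) M.Γ ∧
      ContDiffOn ℝ 2 (M.prob (x, y)) (interior M.Γ)) ∧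
    (∃ C : ℝ, ∀ x ∈ Icc a b, ∀ y : ℝ, ∀ γ ∈ interior M.Γ,
      ‖fderiv ℝ (M.prob (x, y)) γ‖ ≤ C ∧ ‖iteratedFDeriv ℝ 2 (M.prob (x, y)) γ‖ ≤ C) ∧
    /- `sup_{x} ‖u_K(x)‖ ≤ C K`. -/
    (∃ C : ℝ, ∀ K, p ≤ K → ∀ x ∈ Icc a b, ‖WithLp.toLp 2 (M.u K x)‖ ≤ C * K)
  /- Eigenvalues of `E[u_K u_Kᵀ]` are bounded and bounded away from zero uniformly in `K`. -/
  eigen : ∃ a b : ℝ, 0 < a ∧ ∀ K, p ≤ K →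
    (M.gram K - a • 1).PosSemidef ∧ (b • 1 - M.gram K).PosSemidef
  /- The linear spans of the components of `u_K(X)` become dense in `L²(X)`. -/
  dense : ∀ f : (Fin r → ℝ) → ℝ, MemLp f 2 (M.P.map xVec) → ∀ ε : ℝ, 0 < ε →
    ∀ᶠ K in atTop, ∃ β : Fin K → ℝ, ∫ w, (f (xVec w) - β ⬝ᵥ M.u K (xVec w)) ^ 2 ∂M.P < ε
  Seff_smooth : ∀ γ ∈ interior M.Γ, ∀ θ ∈ interior M.Θ, ∀ᵐ w ∂M.P,
    ContDiffAt ℝ 1 (M.Seff w) (γ, θ)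
  effJac_nonsing : IsUnit M.effJac.det

/-- The moment function `g_K(T, Z; γ, θ)`. -/
def g (K : ℕ) (w : Obs r) (η : EuclideanSpace ℝ (Fin p) × ℝ) : Fin K ⊕ Unit → ℝ :=
  Sum.elim (fun k => M.resid η.1 w * M.u K (xVec w) k)
    (fun _ => η.2 - tInd w / M.prob (zVec w) η.1 * M.U (zVec w))

/-- `G_K(γ, θ)` for the observations `d 0, …, d (N - 1)`. -/
def G (K N : ℕ) (d : ℕ → Obs r) (η : EuclideanSpace ℝ (Fin p) × ℝ) : Fin K ⊕ Unit → ℝ :=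
  ∑ i ∈ Finset.range N, M.g K (d i) η

/-- `D = E[g_K g_Kᵀ]` at `(γ₀, θ₀)`. -/
def D (K : ℕ) : Matrix (Fin K ⊕ Unit) (Fin K ⊕ Unit) ℝ :=
  Matrix.of fun i j => ∫ w, M.g K w (M.γ₀, M.θ₀) i * M.g K w (M.γ₀, M.θ₀) j ∂M.P

/-- The first-step matrix `Ŵ₀`. -/
def W0 (K N : ℕ) (d : ℕ → Obs r) : Matrix (Fin K ⊕ Unit) (Fin K ⊕ Unit) ℝ :=
  Matrix.fromBlocks
    ((N : ℝ)⁻¹ • ∑ i ∈ Finset.range N,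
      Matrix.vecMulVec (M.u K (xVec (d i))) (M.u K (xVec (d i)))) 0 0 1

/-- `D̂ = N⁻¹ ∑ g_K g_Kᵀ` evaluated at the parameter value `η`. -/
def Dhat (K N : ℕ) (d : ℕ → Obs r) (η : EuclideanSpace ℝ (Fin p) × ℝ) :
    Matrix (Fin K ⊕ Unit) (Fin K ⊕ Unit) ℝ :=
  (N : ℝ)⁻¹ • ∑ i ∈ Finset.range N, Matrix.vecMulVec (M.g K (d i) η) (M.g K (d i) η)

/-- `η` minimizes `G_K(γ, θ)ᵀ A⁻¹ G_K(γ, θ)` over `Γ × Θ`. -/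
def IsGMM (K N : ℕ) (d : ℕ → Obs r) (A : Matrix (Fin K ⊕ Unit) (Fin K ⊕ Unit) ℝ)
    (η : EuclideanSpace ℝ (Fin p) × ℝ) : Prop :=
  η ∈ M.Γ ×ˢ M.Θ ∧
    IsMinOn (fun η' => M.G K N d η' ⬝ᵥ (A⁻¹ *ᵥ M.G K N d η')) (M.Γ ×ˢ M.Θ) η

end Model

/-- The column vector `(γᵀ, θ)ᵀ` in the Euclidean space `ℝ^(p+1)`. -/
def stack {p : ℕ} (η : EuclideanSpace ℝ (Fin p) × ℝ) : EuclideanSpace ℝ (Fin p ⊕ Unit) :=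
  WithLp.toLp 2 (Sum.elim (fun j => η.1 j) (fun _ => η.2))

end MNAR

end

/-! Conditioning on `Z` computes all population moments at the true parameter: with O = (1 - π)/π,
E[(1 - T/π) F] = 0 and E[(1 - T/π)² F] = E[O F] for functions F of `Z`. Since θ - TU/π = (1 - T/π) U
+ (θ - U), every linear combination of the moments, and every component of S_eff, has at the truth
the form `psi`: (1 - T/π)(f(X) + βU) + β(θ₀ - U). On this class the mean derivative in the j-th
parameter is the L² pairing with a fixed function φ_j, a linear combination of the components of
S_eff (`Regular.integral_phi_mul_psi`). Applied to S_eff itself, this gives J = E[S_eff S_effᵀ] Bᵀ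
with B = `effCoef`. Hence nonsingularity of J makes E[S_eff S_effᵀ] positive definite and B
invertible, and E[φφᵀ]⁻¹ φ = J⁻¹ S_eff (`Regular.inv_phiCov_mulVec`).

For fixed K put b_j = D⁻¹ E[∂_j g_K]. The normal equations show that b_j · g_K is the L² projection
of φ_j on the span of the moments. The U-part of φ_j lies in that span exactly and the X-part is
approximated by u_K, so the projections converge to φ_j (`Regular.tendsto_projCoef`) and the vectors
b_j stay bounded.

Growth of K is handled by Chebyshev bounds. K³/N → 0 makes sample second moment matrices converge in
Frobenius norm (`Regular.tendsto_frobenius`), so with probability tending to one every weighting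
matrix has eigenvalues in a fixed positive interval. The sample moments at the truth satisfy √(NK)
|ḡ|² → 0 in probability. A minimizer has sample moments of the same order; identification and
compactness give consistency (`Regular.tendsto_of_gbar`), and expansion around the truth gives |η -
η₀| ≤ q |ḡ(η₀)| (`Regular.exists_rate`).

The decisive step is `Regular.abs_linearization_le`. With λ = A⁻¹ ḡ(η), b_j · ḡ(η) = (A b_j) · λ. As
D b_j is the mean derivative and the first order condition says that λ is orthogonal to the sample
derivative at η, (A b_j) · λ contains only products of two small quantities. These are o(N^(-1/2))
in probability, so √N (η - η₀) = -√N × (sample mean of J⁻¹ S_eff) + o_p(1), whatever A is, provided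
the first block of (A - D) b_j is small (`Regular.tendsto_linear_expansion`). This is trivial for A
= D and follows from the first-step rate for A = D̂. Both estimators therefore share one expansion:
subtraction gives their equivalence, and the multivariate central limit theorem gives the limit law.
-/

namespace MNAR

noncomputable section

/-! ### Convergence in probability as convergence along a filter -/

section InProb

variable {Ω : Type*} [MeasurableSpace Ω] {μ : Measure Ω}

/-- The filter of sequences of events whose probability tends to one. Convergence of a sequence of
random variables along it, to a constant, is convergence in probability. -/
def inProb (μ : Measure Ω) : Filter (ℕ × Ω) where
  sets := {S | Tendsto (fun N => μ {ω | (N, ω) ∉ S}) atTop (𝓝 0)}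
  univ_sets := by simp
  sets_of_superset := fun {S T} hS hST =>
    tendsto_of_tendsto_of_tendsto_of_le_of_le tendsto_const_nhds hS (fun _ => zero_le)
      (fun N => measure_mono fun ω h h' => h (hST h'))
  inter_sets := fun {S T} hS hT => by
    have h := Tendsto.add hS hT
    rw [add_zero] at h
    refine tendsto_of_tendsto_of_tendsto_of_le_of_le tendsto_const_nhds h (fun _ => zero_le)
      (fun N => (measure_mono ?_).trans (measure_union_le _ _))
    intro ω hω
    by_cases h1 : (N, ω) ∈ S
    · exact Or.inr fun h2 => hω ⟨h1, h2⟩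
    · exact Or.inl h1

lemma eventually_inProb {p : ℕ × Ω → Prop} :
    (∀ᶠ x in inProb μ, p x) ↔ Tendsto (fun N => μ {ω | ¬ p (N, ω)}) atTop (𝓝 0) := Iff.rfl

lemma eventually_inProb_of_ae {p : ℕ × Ω → Prop} (h : ∀ᶠ N in atTop, ∀ᵐ ω ∂μ, p (N, ω)) :
    ∀ᶠ x in inProb μ, p x := by
  rw [eventually_inProb]
  refine tendsto_const_nhds.congr' ?_
  filter_upwards [h] with N hN
  exact (ae_iff.1 hN).symm

lemma tendsto_fst_inProb : Tendsto Prod.fst (inProb μ) (atTop : Filter ℕ) := by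
  intro s hs
  refine eventually_inProb_of_ae (p := fun x => x.1 ∈ s) ?_
  filter_upwards [hs] with N hN
  exact Eventually.of_forall fun _ => hN

/-- This is what makes the filter useful: sums, products, squeezing and "with probability tending to
one" become ordinary filter calculus, even for quantities whose dimension varies with the index and
whose measurability is never checked. -/
lemma tendstoInMeasure_iff_inProb {E : Type*} [PseudoMetricSpace E] {X : ℕ → Ω → E} {c : E} :
    TendstoInMeasure μ X atTop (fun _ => c) ↔
      Tendsto (fun x : ℕ × Ω => X x.1 x.2) (inProb μ) (𝓝 c) := by
  rw [tendstoInMeasure_iff_dist, Metric.tendsto_nhds]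
  refine forall_congr' fun ε => forall_congr' fun hε => ?_
  simp only [eventually_inProb, not_lt]

/-- Markov's inequality. -/
lemma tendsto_inProb_of_integral {X : ℕ → Ω → ℝ} {c : ℕ → ℝ}
    (hX : ∀ᶠ N in atTop, Integrable (X N) μ ∧ (∀ ω, 0 ≤ X N ω) ∧ ∫ ω, X N ω ∂μ ≤ c N)
    (hc : Tendsto c atTop (𝓝 0)) :
    Tendsto (fun x : ℕ × Ω => X x.1 x.2) (inProb μ) (𝓝 0) := by
  rw [Metric.tendsto_nhds]
  intro ε hε
  rw [eventually_inProb]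
  have h : Tendsto (fun N => ENNReal.ofReal (c N / ε)) atTop (𝓝 0) := by
    have := ENNReal.tendsto_ofReal (hc.div_const ε)
    simpa using this
  refine tendsto_of_tendsto_of_tendsto_of_le_of_le' tendsto_const_nhds h
    (Eventually.of_forall fun _ => zero_le) ?_
  filter_upwards [hX] with N hN
  obtain ⟨hi, h0, hle⟩ := hN
  have hset : {ω | ¬ dist (X N ω) 0 < ε} = {ω | ε ≤ X N ω} := by
    ext ω
    simp [abs_of_nonneg (h0 ω)]
  rw [hset]
  have hm := mul_meas_ge_le_integral_of_nonneg (ae_of_all μ h0) hi ε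
  have : μ {ω | ε ≤ X N ω} ≠ ⊤ := by
    have := hi.measure_norm_ge_lt_top hε
    refine (lt_of_le_of_lt (measure_mono fun ω hω => ?_) this).ne
    have hω' : ε ≤ X N ω := hω
    exact hω'.trans (le_abs_self _)
  rw [← ENNReal.ofReal_toReal this]
  refine ENNReal.ofReal_le_ofReal ?_
  rw [le_div_iff₀ hε, mul_comm]
  exact hm.trans hle

/-- A sequence bounded in mean times a sequence which tends to zero in probability. -/
lemma tendsto_inProb_mul_of_integral_le {X : ℕ → Ω → ℝ} {Y : ℕ × Ω → ℝ} {C : ℝ}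
    (hX : ∀ᶠ N in atTop, Integrable (X N) μ ∧ ∫ ω, |X N ω| ∂μ ≤ C)
    (hY : Tendsto Y (inProb μ) (𝓝 0)) :
    Tendsto (fun x : ℕ × Ω => X x.1 x.2 * Y x) (inProb μ) (𝓝 0) := by
  rw [Metric.tendsto_nhds]
  intro ε hε
  rw [eventually_inProb, ENNReal.tendsto_nhds_zero]
  intro δ hδ
  -- The tolerance δ is an extended real and may be infinite; a real one is needed to choose the
  -- truncation level.
  obtain ⟨δ', hδ'0, hδ'⟩ : ∃ δ' : ℝ, 0 < δ' ∧ ENNReal.ofReal δ' ≤ δ / 2 := by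
    by_cases hd : δ = ⊤
    · exact ⟨1, one_pos, by simp [hd, ENNReal.top_div]⟩
    · refine ⟨(δ / 2).toReal, ENNReal.toReal_pos (by simpa using hδ.ne') ?_, ?_⟩
      · exact (ENNReal.div_lt_top hd (by simp)).ne
      · rw [ENNReal.ofReal_toReal (ENNReal.div_lt_top hd (by simp)).ne]
  -- By Markov's inequality |X| exceeds this level with probability at most δ'; the numerator |C| +
  -- 1 keeps B positive for any C.
  set B : ℝ := (|C| + 1) / δ' with hB
  have hBpos : 0 < B := by positivity
  have hYev := (Metric.tendsto_nhds.1 hY (ε / B) (by positivity))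
  rw [eventually_inProb, ENNReal.tendsto_nhds_zero] at hYev
  filter_upwards [hX, hYev (δ / 2) (by simpa using hδ.ne')] with N hN hYN
  obtain ⟨hi, hle⟩ := hN
  have h1 : μ {ω | B ≤ |X N ω|} ≤ δ / 2 := by
    have hm := mul_meas_ge_le_integral_of_nonneg (μ := μ) (f := fun ω => |X N ω|)
      (ae_of_all μ fun ω => abs_nonneg _) hi.abs B
    have hne : μ {ω | B ≤ |X N ω|} ≠ ⊤ := (hi.measure_norm_ge_lt_top hBpos).ne
    rw [← ENNReal.ofReal_toReal hne]
    refine le_trans (ENNReal.ofReal_le_ofReal ?_) hδ'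
    have : B * (μ {ω | B ≤ |X N ω|}).toReal ≤ |C| + 1 := by
      refine hm.trans (hle.trans ?_)
      linarith [le_abs_self C]
    rw [hB, div_mul_eq_mul_div, div_le_iff₀ hδ'0] at this
    exact le_of_mul_le_mul_left this (by positivity)
  calc μ {ω | ¬ dist (X N ω * Y (N, ω)) 0 < ε}
      ≤ μ ({ω | B ≤ |X N ω|} ∪ {ω | ¬ dist (Y (N, ω)) 0 < ε / B}) := by
        refine measure_mono fun ω hω => ?_
        by_contra hcon
        simp only [mem_union, mem_ofPred_eq, not_or, not_not, not_le, dist_zero_right,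
          Real.norm_eq_abs] at hcon hω
        apply hω
        rw [abs_mul]
        calc |X N ω| * |Y (N, ω)| ≤ B * |Y (N, ω)| := by gcongr; exact hcon.1.le
          _ < B * (ε / B) := by gcongr; exact hcon.2
          _ = ε := by field_simp
    _ ≤ δ / 2 + δ / 2 := (measure_union_le _ _).trans (add_le_add h1 hYN)
    _ = δ := ENNReal.add_halves δ

lemma tendsto_inProb_of_ae [IsProbabilityMeasure μ] {X : ℕ → Ω → ℝ} {c : ℝ}
    (hX : ∀ N, AEStronglyMeasurable (X N) μ)
    (h : ∀ᵐ ω ∂μ, Tendsto (fun N => X N ω) atTop (𝓝 c)) :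
    Tendsto (fun x : ℕ × Ω => X x.1 x.2) (inProb μ) (𝓝 c) :=
  tendstoInMeasure_iff_inProb.1 (tendstoInMeasure_of_tendsto_ae hX h)

end InProb

/-! ### Empirical means -/

section Empirical

variable {𝒲 : Type*}

/-- The empirical mean `N⁻¹ ∑ f(d i)` over the first `N` observations. -/
def emp (N : ℕ) (d : ℕ → 𝒲) (f : 𝒲 → ℝ) : ℝ := (N : ℝ)⁻¹ * ∑ i ∈ Finset.range N, f (d i)

variable {N : ℕ} {d : ℕ → 𝒲}

lemma emp_add (f g : 𝒲 → ℝ) : emp N d (fun w => f w + g w) = emp N d f + emp N d g := by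
  simp [emp, Finset.sum_add_distrib, mul_add]

lemma emp_sub (f g : 𝒲 → ℝ) : emp N d (fun w => f w - g w) = emp N d f - emp N d g := by
  simp [emp, Finset.sum_sub_distrib, mul_sub]

lemma emp_const_mul (c : ℝ) (f : 𝒲 → ℝ) : emp N d (fun w => c * f w) = c * emp N d f := by
  simp only [emp, ← Finset.mul_sum]
  ring

lemma emp_sum {ι : Type*} (s : Finset ι) (f : ι → 𝒲 → ℝ) :
    emp N d (fun w => ∑ k ∈ s, f k w) = ∑ k ∈ s, emp N d (f k) := by
  simp only [emp, ← Finset.mul_sum]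
  rw [Finset.sum_comm]

lemma emp_const (hN : N ≠ 0) (c : ℝ) : emp N d (fun _ => c) = c := by
  have : (N : ℝ) ≠ 0 := by exact_mod_cast hN
  simp [emp, this]

lemma emp_mono {f g : 𝒲 → ℝ} (h : ∀ i, f (d i) ≤ g (d i)) : emp N d f ≤ emp N d g := by
  unfold emp
  gcongr with i
  exact h i

lemma emp_nonneg {f : 𝒲 → ℝ} (h : ∀ i, 0 ≤ f (d i)) : 0 ≤ emp N d f := by
  unfold emp
  exact mul_nonneg (by positivity) (Finset.sum_nonneg fun i _ => h i)

lemma abs_emp_le (f : 𝒲 → ℝ) : |emp N d f| ≤ emp N d (fun w => |f w|) := by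
  unfold emp
  rw [abs_mul, abs_of_nonneg (by positivity : (0 : ℝ) ≤ (N : ℝ)⁻¹)]
  gcongr
  exact Finset.abs_sum_le_sum_abs _ _

lemma sq_emp_mul_le (f g : 𝒲 → ℝ) :
    (emp N d fun w => f w * g w) ^ 2 ≤ emp N d (fun w => f w ^ 2) * emp N d (fun w => g w ^ 2) := by
  unfold emp
  have h := Finset.sum_mul_sq_le_sq_mul_sq (Finset.range N) (fun i => f (d i)) (fun i => g (d i))
  calc ((N : ℝ)⁻¹ * ∑ i ∈ Finset.range N, f (d i) * g (d i)) ^ 2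
      = (N : ℝ)⁻¹ ^ 2 * (∑ i ∈ Finset.range N, f (d i) * g (d i)) ^ 2 := by ring
    _ ≤ (N : ℝ)⁻¹ ^ 2 * ((∑ i ∈ Finset.range N, f (d i) ^ 2) *
          ∑ i ∈ Finset.range N, g (d i) ^ 2) := by gcongr
    _ = _ := by ring

lemma emp_mul_le_sqrt (f g : 𝒲 → ℝ) :
    |emp N d fun w => f w * g w| ≤
      √(emp N d fun w => f w ^ 2) * √(emp N d fun w => g w ^ 2) := by
  rw [← Real.sqrt_mul (emp_nonneg (f := fun w => f w ^ 2) fun i => sq_nonneg (f (d i)))]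
  exact Real.abs_le_sqrt (sq_emp_mul_le f g)

end Empirical

/-! ### Independent samples -/

section Sample

variable {Ω 𝒲 : Type*} [MeasurableSpace Ω] [MeasurableSpace 𝒲]

/-- `W 0, W 1, …` is an i.i.d. sample from the law `P`. -/
structure IsIIDSample (μ : Measure Ω) (P : Measure 𝒲) (W : ℕ → Ω → 𝒲) : Prop where
  meas : ∀ i, Measurable (W i)
  indep : iIndepFun W μ
  law : ∀ i, μ.map (W i) = P

namespace IsIIDSample

variable {μ : Measure Ω} {P : Measure 𝒲} {W : ℕ → Ω → 𝒲}

lemma measurePreserving (h : IsIIDSample μ P W) (i : ℕ) : MeasurePreserving (W i) μ P :=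
  ⟨h.meas i, h.law i⟩

lemma integral (h : IsIIDSample μ P W) {f : 𝒲 → ℝ} (hf : AEStronglyMeasurable f P) (i : ℕ) :
    ∫ ω, f (W i ω) ∂μ = ∫ w, f w ∂P := by
  rw [← h.law i] at hf ⊢
  exact (integral_map (h.meas i).aemeasurable hf).symm

lemma ae_forall (h : IsIIDSample μ P W) {p : 𝒲 → Prop} (hp : ∀ᵐ w ∂P, p w) :
    ∀ᵐ ω ∂μ, ∀ i, p (W i ω) :=
  ae_all_iff.2 fun i => (h.measurePreserving i).quasiMeasurePreserving.ae hp

lemma memLp (h : IsIIDSample μ P W) {f : 𝒲 → ℝ} (hf : MemLp f 2 P) (i : ℕ) :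
    MemLp (fun ω => f (W i ω)) 2 μ := hf.comp_measurePreserving (h.measurePreserving i)

lemma integrable (h : IsIIDSample μ P W) {f : 𝒲 → ℝ} (hf : Integrable f P) (i : ℕ) :
    Integrable (fun ω => f (W i ω)) μ :=
  (h.measurePreserving i).integrable_comp_of_integrable hf

lemma integrable_emp (h : IsIIDSample μ P W) {f : 𝒲 → ℝ} (hf : Integrable f P) (N : ℕ) :
    Integrable (fun ω => emp N (fun i => W i ω) f) μ :=
  (integrable_finsetSum _ fun i _ => h.integrable hf i).const_mul _

lemma memLp_emp (h : IsIIDSample μ P W) {f : 𝒲 → ℝ} (hf : MemLp f 2 P) (N : ℕ) :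
    MemLp (fun ω => emp N (fun i => W i ω) f) 2 μ :=
  (memLp_finsetSum _ fun i _ => h.memLp hf i).const_mul _

lemma integral_emp (h : IsIIDSample μ P W) {f : 𝒲 → ℝ} (hf : Integrable f P) {N : ℕ}
    (hN : N ≠ 0) : ∫ ω, emp N (fun i => W i ω) f ∂μ = ∫ w, f w ∂P := by
  have hN' : (N : ℝ) ≠ 0 := by exact_mod_cast hN
  simp only [emp]
  rw [integral_const_mul, integral_finsetSum _ fun i _ => h.integrable hf i]
  simp [h.integral hf.aestronglyMeasurable, hN']

/-- An array of functions that tends to zero in mean has empirical means that tend to zero. -/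
lemma tendsto_emp_of_integral (h : IsIIDSample μ P W) {f : ℕ → 𝒲 → ℝ} {c : ℕ → ℝ}
    (hf : ∀ᶠ N in atTop, Integrable (f N) P ∧ (∀ w, 0 ≤ f N w) ∧ ∫ w, f N w ∂P ≤ c N)
    (hc : Tendsto c atTop (𝓝 0)) :
    Tendsto (fun x : ℕ × Ω => emp x.1 (fun i => W i x.2) (f x.1)) (inProb μ) (𝓝 0) := by
  refine tendsto_inProb_of_integral (X := fun N ω => emp N (fun i => W i ω) (f N)) (c := c) ?_ hc
  filter_upwards [hf, eventually_ne_atTop 0] with N hfN hN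
  exact ⟨h.integrable_emp hfN.1 N, fun ω => emp_nonneg fun i => hfN.2.1 _,
    (h.integral_emp hfN.1 hN).trans_le hfN.2.2⟩

variable [IsProbabilityMeasure μ]

/-- The variance of an empirical mean. -/
lemma integral_sq_emp_sub_le (h : IsIIDSample μ P W) {f : 𝒲 → ℝ} (hf : MemLp f 2 P)
    {N : ℕ} (hN : N ≠ 0) :
    ∫ ω, (emp N (fun i => W i ω) f - ∫ w, f w ∂P) ^ 2 ∂μ ≤ (∫ w, f w ^ 2 ∂P) / N := by
  have hN' : (N : ℝ) ≠ 0 := by exact_mod_cast hN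
  have : IsProbabilityMeasure P := by
    rw [← h.law 0]; exact Measure.isProbabilityMeasure_map (h.meas 0).aemeasurable
  have hfi : Integrable f P := hf.integrable one_le_two
  rw [← h.integral_emp hfi hN, ← variance_eq_integral (h.memLp_emp hf N).aemeasurable]
  have hfun : (fun ω => emp N (fun i => W i ω) f)
      = fun ω => (N : ℝ)⁻¹ * (∑ i ∈ Finset.range N, fun ω => f (W i ω)) ω := by
    ext ω; simp [emp]
  rw [hfun, variance_const_mul, IndepFun.variance_sum (fun i _ => h.memLp hf i)]
  -- The variance is bounded by the raw second moment, so that later applications need only second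
  -- moments.
  · have hv : ∀ i, Var[fun ω => f (W i ω); μ] ≤ ∫ w, f w ^ 2 ∂P := by
      intro i
      rw [variance_eq_sub (h.memLp hf i)]
      have : μ[(fun ω => f (W i ω)) ^ 2] = ∫ w, f w ^ 2 ∂P :=
        h.integral (f := fun w => f w ^ 2) (hf.aestronglyMeasurable.pow 2) i
      rw [this]
      linarith [sq_nonneg (μ[fun ω => f (W i ω)])]
    calc ((N : ℝ)⁻¹) ^ 2 * ∑ i ∈ Finset.range N, Var[fun ω => f (W i ω); μ]
        ≤ ((N : ℝ)⁻¹) ^ 2 * ∑ i ∈ Finset.range N, ∫ w, f w ^ 2 ∂P := by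
          gcongr with i; exact hv i
      _ = _ := by simp; field_simp
  · intro i _ j _ hij
    refine IndepFun.comp₀ (h.indep.indepFun hij) (h.meas i).aemeasurable (h.meas j).aemeasurable
      (φ := f) (ψ := f) ?_ ?_
    · rw [h.law i]; exact hf.aemeasurable
    · rw [h.law j]; exact hf.aemeasurable

/-- The weak law of large numbers. -/
lemma tendsto_emp (h : IsIIDSample μ P W) {f : 𝒲 → ℝ} (hf : Integrable f P) :
    Tendsto (fun x : ℕ × Ω => emp x.1 (fun i => W i x.2) f) (inProb μ) (𝓝 (∫ w, f w ∂P)) := by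
  refine tendsto_inProb_of_ae (X := fun N ω => emp N (fun i => W i ω) f)
    (fun N => (h.integrable_emp hf N).aestronglyMeasurable) ?_
  have hs := strong_law_ae_real (fun i ω => f (W i ω)) (h.integrable hf 0) ?_ ?_
  · filter_upwards [hs] with ω hω
    rw [h.integral hf.aestronglyMeasurable] at hω
    refine hω.congr fun N => ?_
    simp [emp, div_eq_inv_mul]
  · intro i j hij
    refine IndepFun.comp₀ (h.indep.indepFun hij) (h.meas i).aemeasurable (h.meas j).aemeasurable
      (φ := f) (ψ := f) ?_ ?_
    · rw [h.law i]; exact hf.aemeasurable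
    · rw [h.law j]; exact hf.aemeasurable
  · intro i
    refine ⟨(h.integrable hf i).aemeasurable, (h.integrable hf 0).aemeasurable, ?_⟩
    have hc : ∀ k, μ.map (fun ω => f (W k ω)) = P.map f := fun k => by
      rw [← h.law k]
      refine (AEMeasurable.map_map_of_aemeasurable ?_ (h.meas k).aemeasurable).symm
      rw [h.law k]; exact hf.aemeasurable
    rw [hc i, hc 0]

/-- Chebyshev's inequality for vectors of empirical means, in a triangular array. -/
lemma tendsto_sum_sq_emp_sub (h : IsIIDSample μ P W) {ι : ℕ → Type*} [∀ N, Fintype (ι N)]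
    {f : (N : ℕ) → ι N → 𝒲 → ℝ} {c a : ℕ → ℝ} (ha : ∀ N, 0 ≤ a N)
    (hf : ∀ᶠ N in atTop, (∀ k, MemLp (f N k) 2 P) ∧ a N * ∑ k, ∫ w, f N k w ^ 2 ∂P ≤ c N * N)
    (hc : Tendsto c atTop (𝓝 0)) :
    Tendsto (fun x : ℕ × Ω => a x.1 * ∑ k, (emp x.1 (fun i => W i x.2) (f x.1 k)
      - ∫ w, f x.1 k w ∂P) ^ 2) (inProb μ) (𝓝 0) := by
  have : IsProbabilityMeasure P := by
    rw [← h.law 0]; exact Measure.isProbabilityMeasure_map (h.meas 0).aemeasurable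
  refine tendsto_inProb_of_integral (X := fun N ω => a N * ∑ k, (emp N (fun i => W i ω) (f N k)
      - ∫ w, f N k w ∂P) ^ 2) (c := c) ?_ hc
  filter_upwards [hf, eventually_ne_atTop 0] with N hfN hN
  obtain ⟨hL, hle⟩ := hfN
  have hi : ∀ k, Integrable (fun ω => (emp N (fun i => W i ω) (f N k)
      - ∫ w, f N k w ∂P) ^ 2) μ := fun k =>
    ((h.memLp_emp (hL k) N).sub (memLp_const _)).integrable_sq
  refine ⟨(integrable_finsetSum _ fun k _ => hi k).const_mul _,
    fun ω => mul_nonneg (ha N) (Finset.sum_nonneg fun k _ => sq_nonneg _), ?_⟩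
  rw [integral_const_mul, integral_finsetSum _ fun k _ => hi k]
  have hN' : (0 : ℝ) < N := by exact_mod_cast Nat.pos_of_ne_zero hN
  calc a N * ∑ k, ∫ ω, (emp N (fun i => W i ω) (f N k) - ∫ w, f N k w ∂P) ^ 2 ∂μ
      ≤ a N * ∑ k, (∫ w, f N k w ^ 2 ∂P) / N := by
        gcongr with k
        · exact ha N
        · exact h.integral_sq_emp_sub_le (hL k) hN
    _ = (a N * ∑ k, ∫ w, f N k w ^ 2 ∂P) / N := by rw [← Finset.sum_div]; ring
    _ ≤ c N := by rwa [div_le_iff₀ hN']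

end IsIIDSample

end Sample

end

end MNAR

namespace MNAR

noncomputable section

/-! ### The central limit theorem through characteristic functions -/

section CLT

variable {Ω 𝒲 : Type*} [MeasurableSpace Ω] [MeasurableSpace 𝒲]
  {μ : Measure Ω} [IsProbabilityMeasure μ] {P : Measure 𝒲} {W : ℕ → Ω → 𝒲}

lemma IsIIDSample.isProbabilityMeasure (h : IsIIDSample μ P W) : IsProbabilityMeasure P := by
  rw [← h.law 0]; exact Measure.isProbabilityMeasure_map (h.meas 0).aemeasurable

/-- The characteristic function of a normalized sum of centred variables. -/
lemma IsIIDSample.tendsto_charFun (h : IsIIDSample μ P W) {f : 𝒲 → ℝ} (hf : MemLp f 2 P)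
    (h0 : ∫ w, f w ∂P = 0) :
    Tendsto (fun N : ℕ => charFun (μ.map fun ω => √(N : ℝ) * emp N (fun i => W i ω) f) 1) atTop
      (𝓝 (Complex.exp (-(∫ w, f w ^ 2 ∂P : ℝ) / 2))) := by
  have hid : ∀ i, IdentDistrib (fun ω => f (W i ω)) (fun ω => f (W 0 ω)) μ μ := by
    intro i
    refine ⟨(h.memLp hf i).aemeasurable, (h.memLp hf 0).aemeasurable, ?_⟩
    have hc : ∀ k, μ.map (fun ω => f (W k ω)) = P.map f := fun k => by
      rw [← h.law k]
      refine (AEMeasurable.map_map_of_aemeasurable ?_ (h.meas k).aemeasurable).symm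
      rw [h.law k]; exact hf.aemeasurable
    rw [hc i, hc 0]
  have hind : iIndepFun (fun i ω => f (W i ω)) μ := by
    refine h.indep.comp₀ (fun _ => f) (fun i => (h.meas i).aemeasurable) fun i => ?_
    rw [h.law i]; exact hf.aemeasurable
  have hm : μ[fun ω => f (W 0 ω)] = 0 := (h.integral hf.aestronglyMeasurable 0).trans h0
  have hvar : Var[fun ω => f (W 0 ω); μ] = ∫ w, f w ^ 2 ∂P := by
    rw [variance_eq_sub (h.memLp hf 0), hm]
    have := h.integral (f := fun w => f w ^ 2) (hf.aestronglyMeasurable.pow 2) 0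
    simpa using this
  have hclt := tendstoInDistribution_inv_sqrt_mul_sum_sub (P := μ)
    (X := fun i ω => f (W i ω)) (Y := id)
    (P' := gaussianReal 0 Var[fun ω => f (W 0 ω); μ].toNNReal)
    ⟨by fun_prop, by simp⟩ (h.memLp hf 0) hind hid
  -- The frequency 1 is enough: the multivariate version absorbs the frequency vector into `f`.
  have ht := (ProbabilityMeasure.tendsto_iff_tendsto_charFun.1 hclt.tendsto) 1
  simp only [ProbabilityMeasure.coe_mk, Measure.map_id, charFun_gaussianReal, hm, hvar] at ht
  have hnn : 0 ≤ ∫ w, f w ^ 2 ∂P := integral_nonneg fun w => sq_nonneg _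
  have hlim : Complex.exp ((1 : ℝ) * (0 : ℝ) * Complex.I
      - ((∫ w, f w ^ 2 ∂P).toNNReal : ℝ) * (1 : ℝ) ^ 2 / 2)
      = Complex.exp (-(∫ w, f w ^ 2 ∂P : ℝ) / 2) := by
    rw [Real.coe_toNNReal _ hnn]
    congr 1
    push_cast
    ring
  rw [← hlim]
  convert ht using 4 with N ω
  ext ω
  simp only [emp, mul_zero, sub_zero]
  rcases Nat.eq_zero_or_pos N with rfl | hN
  · simp
  · have : (0 : ℝ) < N := by exact_mod_cast hN
    rw [← mul_assoc]
    congr 1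
    rw [← div_eq_mul_inv, Real.sqrt_div_self', one_div]

/-- The multivariate central limit theorem for centred variables. -/
theorem IsIIDSample.tendstoInDistribution_toLp (h : IsIIDSample μ P W) {ι : Type*} [Fintype ι]
    [DecidableEq ι] {ζ : ι → 𝒲 → ℝ} (hζ : ∀ a, MemLp (ζ a) 2 P) (h0 : ∀ a, ∫ w, ζ a w ∂P = 0)
    {V : Matrix ι ι ℝ} (hV : V.PosSemidef) (hcov : ∀ a b, ∫ w, ζ a w * ζ b w ∂P = V a b) :
    TendstoInDistribution
      (fun (N : ℕ) ω => WithLp.toLp 2 (fun a => √(N : ℝ) * emp N (fun i => W i ω) (ζ a)))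
      atTop id (fun _ => μ) (multivariateGaussian 0 V) := by
  have hX : ∀ N : ℕ, AEMeasurable (fun ω => (WithLp.toLp 2
      (fun a => √(N : ℝ) * emp N (fun i => W i ω) (ζ a)) : EuclideanSpace ℝ ι)) μ := by
    intro N
    refine (PiLp.continuous_toLp 2 _).measurable.comp_aemeasurable (aemeasurable_pi_lambda _ ?_)
    intro a
    exact ((h.memLp_emp (hζ a) N).aemeasurable).const_mul _
  refine ⟨hX, by fun_prop, ?_⟩
  refine ProbabilityMeasure.tendsto_iff_tendsto_charFun.2 fun t => ?_
  simp only [ProbabilityMeasure.coe_mk, Measure.map_id, charFun_multivariateGaussian hV]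
  -- Cramér–Wold: the characteristic function of the vector at t is that of the scalar array built
  -- from t · ζ, at frequency 1.
  have hL : MemLp (fun w => ∑ a, t a * ζ a w) 2 P :=
    memLp_finsetSum _ fun a _ => (hζ a).const_mul _
  have hP := h.isProbabilityMeasure
  have hI : ∫ w, ∑ a, t a * ζ a w ∂P = 0 := by
    rw [integral_finsetSum _ fun a _ => ((hζ a).integrable one_le_two).const_mul _]
    simp [integral_const_mul, h0]
  have hsq : ∫ w, (∑ a, t a * ζ a w) ^ 2 ∂P = t ⬝ᵥ V *ᵥ t := by
    have : ∀ w, (∑ a, t a * ζ a w) ^ 2 = ∑ a, ∑ b, t a * t b * (ζ a w * ζ b w) := by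
      intro w
      rw [sq, Finset.sum_mul_sum]
      refine Finset.sum_congr rfl fun a _ => Finset.sum_congr rfl fun b _ => by ring
    have hi : ∀ a b, Integrable (fun w => t a * t b * (ζ a w * ζ b w)) P := fun a b =>
      ((hζ a).integrable_mul (hζ b)).const_mul _
    simp only [this]
    rw [integral_finsetSum _ fun a _ => integrable_finsetSum _ fun b _ => hi a b]
    simp only [dotProduct, Matrix.mulVec, Finset.mul_sum]
    refine Finset.sum_congr rfl fun a _ => ?_
    rw [integral_finsetSum _ fun b _ => hi a b]
    refine Finset.sum_congr rfl fun b _ => ?_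
    rw [integral_const_mul, hcov]
    ring
  have key := h.tendsto_charFun hL hI
  rw [hsq] at key
  have hlim : Complex.exp (inner ℝ t (0 : EuclideanSpace ℝ ι) * Complex.I
      - (t ⬝ᵥ V *ᵥ t : ℝ) / 2) = Complex.exp (-(t ⬝ᵥ V *ᵥ t : ℝ) / 2) := by
    rw [inner_zero_right]
    congr 1
    push_cast
    ring
  rw [hlim]
  refine key.congr fun N => ?_
  rw [charFun_apply, charFun_apply, integral_map (hX N) (by fun_prop),
    integral_map ((h.memLp_emp hL N).aemeasurable.const_mul _) (by fun_prop)]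
  refine integral_congr_ae (ae_of_all _ fun ω => ?_)
  simp only [EuclideanSpace.inner_eq_star_dotProduct, star_trivial, dotProduct]
  congr 3
  have e : (emp N (fun i => W i ω) fun w => ∑ a, t a * ζ a w)
      = ∑ a, t a * emp N (fun i => W i ω) (ζ a) := by
    rw [emp_sum]
    exact Finset.sum_congr rfl fun a _ => emp_const_mul _ _
  rw [e, Finset.mul_sum]
  simp
  refine Finset.sum_congr rfl fun a _ => by ring

end CLT

/-! ### Euclidean norms of plain vectors -/

section Eucl

variable {κ : Type*} [Fintype κ]

/-- The Euclidean norm of a vector `v : κ → ℝ`. -/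
def eucl (v : κ → ℝ) : ℝ := √(v ⬝ᵥ v)

lemma dotProduct_self_nonneg' (v : κ → ℝ) : 0 ≤ v ⬝ᵥ v :=
  Finset.sum_nonneg fun _ _ => mul_self_nonneg _

lemma eucl_nonneg (v : κ → ℝ) : 0 ≤ eucl v := Real.sqrt_nonneg _

lemma eucl_sq (v : κ → ℝ) : eucl v ^ 2 = v ⬝ᵥ v := Real.sq_sqrt (dotProduct_self_nonneg' v)

lemma eucl_eq_norm (v : κ → ℝ) : eucl v = ‖(WithLp.toLp 2 v : EuclideanSpace ℝ κ)‖ := by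
  rw [EuclideanSpace.norm_eq, eucl]
  simp [dotProduct, sq]

lemma abs_dotProduct_le (v w : κ → ℝ) : |v ⬝ᵥ w| ≤ eucl v * eucl w := by
  rw [eucl, eucl, ← Real.sqrt_mul (dotProduct_self_nonneg' v)]
  refine Real.abs_le_sqrt ?_
  have := Finset.sum_mul_sq_le_sq_mul_sq Finset.univ v w
  simpa [dotProduct, sq] using this

lemma eucl_add_le (v w : κ → ℝ) : eucl (v + w) ≤ eucl v + eucl w := by
  simp only [eucl_eq_norm, WithLp.toLp_add]
  exact norm_add_le _ _

lemma eucl_neg (v : κ → ℝ) : eucl (-v) = eucl v := by simp [eucl]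

/-- Duality, by testing against v itself. It turns Cauchy–Schwarz bounds for scalar empirical means
into bounds for vectors of empirical means that do not grow with the number of coordinates. -/
lemma eucl_le_of_forall {v : κ → ℝ} {c : ℝ} (h : ∀ w, |w ⬝ᵥ v| ≤ c * eucl w) (hc : 0 ≤ c) :
    eucl v ≤ c := by
  have h1 := h v
  rw [← eucl_sq, abs_of_nonneg (sq_nonneg _), sq] at h1
  rcases (eucl_nonneg v).eq_or_lt with h0 | h0
  · rwa [← h0]
  · exact le_of_mul_le_mul_right h1 h0

lemma abs_le_eucl (v : κ → ℝ) (k : κ) : |v k| ≤ eucl v := by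
  refine Real.abs_le_sqrt ?_
  rw [sq]
  exact Finset.single_le_sum (f := fun k => v k * v k) (fun _ _ => mul_self_nonneg _)
    (Finset.mem_univ k)

lemma eucl_smul (c : ℝ) (v : κ → ℝ) : eucl (c • v) = |c| * eucl v := by
  rw [eucl_eq_norm, WithLp.toLp_smul, norm_smul, Real.norm_eq_abs, ← eucl_eq_norm]

/-- Cauchy–Schwarz in each row: the Frobenius norm dominates the operator norm. -/
lemma eucl_mulVec_sq_le (B : Matrix κ κ ℝ) (v : κ → ℝ) :
    eucl (B *ᵥ v) ^ 2 ≤ (∑ i, ∑ j, B i j ^ 2) * eucl v ^ 2 := by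
  rw [eucl_sq, eucl_sq, dotProduct, Finset.sum_mul]
  refine Finset.sum_le_sum fun i _ => ?_
  have := Finset.sum_mul_sq_le_sq_mul_sq Finset.univ (B i) v
  simpa [Matrix.mulVec, dotProduct, sq] using this

end Eucl

/-! ### Quadratic forms with bounded eigenvalues -/

section Quad

variable {κ : Type*} [Fintype κ] [DecidableEq κ] {A : Matrix κ κ ℝ} {c C : ℝ}

/-- `A` is symmetric with eigenvalues in `[c, C]`. -/
structure EigIn (A : Matrix κ κ ℝ) (c C : ℝ) : Prop where
  symm : Aᵀ = A
  lower : ∀ v, c * eucl v ^ 2 ≤ v ⬝ᵥ A *ᵥ v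
  upper : ∀ v, v ⬝ᵥ A *ᵥ v ≤ C * eucl v ^ 2

namespace EigIn

omit [DecidableEq κ] in
lemma dotProduct_comm (h : EigIn A c C) (v w : κ → ℝ) : v ⬝ᵥ A *ᵥ w = (A *ᵥ v) ⬝ᵥ w := by
  rw [Matrix.dotProduct_mulVec, ← Matrix.mulVec_transpose, h.symm]

/-- A kernel vector would have zero quadratic form. This is what keeps the convention A⁻¹ = 0 for
singular A out of the argument. -/
lemma isUnit_det (h : EigIn A c C) (hc : 0 < c) : IsUnit A.det := by
  rw [isUnit_iff_ne_zero]
  intro h0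
  obtain ⟨v, hv, hAv⟩ := Matrix.exists_mulVec_eq_zero_iff.2 h0
  have := h.lower v
  rw [hAv, dotProduct_zero, eucl_sq] at this
  have h2 : 0 < v ⬝ᵥ v :=
    lt_of_le_of_ne (dotProduct_self_nonneg' v) fun h => hv (dotProduct_self_eq_zero.1 h.symm)
  nlinarith

lemma mulVec_inv (h : EigIn A c C) (hc : 0 < c) (v : κ → ℝ) : A *ᵥ (A⁻¹ *ᵥ v) = v := by
  rw [Matrix.mulVec_mulVec, Matrix.mul_nonsing_inv _ (h.isUnit_det hc), Matrix.one_mulVec]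

/-- With w = A⁻¹ v, c|w|² ≤ w · Aw = w · v ≤ |w||v|. -/
lemma eucl_inv_le (h : EigIn A c C) (hc : 0 < c) (v : κ → ℝ) :
    eucl (A⁻¹ *ᵥ v) ≤ eucl v / c := by
  rw [le_div_iff₀ hc]
  have h1 := h.lower (A⁻¹ *ᵥ v)
  rw [h.mulVec_inv hc] at h1
  have h2 := (le_abs_self _).trans (abs_dotProduct_le (A⁻¹ *ᵥ v) v)
  rcases (eucl_nonneg (A⁻¹ *ᵥ v)).eq_or_lt with h0 | h0
  · rw [← h0, zero_mul]; exact eucl_nonneg v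
  · refine le_of_mul_le_mul_left ?_ h0
    linarith

lemma inv_upper (h : EigIn A c C) (hc : 0 < c) (v : κ → ℝ) :
    v ⬝ᵥ A⁻¹ *ᵥ v ≤ eucl v ^ 2 / c := by
  have h2 := (le_abs_self _).trans (abs_dotProduct_le v (A⁻¹ *ᵥ v))
  have h3 := mul_le_mul_of_nonneg_left (h.eucl_inv_le hc v) (eucl_nonneg v)
  calc v ⬝ᵥ A⁻¹ *ᵥ v ≤ eucl v * (eucl v / c) := h2.trans h3
    _ = _ := by ring

/-- Completing the square instead of diagonalizing: with w = A⁻¹ v, expand the nonnegative form of A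
at w - C⁻¹ v and bound its v · Av term from above. -/
lemma inv_lower (h : EigIn A c C) (hc : 0 < c) (hC : 0 < C) (v : κ → ℝ) :
    eucl v ^ 2 / C ≤ v ⬝ᵥ A⁻¹ *ᵥ v := by
  set w := A⁻¹ *ᵥ v with hw
  have hAw : A *ᵥ w = v := h.mulVec_inv hc v
  have h1 := h.lower (w - C⁻¹ • v)
  have h2 := h.upper v
  have h3 : (w - C⁻¹ • v) ⬝ᵥ A *ᵥ (w - C⁻¹ • v)
      = v ⬝ᵥ w - 2 * C⁻¹ * eucl v ^ 2 + C⁻¹ ^ 2 * (v ⬝ᵥ A *ᵥ v) := by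
    rw [Matrix.mulVec_sub, Matrix.mulVec_smul, hAw, eucl_sq]
    simp only [sub_dotProduct, dotProduct_sub, smul_dotProduct, dotProduct_smul, smul_eq_mul]
    rw [h.dotProduct_comm w v, hAw, _root_.dotProduct_comm w v]
    ring
  have h4 : 0 ≤ c * eucl (w - C⁻¹ • v) ^ 2 := by positivity
  have h5 : C⁻¹ ^ 2 * (v ⬝ᵥ A *ᵥ v) ≤ C⁻¹ ^ 2 * (C * eucl v ^ 2) := by gcongr
  have h6 : C⁻¹ ^ 2 * (C * eucl v ^ 2) = C⁻¹ * eucl v ^ 2 := by field_simp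
  rw [div_eq_inv_mul]
  linarith

end EigIn

end Quad

end

end MNAR

namespace MNAR

noncomputable section

/-! ### Uniform regularity of the response model -/

namespace Model

variable {r p : ℕ} (M : Model r p)

/-- The gradient in `γ` of `1 - T / π(Z; γ)`. -/
def dres (γ : EuclideanSpace ℝ (Fin p)) (w : Obs r) : EuclideanSpace ℝ (Fin p) →L[ℝ] ℝ :=
  (tInd w / M.prob (zVec w) γ ^ 2) • fderiv ℝ (M.prob (zVec w)) γ

/-- Uniform bounds on the response probability and the matching functions, on a set `S` of
observations of full probability. -/
structure Regular (S : Set (Obs r)) (c C ρ : ℝ) : Prop where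
  ae_mem : ∀ᵐ w ∂M.P, w ∈ S
  c_pos : 0 < c
  one_le : 1 ≤ C
  ρ_pos : 0 < ρ
  ball_sub : Metric.ball M.γ₀ ρ ⊆ interior M.Γ
  le_prob : ∀ w ∈ S, ∀ γ ∈ M.Γ, c ≤ M.prob (zVec w) γ
  prob_le : ∀ w ∈ S, ∀ γ ∈ M.Γ, M.prob (zVec w) γ ≤ 1 - c
  abs_resid_le : ∀ w ∈ S, ∀ γ ∈ M.Γ, |M.resid γ w| ≤ C
  resid_cont : ∀ w ∈ S, ContinuousOn (fun γ => M.resid γ w) M.Γ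
  differentiable : ∀ w ∈ S, DifferentiableAt ℝ (M.prob (zVec w)) M.γ₀
  hasFDerivAt : ∀ w ∈ S, ∀ γ ∈ Metric.ball M.γ₀ ρ,
    HasFDerivAt (fun γ => M.resid γ w) (M.dres γ w) γ
  dres_le : ∀ w ∈ S, ∀ γ ∈ Metric.ball M.γ₀ ρ, ‖M.dres γ w‖ ≤ C
  dres_lip : ∀ w ∈ S, ∀ γ ∈ Metric.ball M.γ₀ ρ, ∀ γ' ∈ Metric.ball M.γ₀ ρ,
    ‖M.dres γ w - M.dres γ' w‖ ≤ C * ‖γ - γ'‖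
  gradProb_le : ∀ w ∈ S, ∀ j, |M.gradProb (zVec w) M.γ₀ j| ≤ C
  eucl_u_le : ∀ w ∈ S, ∀ K, p ≤ K → eucl (M.u K (xVec w)) ≤ C * K

variable {M}

lemma tInd_nonneg (w : Obs r) : 0 ≤ tInd w := by unfold tInd; split <;> norm_num

lemma tInd_le_one (w : Obs r) : tInd w ≤ 1 := by unfold tInd; split <;> norm_num

lemma tInd_sq (w : Obs r) : tInd w ^ 2 = tInd w := by unfold tInd; split <;> norm_num

lemma measurable_tInd : Measurable (tInd (r := r)) := by
  unfold tInd
  refine Measurable.ite ?_ measurable_const measurable_const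
  exact measurable_fst (measurableSet_singleton true)

lemma measurable_zVec : Measurable (zVec (r := r)) := measurable_snd

lemma measurable_xVec : Measurable (xVec (r := r)) := measurable_fst.comp measurable_snd

/-- The difference is -(a + b)(a - b)/(a²b²), with a + b ≤ 2 and a²b² ≥ c⁴. It controls the factor
π⁻² in `dres`. -/
lemma abs_inv_sq_sub_le {a b c : ℝ} (hc : 0 < c) (ha : c ≤ a) (hb : c ≤ b) (ha1 : a ≤ 1)
    (hb1 : b ≤ 1) : |1 / a ^ 2 - 1 / b ^ 2| ≤ 2 / c ^ 4 * |a - b| := by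
  have ha0 : 0 < a := hc.trans_le ha
  have hb0 : 0 < b := hc.trans_le hb
  have h : 1 / a ^ 2 - 1 / b ^ 2 = -((a + b) / (a ^ 2 * b ^ 2)) * (a - b) := by
    field_simp
    ring
  rw [h, abs_mul, abs_neg, abs_of_nonneg (by positivity : 0 ≤ (a + b) / (a ^ 2 * b ^ 2))]
  gcongr
  · linarith
  · calc c ^ 4 = c ^ 2 * c ^ 2 := by ring
      _ ≤ a ^ 2 * b ^ 2 := by gcongr

/-- The set S consists of the observations with X in the box, the support of its law. The first and
second derivative bounds hold only in the interior of Γ, which need not be convex; on a ball around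
γ₀ inside it the mean value inequality turns them into Lipschitz bounds. -/
theorem Assumptions.exists_regular (hM : M.Assumptions) :
    ∃ S c C ρ, M.Regular S c C ρ := by
  obtain ⟨a, b, -, hsupp, -, ⟨c, c', hc, hc', hprob⟩, hsmooth, ⟨C₁, hC₁⟩, ⟨C₂, hC₂⟩⟩ := hM.box
  obtain ⟨ρ, hρ, hball⟩ := Metric.isOpen_iff.1 isOpen_interior M.γ₀ hM.γ₀_mem
  have := hM.isProb
  have hC₁' : ∀ x ∈ Icc a b, ∀ y : ℝ, ∀ γ ∈ interior M.Γ,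
      ‖fderiv ℝ (M.prob (x, y)) γ‖ ≤ |C₁| ∧ ‖iteratedFDeriv ℝ 2 (M.prob (x, y)) γ‖ ≤ |C₁| :=
    fun x hx y γ hγ => ⟨(hC₁ x hx y γ hγ).1.trans (le_abs_self _),
      (hC₁ x hx y γ hγ).2.trans (le_abs_self _)⟩
  set S : Set (Obs r) := {w | xVec w ∈ Icc a b} with hS
  set e : ℝ := min c (1 - c') with he
  have he0 : 0 < e := lt_min hc (by linarith)
  -- The Lipschitz constant of T π⁻² ∇π by the product rule: the first term comes from varying ∇π,
  -- the second from varying π⁻².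
  set D : ℝ := |C₁| / e ^ 2 + 2 / e ^ 4 * |C₁| * |C₁| with hD
  have hD0 : 0 ≤ D := by positivity
  have hsub : ∀ γ ∈ Metric.ball M.γ₀ ρ, γ ∈ M.Γ := fun γ hγ => interior_subset (hball hγ)
  have hlow : ∀ w ∈ S, ∀ γ ∈ M.Γ, e ≤ M.prob (zVec w) γ := fun w hw γ hγ =>
    (min_le_left _ _).trans (hprob _ hw _ γ hγ).1
  have hup : ∀ w ∈ S, ∀ γ ∈ M.Γ, M.prob (zVec w) γ ≤ 1 - e := fun w hw γ hγ => by
    have := (hprob _ hw (yVal w) γ hγ).2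
    have h2 := min_le_right c (1 - c')
    have h3 : M.prob (zVec w) γ ≤ c' := this
    linarith
  have hcda : ∀ w ∈ S, ∀ γ ∈ Metric.ball M.γ₀ ρ, ContDiffAt ℝ 2 (M.prob (zVec w)) γ :=
    fun w hw γ hγ => ((hsmooth _ hw (yVal w)).2).contDiffAt (isOpen_interior.mem_nhds (hball hγ))
  have hdiff : ∀ w ∈ S, ∀ γ ∈ Metric.ball M.γ₀ ρ, DifferentiableAt ℝ (M.prob (zVec w)) γ :=
    fun w hw γ hγ => (hcda w hw γ hγ).differentiableAt (by norm_num)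
  have hplip : ∀ w ∈ S, ∀ γ ∈ Metric.ball M.γ₀ ρ, ∀ γ' ∈ Metric.ball M.γ₀ ρ,
      |M.prob (zVec w) γ - M.prob (zVec w) γ'| ≤ |C₁| * ‖γ - γ'‖ := fun w hw γ hγ γ' hγ' =>
    (convex_ball M.γ₀ ρ).norm_image_sub_le_of_norm_fderiv_le (fun x hx => hdiff w hw x hx)
      (fun x hx => (hC₁' _ hw (yVal w) x (hball hx)).1) hγ' hγ
  have hdlip : ∀ w ∈ S, ∀ γ ∈ Metric.ball M.γ₀ ρ, ∀ γ' ∈ Metric.ball M.γ₀ ρ,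
      ‖fderiv ℝ (M.prob (zVec w)) γ - fderiv ℝ (M.prob (zVec w)) γ'‖ ≤ |C₁| * ‖γ - γ'‖ :=
    fun w hw γ hγ γ' hγ' =>
    (convex_ball M.γ₀ ρ).norm_image_sub_le_of_norm_fderiv_le
      (fun x hx => ((hcda w hw x hx).fderiv_right (m := 1) (by norm_num)).differentiableAt
        (by norm_num))
      (fun x hx => by
        have h2 := (hC₁' _ hw (yVal w) x (hball hx)).2
        rw [← norm_iteratedFDeriv_one, norm_iteratedFDeriv_fderiv]
        exact h2) hγ' hγ
  have hγ₀ball : M.γ₀ ∈ Metric.ball M.γ₀ ρ := Metric.mem_ball_self hρ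
  have hfrac : ∀ w ∈ S, ∀ γ ∈ M.Γ, |tInd w / M.prob (zVec w) γ ^ 2| ≤ 1 / e ^ 2 := by
    intro w hw γ hγ
    have h1 := hlow w hw γ hγ
    rw [abs_of_nonneg (div_nonneg (tInd_nonneg w) (sq_nonneg _))]
    have := tInd_le_one w
    gcongr
  have hdres : ∀ w ∈ S, ∀ γ ∈ Metric.ball M.γ₀ ρ, ‖M.dres γ w‖ ≤ |C₁| / e ^ 2 := by
    intro w hw γ hγ
    rw [dres, norm_smul, Real.norm_eq_abs]
    calc _ ≤ 1 / e ^ 2 * |C₁| := mul_le_mul (hfrac w hw γ (hsub γ hγ))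
            (hC₁' _ hw (yVal w) γ (hball hγ)).1 (norm_nonneg _) (by positivity)
      _ = _ := by ring
  -- One constant dominating every bound; the summand 1 also gives 1 ≤ C, which is used later to
  -- merge bounds.
  refine ⟨S, e, 1 + 1 / e + D + |C₁| + |C₂|, ρ, ?_⟩
  have h1e : 0 < 1 / e := by positivity
  refine
  { ae_mem := ?_
    c_pos := he0
    one_le := by linarith [abs_nonneg C₁, abs_nonneg C₂]
    ρ_pos := hρ
    ball_sub := hball
    le_prob := hlow
    prob_le := hup
    abs_resid_le := ?_
    resid_cont := ?_
    differentiable := fun w hw => hdiff w hw _ hγ₀ball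
    hasFDerivAt := ?_
    dres_le := ?_
    dres_lip := ?_
    gradProb_le := ?_
    eucl_u_le := ?_ }
  · have h := Measure.support_mem_ae (μ := M.P.map xVec)
    rw [hsupp] at h
    exact (mem_ae_map_iff measurable_xVec.aemeasurable measurableSet_Icc).1 h
  · intro w hw γ hγ
    have h1 := hlow w hw γ hγ
    have h2 : 0 ≤ tInd w / M.prob (zVec w) γ := div_nonneg (tInd_nonneg w) (he0.le.trans h1)
    have h3 : tInd w / M.prob (zVec w) γ ≤ 1 / e := by
      have := tInd_le_one w
      gcongr
    rw [resid, abs_le]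
    constructor <;> linarith [abs_nonneg C₁, abs_nonneg C₂]
  · intro w hw
    unfold resid
    refine continuousOn_const.sub (continuousOn_const.div (hsmooth _ hw (yVal w)).1 ?_)
    exact fun γ hγ => (he0.trans_le (hlow w hw γ hγ)).ne'
  · intro w hw γ hγ
    have h0 : M.prob (zVec w) γ ≠ 0 := (he0.trans_le (hlow w hw γ (hsub γ hγ))).ne'
    have h1 := ((hasDerivAt_inv h0).comp_hasFDerivAt γ (hdiff w hw γ hγ).hasFDerivAt).const_mul
      (tInd w)
    have h2 := h1.const_sub 1
    refine (h2.congr_fderiv ?_)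
    ext v
    simp [dres]
    ring
  · intro w hw γ hγ
    have : 0 ≤ 2 / e ^ 4 * |C₁| * |C₁| := by positivity
    linarith [hdres w hw γ hγ, abs_nonneg C₁, abs_nonneg C₂]
  · intro w hw γ hγ γ' hγ'
    have hsplit : M.dres γ w - M.dres γ' w
        = (tInd w / M.prob (zVec w) γ ^ 2) •
            (fderiv ℝ (M.prob (zVec w)) γ - fderiv ℝ (M.prob (zVec w)) γ')
          + (tInd w * (1 / M.prob (zVec w) γ ^ 2 - 1 / M.prob (zVec w) γ' ^ 2)) •
            fderiv ℝ (M.prob (zVec w)) γ' := by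
      rw [dres, dres]
      module
    have h1 : ‖(tInd w / M.prob (zVec w) γ ^ 2) •
            (fderiv ℝ (M.prob (zVec w)) γ - fderiv ℝ (M.prob (zVec w)) γ')‖
          ≤ 1 / e ^ 2 * (|C₁| * ‖γ - γ'‖) := by
      rw [norm_smul, Real.norm_eq_abs]
      exact mul_le_mul (hfrac w hw γ (hsub γ hγ)) (hdlip w hw γ hγ γ' hγ') (norm_nonneg _)
        (by positivity)
    have h2 : ‖(tInd w * (1 / M.prob (zVec w) γ ^ 2 - 1 / M.prob (zVec w) γ' ^ 2)) •
            fderiv ℝ (M.prob (zVec w)) γ'‖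
          ≤ (2 / e ^ 4 * (|C₁| * ‖γ - γ'‖)) * |C₁| := by
      rw [norm_smul, Real.norm_eq_abs, abs_mul, abs_of_nonneg (tInd_nonneg w)]
      refine mul_le_mul ?_ (hC₁' _ hw (yVal w) γ' (hball hγ')).1 (norm_nonneg _) (by positivity)
      have hi := abs_inv_sq_sub_le he0 (hlow w hw γ (hsub γ hγ)) (hlow w hw γ' (hsub γ' hγ'))
        (by linarith [hup w hw γ (hsub γ hγ)]) (by linarith [hup w hw γ' (hsub γ' hγ')])
      calc _ ≤ 1 * (2 / e ^ 4 * |M.prob (zVec w) γ - M.prob (zVec w) γ'|) :=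
            mul_le_mul (tInd_le_one w) hi (abs_nonneg _) zero_le_one
        _ ≤ _ := by
            rw [one_mul]
            gcongr
            exact hplip w hw γ hγ γ' hγ'
    rw [hsplit]
    calc _ ≤ 1 / e ^ 2 * (|C₁| * ‖γ - γ'‖) + (2 / e ^ 4 * (|C₁| * ‖γ - γ'‖)) * |C₁| :=
          (norm_add_le _ _).trans (add_le_add h1 h2)
      _ = D * ‖γ - γ'‖ := by rw [hD]; ring
      _ ≤ _ := by
          gcongr
          linarith [abs_nonneg C₁, abs_nonneg C₂]
  · intro w hw j
    have h1 := (fderiv ℝ (M.prob (zVec w)) M.γ₀).le_opNorm (EuclideanSpace.single j (1 : ℝ))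
    have h2 := (hC₁' _ hw (yVal w) M.γ₀ hM.γ₀_mem).1
    have h3 : ‖EuclideanSpace.single j (1 : ℝ)‖ = 1 := by simp
    rw [h3, mul_one, Real.norm_eq_abs] at h1
    have h4 : |M.gradProb (zVec w) M.γ₀ j| ≤ |C₁| := h1.trans h2
    linarith [abs_nonneg C₂]
  · intro w hw K hK
    rw [eucl_eq_norm]
    refine (hC₂ K hK _ hw).trans ?_
    gcongr
    linarith [le_abs_self C₂, abs_nonneg C₁]

end Model

end

end MNAR

namespace MNAR

noncomputable section

namespace Model

set_option linter.unusedSectionVars false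

variable {r p : ℕ} {M : Model r p} {S : Set (Obs r)} {c C ρ : ℝ}

/-! ### Moments of one observation -/

lemma sigmaZ_le : sigmaZ r ≤ (inferInstance : MeasurableSpace (Obs r)) :=
  measurable_zVec.comap_le

lemma sigmaX_le_sigmaZ : sigmaX r ≤ sigmaZ r := by
  rintro _ ⟨s, hs, rfl⟩
  exact ⟨Prod.fst ⁻¹' s, measurable_fst hs, rfl⟩

lemma sigmaX_le : sigmaX r ≤ (inferInstance : MeasurableSpace (Obs r)) :=
  sigmaX_le_sigmaZ.trans sigmaZ_le

variable (M) in
/-- Almost sure measurability with respect to `Z`. -/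
abbrev ZMeas (F : Obs r → ℝ) : Prop := AEStronglyMeasurable[sigmaZ r] F M.P

variable (M) in
/-- Almost sure measurability with respect to `X`. -/
abbrev XMeas (F : Obs r → ℝ) : Prop := AEStronglyMeasurable[sigmaX r] F M.P

lemma XMeas.zMeas {F : Obs r → ℝ} (h : M.XMeas F) : M.ZMeas F := h.mono sigmaX_le_sigmaZ

lemma ZMeas.aesm {F : Obs r → ℝ} (h : M.ZMeas F) : AEStronglyMeasurable F M.P := h.mono sigmaZ_le

lemma zMeas_comp {f : (Fin r → ℝ) × ℝ → ℝ} (hf : Measurable f) :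
    M.ZMeas (fun w => f (zVec w)) :=
  StronglyMeasurable.aestronglyMeasurable
    (Measurable.stronglyMeasurable (hf.comp (comap_measurable (zVec (r := r)))))

lemma xMeas_comp {f : (Fin r → ℝ) → ℝ} (hf : Measurable f) :
    M.XMeas (fun w => f (xVec w)) :=
  StronglyMeasurable.aestronglyMeasurable
    (Measurable.stronglyMeasurable (hf.comp (comap_measurable (xVec (r := r)))))

lemma Assumptions.γ₀_mem' (hM : M.Assumptions) : M.γ₀ ∈ M.Γ := interior_subset hM.γ₀_mem

lemma Assumptions.zMeas_prob (hM : M.Assumptions) : M.ZMeas (fun w => M.prob (zVec w) M.γ₀) :=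
  zMeas_comp (hM.prob_meas _ hM.γ₀_mem')

lemma Assumptions.zMeas_U (hM : M.Assumptions) : M.ZMeas (fun w => M.U (zVec w)) :=
  zMeas_comp hM.U_meas

lemma Assumptions.zMeas_odds (hM : M.Assumptions) : M.ZMeas M.odds :=
  zMeas_comp (f := fun z => (1 - M.prob z M.γ₀) / M.prob z M.γ₀)
    ((measurable_const.sub (hM.prob_meas _ hM.γ₀_mem')).div (hM.prob_meas _ hM.γ₀_mem'))

/-- No measurability of the gradient in z is assumed. It is the limit on S of difference quotients
of functions measurable in z. -/
lemma Regular.zMeas_gradProb (hR : M.Regular S c C ρ) (hM : M.Assumptions) (j : Fin p) :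
    M.ZMeas (fun w => M.gradProb (zVec w) M.γ₀ j) := by
  set e : EuclideanSpace ℝ (Fin p) := EuclideanSpace.single j 1
  have hlim : Tendsto (fun n : ℕ => M.γ₀ + ((n : ℝ))⁻¹ • e) atTop (𝓝 M.γ₀) := by
    have h1 : Tendsto (fun n : ℕ => ((n : ℝ))⁻¹ • e) atTop (𝓝 ((0 : ℝ) • e)) :=
      (tendsto_inv_atTop_nhds_zero_nat (𝕜 := ℝ)).smul_const e
    simpa using h1.const_add M.γ₀
  have hΓ : M.Γ ∈ 𝓝 M.γ₀ := mem_interior_iff_mem_nhds.1 hM.γ₀_mem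
  -- Measurability of π(·; γ) is known only for γ in Γ, so the sequence starts once γ₀ + e/n has
  -- entered Γ.
  obtain ⟨n₀, hn₀⟩ := eventually_atTop.1 (hlim.eventually_mem hΓ)
  set f : ℕ → (Fin r → ℝ) × ℝ → ℝ := fun n z =>
    ((n + n₀ : ℕ) : ℝ) • (M.prob z (M.γ₀ + (((n + n₀ : ℕ) : ℝ))⁻¹ • e) - M.prob z M.γ₀) with hf
  have hfm : ∀ n, StronglyMeasurable (f n) := fun n =>
    (((hM.prob_meas _ (hn₀ (n + n₀) (by omega))).sub (hM.prob_meas _ hM.γ₀_mem')).const_smul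
      ((n + n₀ : ℕ) : ℝ)).stronglyMeasurable
  have hq := (StronglyMeasurable.limUnder (l := atTop) hfm).measurable
  refine (zMeas_comp hq).congr ?_
  filter_upwards [hR.ae_mem] with w hw
  refine Tendsto.limUnder_eq ?_
  refine (hR.differentiable w hw).hasFDerivAt.lim e (c := fun n : ℕ => ((n + n₀ : ℕ) : ℝ)) ?_
  refine tendsto_norm_atTop_atTop.comp (tendsto_natCast_atTop_atTop.comp ?_)
  exact tendsto_add_atTop_nat n₀

variable (hR : M.Regular S c C ρ) (hM : M.Assumptions)

include hR hM

lemma Regular.prob_bounds {w : Obs r} (hw : w ∈ S) :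
    c ≤ M.prob (zVec w) M.γ₀ ∧ M.prob (zVec w) M.γ₀ ≤ 1 - c :=
  ⟨hR.le_prob w hw _ hM.γ₀_mem', hR.prob_le w hw _ hM.γ₀_mem'⟩

lemma Regular.odds_bounds {w : Obs r} (hw : w ∈ S) : c ≤ M.odds w ∧ M.odds w ≤ 1 / c := by
  obtain ⟨h1, h2⟩ := hR.prob_bounds hM hw
  have hc := hR.c_pos
  have hp : 0 < M.prob (zVec w) M.γ₀ := hc.trans_le h1
  constructor
  · rw [odds, le_div_iff₀ hp]
    nlinarith
  · rw [odds]
    gcongr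
    linarith

lemma Regular.zMeas_S0 (j : Fin p) : M.ZMeas (fun w => M.S0 w j) := by
  have h1 := (hR.zMeas_gradProb hM j).neg
  have h2 : M.ZMeas (fun w => 1 - M.prob (zVec w) M.γ₀) :=
    aestronglyMeasurable_const.sub hM.zMeas_prob
  exact AEStronglyMeasurable.div₀ h1 h2

lemma Regular.abs_S0_le {w : Obs r} (hw : w ∈ S) (j : Fin p) : |M.S0 w j| ≤ C / c := by
  obtain ⟨h1, h2⟩ := hR.prob_bounds hM hw
  have hc := hR.c_pos
  have hC := hR.one_le
  rw [S0, abs_div, abs_neg, abs_of_pos (by linarith : 0 < 1 - M.prob (zVec w) M.γ₀)]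
  gcongr
  · exact hR.gradProb_le w hw j
  · linarith

lemma Regular.memLp_S0 (j : Fin p) : MemLp (fun w => M.S0 w j) 2 M.P := by
  have := hM.isProb
  refine MemLp.of_bound (hR.zMeas_S0 hM j).aesm (C / c) ?_
  filter_upwards [hR.ae_mem] with w hw
  exact hR.abs_S0_le hM hw j

lemma Regular.integrable_tInd_mul {F : Obs r → ℝ} (hF : Integrable F M.P) :
    Integrable (fun w => tInd w * F w) M.P := by
  refine hF.bdd_mul (c := 1) measurable_tInd.aestronglyMeasurable (ae_of_all _ fun w => ?_)
  rw [Real.norm_eq_abs, abs_of_nonneg (tInd_nonneg w)]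
  exact tInd_le_one w

/-- Conditioning on Z pulls F out and replaces T by the response probability. -/
lemma Regular.integral_tInd_mul {F : Obs r → ℝ} (hZ : M.ZMeas F) (hF : Integrable F M.P) :
    ∫ w, tInd w * F w ∂M.P = ∫ w, M.prob (zVec w) M.γ₀ * F w ∂M.P := by
  have := hM.isProb
  have hT : Integrable (tInd (r := r)) M.P := by
    simpa using hR.integrable_tInd_mul hM (integrable_const (μ := M.P) (1 : ℝ))
  have h := condExp_mul_of_aestronglyMeasurable_right (m := sigmaZ r) (f := tInd (r := r)) hZ
    (hR.integrable_tInd_mul hM hF) hT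
  have h1 : ∫ w, tInd w * F w ∂M.P = ∫ w, (M.P[tInd * F | sigmaZ r]) w ∂M.P :=
    (integral_condExp sigmaZ_le).symm
  rw [h1]
  refine integral_congr_ae ?_
  filter_upwards [h, hM.response] with w h2 h3
  rw [h2, Pi.mul_apply, h3]

lemma Regular.zMeas_inv_mul {F : Obs r → ℝ} (hZ : M.ZMeas F) :
    M.ZMeas (fun w => F w / M.prob (zVec w) M.γ₀) := AEStronglyMeasurable.div₀ hZ hM.zMeas_prob

lemma Regular.integrable_div_prob {F : Obs r → ℝ} (hF : Integrable F M.P) :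
    Integrable (fun w => F w / M.prob (zVec w) M.γ₀) M.P := by
  have h : Integrable (fun w => (M.prob (zVec w) M.γ₀)⁻¹ * F w) M.P := by
    refine hF.bdd_mul (c := 1 / c) ?_ ?_
    · have := zMeas_comp (M := M) ((hM.prob_meas _ hM.γ₀_mem').inv)
      exact this.aesm
    · filter_upwards [hR.ae_mem] with w hw
      obtain ⟨h1, h2⟩ := hR.prob_bounds hM hw
      have hc := hR.c_pos
      rw [Real.norm_eq_abs, abs_of_nonneg (inv_nonneg.2 (hc.le.trans h1)), ← one_div]
      gcongr
  refine h.congr (ae_of_all _ fun w => ?_)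
  simp [div_eq_inv_mul]

/-- `E[T F / π] = E[F]`. -/
lemma Regular.integral_ipw {F : Obs r → ℝ} (hZ : M.ZMeas F) (hF : Integrable F M.P) :
    ∫ w, tInd w * (F w / M.prob (zVec w) M.γ₀) ∂M.P = ∫ w, F w ∂M.P := by
  rw [hR.integral_tInd_mul hM (hR.zMeas_inv_mul hM hZ) (hR.integrable_div_prob hM hF)]
  refine integral_congr_ae ?_
  filter_upwards [hR.ae_mem] with w hw
  have := (hR.c_pos.trans_le (hR.prob_bounds hM hw).1).ne'
  field_simp

/-- Inverse probability weighting is unbiased at γ₀; this is the source of all the moment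
conditions. -/
lemma Regular.integral_resid_mul {F : Obs r → ℝ} (hZ : M.ZMeas F) (hF : Integrable F M.P) :
    ∫ w, M.resid M.γ₀ w * F w ∂M.P = 0 := by
  have h : ∀ w, M.resid M.γ₀ w * F w = F w - tInd w * (F w / M.prob (zVec w) M.γ₀) := by
    intro w; rw [resid]; ring
  simp only [h]
  rw [integral_sub hF (hR.integrable_tInd_mul hM (hR.integrable_div_prob hM hF)),
    hR.integral_ipw hM hZ hF, sub_self]

/-- Because T² = T, the conditional second moment of 1 - T/π given Z is 1 - 2 + 1/π, the odds
weight. -/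
lemma Regular.integral_resid_sq_mul {F : Obs r → ℝ} (hZ : M.ZMeas F) (hF : Integrable F M.P) :
    ∫ w, M.resid M.γ₀ w ^ 2 * F w ∂M.P = ∫ w, M.odds w * F w ∂M.P := by
  have hF1 := hR.integrable_div_prob hM hF
  have hZ1 := hR.zMeas_inv_mul hM hZ
  have h : ∀ w, M.resid M.γ₀ w ^ 2 * F w = F w - 2 * (tInd w * (F w / M.prob (zVec w) M.γ₀))
      + tInd w * (F w / M.prob (zVec w) M.γ₀ / M.prob (zVec w) M.γ₀) := by
    intro w
    rw [resid]
    have := tInd_sq w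
    calc (1 - tInd w / M.prob (zVec w) M.γ₀) ^ 2 * F w
        = F w - 2 * (tInd w * (F w / M.prob (zVec w) M.γ₀))
          + tInd w ^ 2 * (F w / M.prob (zVec w) M.γ₀ / M.prob (zVec w) M.γ₀) := by ring
      _ = _ := by rw [this]
  have i1 := (hR.integrable_tInd_mul hM hF1).const_mul 2
  have i2 := hR.integrable_tInd_mul hM (hR.integrable_div_prob hM hF1)
  simp only [h]
  have i3 : Integrable (fun w => F w - 2 * (tInd w * (F w / M.prob (zVec w) M.γ₀))) M.P :=
    hF.sub i1
  rw [integral_add i3 i2, integral_sub hF i1, integral_const_mul,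
    hR.integral_ipw hM hZ hF, hR.integral_ipw hM hZ1 hF1]
  have h3 : ∫ w, M.odds w * F w ∂M.P = ∫ w, (F w / M.prob (zVec w) M.γ₀ - F w) ∂M.P := by
    refine integral_congr_ae ?_
    filter_upwards [hR.ae_mem] with w hw
    have := (hR.c_pos.trans_le (hR.prob_bounds hM hw).1).ne'
    rw [odds]
    field_simp
  rw [h3, integral_sub hF1 hF]
  ring

/-- Given Z, the derivative T∇π/π² has mean ∇π/π, and O S₀ = -∇π/π by the definition of S₀. Thus
derivatives are written with the same weight O as covariances. -/
lemma Regular.integral_dres_mul {F : Obs r → ℝ} (hZ : M.ZMeas F) (hF : Integrable F M.P)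
    (j : Fin p) :
    ∫ w, M.dres M.γ₀ w (EuclideanSpace.single j 1) * F w ∂M.P
      = -∫ w, M.odds w * M.S0 w j * F w ∂M.P := by
  have hg : Integrable (fun w => M.gradProb (zVec w) M.γ₀ j * F w) M.P := by
    refine hF.bdd_mul (c := C) (hR.zMeas_gradProb hM j).aesm ?_
    filter_upwards [hR.ae_mem] with w hw using hR.gradProb_le w hw j
  have hgZ : M.ZMeas (fun w => M.gradProb (zVec w) M.γ₀ j * F w) :=
    (hR.zMeas_gradProb hM j).mul hZ
  have h : ∀ w, M.dres M.γ₀ w (EuclideanSpace.single j 1) * F w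
      = tInd w * (M.gradProb (zVec w) M.γ₀ j * F w / M.prob (zVec w) M.γ₀
        / M.prob (zVec w) M.γ₀) := by
    intro w
    simp only [dres, gradProb, smul_apply, smul_eq_mul]
    ring
  simp only [h]
  rw [hR.integral_ipw hM (hR.zMeas_inv_mul hM hgZ) (hR.integrable_div_prob hM hg),
    ← integral_neg]
  refine integral_congr_ae ?_
  filter_upwards [hR.ae_mem] with w hw
  obtain ⟨h1, h2⟩ := hR.prob_bounds hM hw
  have hc := hR.c_pos
  have h3 := (hc.trans_le h1).ne'
  have h4 : 1 - M.prob (zVec w) M.γ₀ ≠ 0 := by linarith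
  rw [odds, S0]
  field_simp

lemma Regular.aesm_dres (j : Fin p) :
    AEStronglyMeasurable (fun w => M.dres M.γ₀ w (EuclideanSpace.single j 1)) M.P := by
  have h1 := (hR.zMeas_gradProb hM j).aesm
  have h2 : AEStronglyMeasurable (fun w => tInd w / M.prob (zVec w) M.γ₀ ^ 2) M.P := by
    refine Measurable.aestronglyMeasurable ?_
    exact measurable_tInd.div (((hM.prob_meas _ hM.γ₀_mem').comp measurable_zVec).pow_const 2)
  exact h2.mul h1

lemma Regular.abs_dres_le {w : Obs r} (hw : w ∈ S) (j : Fin p) :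
    |M.dres M.γ₀ w (EuclideanSpace.single j 1)| ≤ C := by
  have h1 := (M.dres M.γ₀ w).le_opNorm (EuclideanSpace.single j (1 : ℝ))
  have h3 : ‖EuclideanSpace.single j (1 : ℝ)‖ = 1 := by simp
  rw [h3, mul_one, Real.norm_eq_abs] at h1
  exact h1.trans (hR.dres_le w hw _ (Metric.mem_ball_self hR.ρ_pos))

omit hR in
lemma Regular.aesm_resid : AEStronglyMeasurable (M.resid M.γ₀) M.P := by
  refine Measurable.aestronglyMeasurable ?_
  exact measurable_const.sub
    (measurable_tInd.div ((hM.prob_meas _ hM.γ₀_mem').comp measurable_zVec))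

lemma Regular.memLp_resid_mul {F : Obs r → ℝ} (hF : MemLp F 2 M.P) :
    MemLp (fun w => M.resid M.γ₀ w * F w) 2 M.P := by
  refine MemLp.of_le_mul (c := C) hF ((Regular.aesm_resid hM).mul hF.aestronglyMeasurable) ?_
  filter_upwards [hR.ae_mem] with w hw
  rw [norm_mul]
  gcongr
  exact hR.abs_resid_le w hw _ hM.γ₀_mem'

lemma Regular.memLp_odds_mul {F : Obs r → ℝ} (hF : MemLp F 2 M.P) :
    MemLp (fun w => M.odds w * F w) 2 M.P := by
  refine MemLp.of_le_mul (c := 1 / c) hF (hM.zMeas_odds.aesm.mul hF.aestronglyMeasurable) ?_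
  filter_upwards [hR.ae_mem] with w hw
  have hb := hR.odds_bounds hM hw
  rw [norm_mul]
  gcongr
  rw [Real.norm_eq_abs, abs_of_nonneg (hR.c_pos.le.trans hb.1)]
  exact hb.2

lemma Regular.integrable_odds : Integrable M.odds M.P := by
  have := hM.isProb
  refine Integrable.of_bound hM.zMeas_odds.aesm (1 / c) ?_
  filter_upwards [hR.ae_mem] with w hw
  have hb := hR.odds_bounds hM hw
  rw [Real.norm_eq_abs, abs_of_nonneg (hR.c_pos.le.trans hb.1)]
  exact hb.2

/-! ### Weighted conditional means -/

omit hR hM in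
variable (M) in
/-- `E[O g | X] / E[O | X]`. -/
def condRatio (g : Obs r → ℝ) (w : Obs r) : ℝ :=
  (M.P[fun v => M.odds v * g v | sigmaX r]) w / (M.P[M.odds | sigmaX r]) w

omit hR hM in
lemma xMeas_condRatio (g : Obs r → ℝ) : M.XMeas (M.condRatio g) :=
  AEStronglyMeasurable.div₀ stronglyMeasurable_condExp.aestronglyMeasurable
    stronglyMeasurable_condExp.aestronglyMeasurable

lemma Regular.le_condExp_odds : ∀ᵐ w ∂M.P, c ≤ (M.P[M.odds | sigmaX r]) w := by
  have := hM.isProb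
  have h := condExp_mono (m := sigmaX r) (integrable_const c) (hR.integrable_odds hM) (by
    filter_upwards [hR.ae_mem] with w hw using (hR.odds_bounds hM hw).1)
  rw [condExp_const sigmaX_le] at h
  exact h

lemma Regular.memLp_condRatio {g : Obs r → ℝ} (hg : MemLp g 2 M.P) :
    MemLp (M.condRatio g) 2 M.P := by
  refine MemLp.of_le_mul (c := 1 / c) ((hR.memLp_odds_mul hM hg).condExp (m := sigmaX r)
    one_le_two) ((xMeas_condRatio g).mono sigmaX_le) ?_
  filter_upwards [hR.le_condExp_odds hM] with w hw
  have hc := hR.c_pos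
  rw [condRatio, norm_div, Real.norm_eq_abs (M.P[M.odds | sigmaX r] w),
    abs_of_pos (hc.trans_le hw), div_eq_inv_mul, ← one_div]
  gcongr

/-- The ratio is the orthogonal projection of g on functions of X for the inner product weighted by
O. So m and R are the weighted projections of S₀ and U. -/
lemma Regular.integral_odds_condRatio {g f : Obs r → ℝ} (hg : MemLp g 2 M.P) (hfX : M.XMeas f)
    (hf : MemLp f 2 M.P) :
    ∫ w, M.odds w * (M.condRatio g w * f w) ∂M.P = ∫ w, M.odds w * (g w * f w) ∂M.P := by
  have := hM.isProb
  have hq := hR.memLp_condRatio hM hg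
  have hqf : M.XMeas (M.condRatio g * f) := (xMeas_condRatio g).mul hfX
  have h1 := condExp_mul_of_aestronglyMeasurable_right (m := sigmaX r) (f := M.odds) hqf
    (by
      have h := (hR.memLp_odds_mul hM hq).integrable_mul hf
      refine h.congr (ae_of_all _ fun w => ?_)
      simp only [Pi.mul_apply]
      ring)
    (hR.integrable_odds hM)
  have h2 := condExp_mul_of_aestronglyMeasurable_right (m := sigmaX r)
    (f := fun v => M.odds v * g v) hfX ((hR.memLp_odds_mul hM hg).integrable_mul hf)
    ((hR.memLp_odds_mul hM hg).integrable one_le_two)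
  have e1 : ∫ w, M.odds w * (M.condRatio g w * f w) ∂M.P
      = ∫ w, (M.P[M.odds * (M.condRatio g * f) | sigmaX r]) w ∂M.P :=
    (integral_condExp sigmaX_le).symm
  have e2 : ∫ w, M.odds w * (g w * f w) ∂M.P
      = ∫ w, (M.P[(fun v => M.odds v * g v) * f | sigmaX r]) w ∂M.P := by
    rw [integral_condExp sigmaX_le]
    refine integral_congr_ae (ae_of_all _ fun w => ?_)
    simp only [Pi.mul_apply]
    ring
  rw [e1, e2]
  refine integral_congr_ae ?_
  filter_upwards [h1, h2, hR.le_condExp_odds hM] with w h1 h2 h3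
  rw [h1, h2]
  simp only [Pi.mul_apply, condRatio]
  have : (M.P[M.odds | sigmaX r]) w ≠ 0 := (hR.c_pos.trans_le h3).ne'
  field_simp

/-! ### The moment functions at the true parameter -/

omit hR hM in
variable (M) in
/-- `(1 - T/π(Z; γ₀)) F + β (θ₀ - U)`: the general form of the moment functions at the true
parameter. -/
def psi (F : Obs r → ℝ) (β : ℝ) (w : Obs r) : ℝ :=
  M.resid M.γ₀ w * F w + β * (M.θ₀ - M.U (zVec w))

omit hR hM in
variable (M) in
/-- The variance of `U(Z)`. -/
def varU : ℝ := ∫ w, (M.θ₀ - M.U (zVec w)) ^ 2 ∂M.P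

omit hR in
lemma memLp_const_sub_U : MemLp (fun w => M.θ₀ - M.U (zVec w)) 2 M.P := by
  have := hM.isProb
  exact (memLp_const _).sub hM.U_sq

omit hR in
lemma varU_pos : 0 < M.varU := by
  have hi := (memLp_const_sub_U hM).integrable_sq
  rw [varU, integral_pos_iff_support_of_nonneg (fun w => sq_nonneg _) hi, pos_iff_ne_zero]
  intro h
  apply hM.U_nonconst
  have : ∀ᵐ w ∂M.P, w ∉ Function.support fun w => (M.θ₀ - M.U (zVec w)) ^ 2 :=
    measure_eq_zero_iff_ae_notMem.1 h
  filter_upwards [this] with w hw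
  simp only [Function.mem_support, ne_eq, not_not, pow_eq_zero_iff two_ne_zero] at hw
  linarith

lemma Regular.memLp_psi {F : Obs r → ℝ} (hF : MemLp F 2 M.P) (β : ℝ) :
    MemLp (M.psi F β) 2 M.P :=
  (hR.memLp_resid_mul hM hF).add ((memLp_const_sub_U hM).const_mul β)

lemma Regular.integral_psi {F : Obs r → ℝ} (hZ : M.ZMeas F) (hF : MemLp F 2 M.P) (β : ℝ) :
    ∫ w, M.psi F β w ∂M.P = 0 := by
  have := hM.isProb
  unfold psi
  rw [integral_add ((hR.memLp_resid_mul hM hF).integrable one_le_two)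
    (((memLp_const_sub_U hM).const_mul β).integrable one_le_two),
    hR.integral_resid_mul hM hZ (hF.integrable one_le_two), integral_const_mul,
    integral_sub (integrable_const _) (hM.U_sq.integrable one_le_two)]
  simp [θ₀]

/-- The product is a quadratic polynomial in 1 - T/π with coefficients depending on Z; its linear
term has mean zero and its square turns into the weight O. -/
lemma Regular.integral_psi_mul {F F' : Obs r → ℝ} (hZ : M.ZMeas F) (hF : MemLp F 2 M.P)
    (hZ' : M.ZMeas F') (hF' : MemLp F' 2 M.P) (β β' : ℝ) :
    ∫ w, M.psi F β w * M.psi F' β' w ∂M.P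
      = ∫ w, M.odds w * (F w * F' w) ∂M.P + β * β' * M.varU := by
  have hV := memLp_const_sub_U hM
  have hZV : M.ZMeas (fun w => M.θ₀ - M.U (zVec w)) := aestronglyMeasurable_const.sub hM.zMeas_U
  -- The coefficient of the linear term, whose contribution vanishes.
  set H : Obs r → ℝ := fun w => (β' * F w + β * F' w) * (M.θ₀ - M.U (zVec w)) with hH
  have hHL : MemLp (fun w => β' * F w + β * F' w) 2 M.P := (hF.const_mul β').add (hF'.const_mul β)
  have hHi : Integrable H M.P := hHL.integrable_mul hV
  have hHZ : M.ZMeas H := ((hZ.const_mul β').add (hZ'.const_mul β)).mul hZV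
  have hFF : Integrable (fun w => F w * F' w) M.P := hF.integrable_mul hF'
  have hFFZ : M.ZMeas (fun w => F w * F' w) := hZ.mul hZ'
  have h : ∀ w, M.psi F β w * M.psi F' β' w = M.resid M.γ₀ w ^ 2 * (F w * F' w)
      + M.resid M.γ₀ w * H w + β * β' * (M.θ₀ - M.U (zVec w)) ^ 2 := by
    intro w; simp only [psi, hH]; ring
  have i1 : Integrable (fun w => M.resid M.γ₀ w ^ 2 * (F w * F' w)) M.P := by
    have := (hR.memLp_resid_mul hM hF).integrable_mul (hR.memLp_resid_mul hM hF')
    refine this.congr (ae_of_all _ fun w => ?_)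
    simp only [Pi.mul_apply]; ring
  have i2 : Integrable (fun w => M.resid M.γ₀ w * H w) M.P := by
    have := (hR.memLp_resid_mul hM hHL).integrable_mul hV
    refine this.congr (ae_of_all _ fun w => ?_)
    simp only [Pi.mul_apply, hH]; ring
  have i3 := hV.integrable_sq.const_mul (β * β')
  simp only [h]
  have i12 : Integrable (fun w => M.resid M.γ₀ w ^ 2 * (F w * F' w) + M.resid M.γ₀ w * H w) M.P :=
    i1.add i2
  rw [integral_add i12 i3, integral_add i1 i2, hR.integral_resid_sq_mul hM hFFZ hFF,
    hR.integral_resid_mul hM hHZ hHi, integral_const_mul, varU, add_zero]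

end Model

end

end MNAR

namespace MNAR

noncomputable section

namespace Model

set_option linter.unusedSectionVars false

variable {r p : ℕ} {M : Model r p} {S : Set (Obs r)} {c C ρ : ℝ}

/-! ### The efficient score represents the derivative of the moments -/

variable (M) in
/-- The factors multiplying `1 - T/π(Z; γ)` in the components of `S_eff`. -/
def effF : Fin p ⊕ Unit → Obs r → ℝ :=
  Sum.elim (fun j w => M.mFun w j) (fun _ w => M.U (zVec w) - M.rFun w)

/-- The coefficients of `θ - U` in the components of `S_eff`. -/
def effβ (p : ℕ) : Fin p ⊕ Unit → ℝ := Sum.elim (fun _ => 0) (fun _ => 1)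

/-- Writing θ - TU/π = (1 - T/π) U + (θ - U) puts both blocks of the score in one shape, with
factors m and U - R. -/
lemma Seff_eq (w : Obs r) (η : EuclideanSpace ℝ (Fin p) × ℝ) (i : Fin p ⊕ Unit) :
    M.Seff w η i = M.resid η.1 w * M.effF i w + effβ p i * (η.2 - M.U (zVec w)) := by
  rcases i with j | _
  · simp [Seff, effF, effβ]
  · simp only [Seff, effF, effβ, Sum.elim_inr, resid]
    ring

lemma Seff_eq_psi (w : Obs r) (i : Fin p ⊕ Unit) :
    M.Seff w (M.γ₀, M.θ₀) i = M.psi (M.effF i) (effβ p i) w := by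
  rw [Seff_eq, psi]

variable (M) in
/-- The mean derivative of `(1 - T/π(Z; γ)) F + β (θ - U)` in the `j`-th parameter, at the true
parameter. -/
def ell (j : Fin p ⊕ Unit) (F : Obs r → ℝ) (β : ℝ) : ℝ :=
  ∫ w, M.dres M.γ₀ w (dir p j).1 * F w ∂M.P + β * (dir p j).2

variable (hR : M.Regular S c C ρ) (hM : M.Assumptions)

include hR hM

lemma Regular.zMeas_effF (i : Fin p ⊕ Unit) : M.ZMeas (M.effF i) := by
  rcases i with j | _
  · exact (xMeas_condRatio fun v => M.S0 v j).zMeas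
  · exact hM.zMeas_U.sub (xMeas_condRatio fun v => M.U (zVec v)).zMeas

lemma Regular.memLp_effF (i : Fin p ⊕ Unit) : MemLp (M.effF i) 2 M.P := by
  rcases i with j | _
  · exact hR.memLp_condRatio hM (hR.memLp_S0 hM j)
  · exact hM.U_sq.sub (hR.memLp_condRatio hM hM.U_sq)

lemma Regular.memLp_Seff (i : Fin p ⊕ Unit) :
    MemLp (fun w => M.Seff w (M.γ₀, M.θ₀) i) 2 M.P := by
  simp only [Seff_eq_psi]
  exact hR.memLp_psi hM (hR.memLp_effF hM i) _

lemma Regular.integral_Seff (i : Fin p ⊕ Unit) : ∫ w, M.Seff w (M.γ₀, M.θ₀) i ∂M.P = 0 := by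
  simp only [Seff_eq_psi]
  exact hR.integral_psi hM (hR.zMeas_effF hM i) (hR.memLp_effF hM i) _

lemma Regular.hasFDerivAt_moment {w : Obs r} (hw : w ∈ S) {η : EuclideanSpace ℝ (Fin p) × ℝ}
    (hη : η.1 ∈ Metric.ball M.γ₀ ρ) (a b u : ℝ) :
    HasFDerivAt (fun η : EuclideanSpace ℝ (Fin p) × ℝ => M.resid η.1 w * a + b * (η.2 - u))
      (a • (M.dres η.1 w).comp (ContinuousLinearMap.fst ℝ _ _)
        + b • ContinuousLinearMap.snd ℝ _ _) η := by
  have h1 : HasFDerivAt (fun η : EuclideanSpace ℝ (Fin p) × ℝ => M.resid η.1 w)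
      ((M.dres η.1 w).comp (ContinuousLinearMap.fst ℝ _ _)) η :=
    HasFDerivAt.comp η (g := fun γ => M.resid γ w) (hR.hasFDerivAt w hw _ hη) hasFDerivAt_fst
  have h2 : HasFDerivAt (fun η : EuclideanSpace ℝ (Fin p) × ℝ => η.2 - u)
      (ContinuousLinearMap.snd ℝ _ _) η := hasFDerivAt_snd.sub_const u
  exact (h1.mul_const a).add (h2.const_mul b)

lemma Regular.effJac_apply (i j : Fin p ⊕ Unit) :
    M.effJac i j = M.ell j (M.effF i) (effβ p i) := by
  have := hM.isProb
  have hF := (hR.memLp_effF hM i).integrable one_le_two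
  have h1 : M.effJac i j
      = ∫ w, (M.dres M.γ₀ w (dir p j).1 * M.effF i w + effβ p i * (dir p j).2) ∂M.P := by
    refine integral_congr_ae ?_
    filter_upwards [hR.ae_mem] with w hw
    have h := (hR.hasFDerivAt_moment hM hw (η := (M.γ₀, M.θ₀)) (Metric.mem_ball_self hR.ρ_pos)
      (M.effF i w) (effβ p i) (M.U (zVec w))).fderiv
    simp only [Seff_eq]
    rw [h]
    simp
    ring
  have hi : Integrable (fun w => M.dres M.γ₀ w (dir p j).1 * M.effF i w) M.P := by
    rcases j with j | _
    · refine hF.bdd_mul (c := C) (hR.aesm_dres hM j) ?_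
      filter_upwards [hR.ae_mem] with w hw using hR.abs_dres_le hM hw j
    · simp [dir]
  rw [h1, integral_add hi (integrable_const _), ell]
  simp

omit hR in
lemma memLp_add_mul_U {f : Obs r → ℝ} (hf : MemLp f 2 M.P) (β : ℝ) :
    MemLp (fun w => f w + β * M.U (zVec w)) 2 M.P := hf.add (hM.U_sq.const_mul β)

omit hR in
lemma zMeas_add_mul_U {f : Obs r → ℝ} (hf : M.XMeas f) (β : ℝ) :
    M.ZMeas (fun w => f w + β * M.U (zVec w)) := hf.zMeas.add (hM.zMeas_U.const_mul β)

lemma Regular.integral_odds_mul_add {g f : Obs r → ℝ} (hg : MemLp g 2 M.P)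
    (hf : MemLp f 2 M.P) (β : ℝ) :
    ∫ w, M.odds w * (g w * (f w + β * M.U (zVec w))) ∂M.P
      = ∫ w, M.odds w * (g w * f w) ∂M.P + β * ∫ w, M.odds w * (g w * M.U (zVec w)) ∂M.P := by
  have hi : ∀ {h : Obs r → ℝ}, MemLp h 2 M.P →
      Integrable (fun w => M.odds w * (g w * h w)) M.P := fun {h} hh => by
    refine ((hR.memLp_odds_mul hM hg).integrable_mul hh).congr (ae_of_all _ fun w => ?_)
    simp only [Pi.mul_apply]
    ring
  rw [← integral_const_mul, ← integral_add (hi hf) ((hi hM.U_sq).const_mul β)]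
  refine integral_congr_ae (ae_of_all _ fun w => ?_)
  ring

variable (M) in
omit hR hM in
/-- `E[O (U - R) U] + Var U`. -/
def effKappa : ℝ :=
  ∫ w, M.odds w * ((M.U (zVec w) - M.rFun w) * M.U (zVec w)) ∂M.P + M.varU

/-- The residual `U - R` is orthogonal to functions of `X`. -/
lemma Regular.integral_odds_sub_rFun_mul {f : Obs r → ℝ} (hfX : M.XMeas f) (hf : MemLp f 2 M.P) :
    ∫ w, M.odds w * ((M.U (zVec w) - M.rFun w) * f w) ∂M.P = 0 := by
  have hRL := hR.memLp_condRatio hM hM.U_sq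
  have hi : ∀ {h : Obs r → ℝ}, MemLp h 2 M.P →
      Integrable (fun w => M.odds w * (h w * f w)) M.P := fun {h} hh => by
    refine ((hR.memLp_odds_mul hM hh).integrable_mul hf).congr (ae_of_all _ fun w => ?_)
    simp only [Pi.mul_apply]
    ring
  have h := hR.integral_odds_condRatio hM hM.U_sq hfX hf
  have h2 : ∫ w, M.odds w * ((M.U (zVec w) - M.rFun w) * f w) ∂M.P
      = ∫ w, (M.odds w * (M.U (zVec w) * f w)
        - M.odds w * (M.condRatio (fun v => M.U (zVec v)) w * f w)) ∂M.P := by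
    refine integral_congr_ae (ae_of_all _ fun w => ?_)
    simp only [rFun, condRatio]
    ring
  rw [h2, integral_sub (hi hM.U_sq) (hi hRL), h, sub_self]

/-- Since U - R is orthogonal to R in the weighted inner product, the first term equals E[O (U -
R)²] ≥ 0, and Var U > 0 because U is not almost surely constant. -/
lemma Regular.effKappa_pos : 0 < M.effKappa := by
  have hRL := hR.memLp_condRatio hM hM.U_sq
  have hg := hM.U_sq.sub hRL
  have h0 := hR.integral_odds_sub_rFun_mul hM (xMeas_condRatio fun v => M.U (zVec v)) hRL
  have h1 := hR.integral_odds_mul_add hM hg hRL 1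
  have h2 : ∫ w, M.odds w * ((M.U (zVec w) - M.rFun w) * M.U (zVec w)) ∂M.P
      = ∫ w, M.odds w * (M.U (zVec w) - M.rFun w) ^ 2 ∂M.P := by
    have hi : ∀ {h : Obs r → ℝ}, MemLp h 2 M.P →
        Integrable (fun w => M.odds w * ((M.U (zVec w) - M.rFun w) * h w)) M.P := fun {h} hh => by
      refine ((hR.memLp_odds_mul hM hg).integrable_mul hh).congr (ae_of_all _ fun w => ?_)
      simp only [Pi.mul_apply, Pi.sub_apply, rFun, condRatio]
      ring
    have h3 : ∀ w, M.odds w * (M.U (zVec w) - M.rFun w) ^ 2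
        = M.odds w * ((M.U (zVec w) - M.rFun w) * M.U (zVec w))
          - M.odds w * ((M.U (zVec w) - M.rFun w) * M.condRatio (fun v => M.U (zVec v)) w) := by
      intro w
      simp only [rFun, condRatio]
      ring
    simp only [h3]
    rw [integral_sub (hi hM.U_sq) (hi hRL), h0, sub_zero]
  rw [effKappa, h2]
  refine add_pos_of_nonneg_of_pos (integral_nonneg_of_ae ?_) (varU_pos hM)
  filter_upwards [hR.ae_mem] with w hw
  exact mul_nonneg (hR.c_pos.le.trans (hR.odds_bounds hM hw).1) (sq_nonneg _)

omit hR hM in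
variable (M) in
/-- The coefficients which express the Riesz representers of the mean derivatives through the
efficient score. -/
def effCoef : Matrix (Fin p ⊕ Unit) (Fin p ⊕ Unit) ℝ :=
  Matrix.fromBlocks (-1)
    (Matrix.of fun j _ => (∫ w, M.odds w * (M.mFun w j * M.U (zVec w)) ∂M.P
      - ∫ w, M.odds w * (M.S0 w j * M.U (zVec w)) ∂M.P) / M.effKappa)
    0 (Matrix.of fun _ _ => 1 / M.effKappa)

omit hR hM in
variable (M) in
/-- The Riesz representers of the mean derivatives. -/
def phi (j : Fin p ⊕ Unit) (w : Obs r) : ℝ :=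
  ∑ i, M.effCoef j i * M.Seff w (M.γ₀, M.θ₀) i

lemma Regular.memLp_phi (j : Fin p ⊕ Unit) : MemLp (M.phi j) 2 M.P :=
  memLp_finsetSum _ fun i _ => (hR.memLp_Seff hM i).const_mul _

lemma Regular.integral_phi (j : Fin p ⊕ Unit) : ∫ w, M.phi j w ∂M.P = 0 := by
  have := hM.isProb
  unfold phi
  rw [integral_finsetSum _ fun i _ => ((hR.memLp_Seff hM i).integrable one_le_two).const_mul _]
  simp [integral_const_mul, hR.integral_Seff hM]

/-- The Riesz representation of the mean derivatives on the functions
`(1 - T/π) (f(X) + β U) + β (θ₀ - U)`. -/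
theorem Regular.integral_phi_mul_psi {f : Obs r → ℝ} (hfX : M.XMeas f) (hf : MemLp f 2 M.P)
    (β : ℝ) (j : Fin p ⊕ Unit) :
    ∫ w, M.phi j w * M.psi (fun w => f w + β * M.U (zVec w)) β w ∂M.P
      = M.ell j (fun w => f w + β * M.U (zVec w)) β := by
  have := hM.isProb
  have hF := memLp_add_mul_U hM hf β
  have hFZ := zMeas_add_mul_U hM hfX β
  have hψ := hR.memLp_psi hM hF β
  have hpair : ∀ i, ∫ w, M.Seff w (M.γ₀, M.θ₀) i * M.psi (fun w => f w + β * M.U (zVec w)) β w ∂M.P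
      = ∫ w, M.odds w * (M.effF i w * (f w + β * M.U (zVec w))) ∂M.P
        + effβ p i * β * M.varU := by
    intro i
    simp only [Seff_eq_psi]
    exact hR.integral_psi_mul hM (hR.zMeas_effF hM i) (hR.memLp_effF hM i) hFZ hF _ _
  -- Against functions of X the projection m may be replaced by S₀, but not against U; the resulting
  -- discrepancy E[O m U] - E[O S₀ U] is the numerator of the last column of `effCoef`.
  have hinl : ∀ k, ∫ w, M.Seff w (M.γ₀, M.θ₀) (Sum.inl k)
        * M.psi (fun w => f w + β * M.U (zVec w)) β w ∂M.P
      = ∫ w, M.odds w * (M.S0 w k * f w) ∂M.P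
        + β * ∫ w, M.odds w * (M.mFun w k * M.U (zVec w)) ∂M.P := by
    intro k
    rw [hpair, hR.integral_odds_mul_add hM (hR.memLp_effF hM _) hf]
    have h := hR.integral_odds_condRatio hM (hR.memLp_S0 hM k) hfX hf
    rw [← h]
    simp only [effβ, Sum.elim_inl, zero_mul, add_zero]
    rfl
  -- The factor U - R kills f, so this component sees only β. It can therefore correct the U-part of
  -- the other pairings without disturbing their X-part.
  have hinr : ∫ w, M.Seff w (M.γ₀, M.θ₀) (Sum.inr ())
        * M.psi (fun w => f w + β * M.U (zVec w)) β w ∂M.P = β * M.effKappa := by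
    rw [hpair, hR.integral_odds_mul_add hM (hR.memLp_effF hM _) hf]
    have h := hR.integral_odds_sub_rFun_mul hM hfX hf
    simp only [effF, Sum.elim_inr, effβ, one_mul]
    rw [h, effKappa]
    ring
  have hsum : ∫ w, M.phi j w * M.psi (fun w => f w + β * M.U (zVec w)) β w ∂M.P
      = ∑ i, M.effCoef j i * ∫ w, M.Seff w (M.γ₀, M.θ₀) i
        * M.psi (fun w => f w + β * M.U (zVec w)) β w ∂M.P := by
    simp only [phi, Finset.sum_mul]
    rw [integral_finsetSum]
    · refine Finset.sum_congr rfl fun i _ => ?_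
      rw [← integral_const_mul]
      refine integral_congr_ae (ae_of_all _ fun w => ?_)
      ring
    · intro i _
      refine (((hR.memLp_Seff hM i).integrable_mul hψ).const_mul (M.effCoef j i)).congr
        (ae_of_all _ fun w => ?_)
      simp only [Pi.mul_apply]
      ring
  have hκ := (hR.effKappa_pos hM).ne'
  rw [hsum, Fintype.sum_sum_type, ell]
  simp only [hinl, Finset.univ_unique, Finset.sum_singleton]
  rw [show (default : Unit) = () from rfl, hinr]
  -- For a γ-direction the coefficient -1 gives -E[O S₀ f] - β E[O m U] and the last column replaces
  -- m by S₀ in the second term. For θ, the coefficient 1/κ (κ = `effKappa`) times βκ leaves β.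
  rcases j with j | _
  · have hd := hR.integral_dres_mul hM hFZ (hF.integrable one_le_two) j
    have hs := hR.integral_odds_mul_add hM (hR.memLp_S0 hM j) hf β
    have hs' : ∫ w, M.odds w * M.S0 w j * (f w + β * M.U (zVec w)) ∂M.P
        = ∫ w, M.odds w * (M.S0 w j * (f w + β * M.U (zVec w))) ∂M.P := by
      refine integral_congr_ae (ae_of_all _ fun w => ?_)
      ring
    simp only [effCoef, Matrix.fromBlocks_apply₁₁, Matrix.fromBlocks_apply₁₂, Matrix.of_apply,
      dir, Sum.elim_inl, mul_zero, add_zero, Matrix.neg_apply, Matrix.one_apply]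
    rw [hd, hs', hs]
    simp
    field_simp
    ring
  · simp only [effCoef, Matrix.fromBlocks_apply₂₁, Matrix.fromBlocks_apply₂₂, Matrix.of_apply,
      dir, Sum.elim_inr, Matrix.zero_apply, zero_mul, Finset.sum_const_zero, map_zero,
      integral_zero, zero_add, mul_one]
    field_simp

/-- `E[∂S_eff] = E[S_eff φᵀ]`. -/
lemma Regular.effJac_eq : M.effJac = M.effCov * M.effCoefᵀ := by
  ext i j
  have hrep : M.ell j (M.effF i) (effβ p i)
      = ∫ w, M.phi j w * M.Seff w (M.γ₀, M.θ₀) i ∂M.P := by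
    simp only [Seff_eq_psi]
    -- The components of S_eff are themselves in the represented class: f = m with β = 0, and f = -R
    -- with β = 1.
    rcases i with k | _
    · have h := hR.integral_phi_mul_psi hM (f := M.effF (Sum.inl k))
        (xMeas_condRatio fun v => M.S0 v k) (hR.memLp_effF hM _) 0 j
      simpa [effβ] using h.symm
    · have hX := xMeas_condRatio (M := M) fun v => M.U (zVec v)
      have h := hR.integral_phi_mul_psi hM (f := fun w => - M.rFun w) hX.neg
        (hR.memLp_condRatio hM hM.U_sq).neg 1 j
      have hF : (fun w => -M.rFun w + 1 * M.U (zVec w)) = M.effF (Sum.inr ()) := by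
        ext w
        simp only [effF, Sum.elim_inr]
        ring
      rw [hF] at h
      simpa [effβ] using h.symm
  rw [hR.effJac_apply hM, hrep, Matrix.mul_apply]
  simp only [phi, Finset.sum_mul]
  rw [integral_finsetSum]
  · refine Finset.sum_congr rfl fun k _ => ?_
    rw [Matrix.transpose_apply, effCov, Matrix.of_apply, mul_comm, ← integral_const_mul]
    refine integral_congr_ae (ae_of_all _ fun w => ?_)
    ring
  · intro k _
    refine (((hR.memLp_Seff hM k).integrable_mul (hR.memLp_Seff hM i)).const_mul
      (M.effCoef j k)).congr (ae_of_all _ fun w => ?_)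
    simp only [Pi.mul_apply]
    ring

/-- `E[φ φᵀ]`. -/
lemma Regular.integral_phi_mul_phi (j k : Fin p ⊕ Unit) :
    ∫ w, M.phi j w * M.phi k w ∂M.P = (M.effCoef * M.effCov * M.effCoefᵀ) j k := by
  have hi : ∀ a b, Integrable (fun w => M.effCoef j a * M.effCoef k b *
      (M.Seff w (M.γ₀, M.θ₀) a * M.Seff w (M.γ₀, M.θ₀) b)) M.P := fun a b =>
    ((hR.memLp_Seff hM a).integrable_mul (hR.memLp_Seff hM b)).const_mul _
  have h : ∀ w, M.phi j w * M.phi k w = ∑ a, ∑ b, M.effCoef j a * M.effCoef k b *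
      (M.Seff w (M.γ₀, M.θ₀) a * M.Seff w (M.γ₀, M.θ₀) b) := by
    intro w
    rw [phi, phi, Finset.sum_mul_sum]
    refine Finset.sum_congr rfl fun a _ => Finset.sum_congr rfl fun b _ => by ring
  simp only [h]
  rw [integral_finsetSum _ fun a _ => integrable_finsetSum _ fun b _ => hi a b,
    Matrix.mul_assoc, Matrix.mul_apply]
  refine Finset.sum_congr rfl fun a _ => ?_
  rw [integral_finsetSum _ fun b _ => hi a b, Matrix.mul_apply, Finset.mul_sum]
  refine Finset.sum_congr rfl fun b _ => ?_
  rw [integral_const_mul, effCov, Matrix.of_apply, Matrix.transpose_apply]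
  ring

/-- The covariance matrix of the efficient score is positive semidefinite. -/
lemma Regular.effCov_posSemidef : M.effCov.PosSemidef := by
  refine Matrix.PosSemidef.of_dotProduct_mulVec_nonneg ?_ fun v => ?_
  · ext i j
    simp only [Matrix.conjTranspose_apply, effCov, Matrix.of_apply, star_trivial]
    simp only [mul_comm]
  · have hi : ∀ a b, Integrable (fun w => v a * v b *
        (M.Seff w (M.γ₀, M.θ₀) a * M.Seff w (M.γ₀, M.θ₀) b)) M.P := fun a b =>
      ((hR.memLp_Seff hM a).integrable_mul (hR.memLp_Seff hM b)).const_mul _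
    have h : star v ⬝ᵥ M.effCov *ᵥ v
        = ∫ w, (∑ a, v a * M.Seff w (M.γ₀, M.θ₀) a) ^ 2 ∂M.P := by
      have h1 : ∀ w, (∑ a, v a * M.Seff w (M.γ₀, M.θ₀) a) ^ 2 = ∑ a, ∑ b, v a * v b *
          (M.Seff w (M.γ₀, M.θ₀) a * M.Seff w (M.γ₀, M.θ₀) b) := by
        intro w
        rw [sq, Finset.sum_mul_sum]
        refine Finset.sum_congr rfl fun a _ => Finset.sum_congr rfl fun b _ => by ring
      simp only [h1]
      rw [integral_finsetSum _ fun a _ => integrable_finsetSum _ fun b _ => hi a b]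
      refine Finset.sum_congr rfl fun a _ => ?_
      rw [integral_finsetSum _ fun b _ => hi a b, Matrix.mulVec, dotProduct, Finset.mul_sum]
      refine Finset.sum_congr rfl fun b _ => ?_
      rw [integral_const_mul, effCov, Matrix.of_apply]
      simp
      ring
    rw [h]
    exact integral_nonneg fun w => sq_nonneg _

/-- Both are factors of J, which is nonsingular by assumption. -/
lemma Regular.isUnit_effCov_effCoef : IsUnit M.effCov.det ∧ IsUnit M.effCoef.det := by
  have h := hM.effJac_nonsing
  rw [hR.effJac_eq hM, Matrix.det_mul, Matrix.det_transpose] at h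
  exact ⟨isUnit_of_mul_isUnit_left h, isUnit_of_mul_isUnit_right h⟩

lemma Regular.effCov_posDef : M.effCov.PosDef :=
  (hR.effCov_posSemidef hM).posDef_iff_isUnit.2
    ((Matrix.isUnit_iff_isUnit_det _).2 (hR.isUnit_effCov_effCoef hM).1)

/-- The efficiency bound is positive definite. -/
theorem Regular.Veff_posDef : M.Veff.PosDef := by
  have h := (hR.effCov_posDef hM).mul_mul_conjTranspose_same (B := M.effJac⁻¹) ?_
  · simpa [Veff] using h
  · refine Matrix.vecMul_injective_iff_isUnit.2 ?_
    exact (Matrix.isUnit_nonsing_inv_iff).2 ((Matrix.isUnit_iff_isUnit_det _).2 hM.effJac_nonsing)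

variable (M) in
omit hR hM in
/-- The second moment matrix of the representers. -/
def phiCov : Matrix (Fin p ⊕ Unit) (Fin p ⊕ Unit) ℝ := M.effCoef * M.effCov * M.effCoefᵀ

lemma Regular.isUnit_phiCov : IsUnit M.phiCov.det := by
  obtain ⟨h1, h2⟩ := hR.isUnit_effCov_effCoef hM
  rw [phiCov, Matrix.det_mul, Matrix.det_mul, Matrix.det_transpose]
  exact (h2.mul h1).mul h2

/-- `E[φ φᵀ]⁻¹ φ = J⁻¹ S_eff`. -/
lemma Regular.inv_phiCov_mulVec (w : Obs r) :
    M.phiCov⁻¹ *ᵥ (fun j => M.phi j w) = M.effJac⁻¹ *ᵥ M.Seff w (M.γ₀, M.θ₀) := by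
  obtain ⟨h1, h2⟩ := hR.isUnit_effCov_effCoef hM
  have h3 : (fun j => M.phi j w) = M.effCoef *ᵥ M.Seff w (M.γ₀, M.θ₀) := rfl
  have h4 : M.phiCov = M.effCoef * M.effJac := by
    rw [phiCov, hR.effJac_eq hM, Matrix.mul_assoc]
  rw [h3, h4, Matrix.mul_inv_rev, Matrix.mulVec_mulVec, Matrix.mul_assoc,
    Matrix.nonsing_inv_mul _ h2, Matrix.mul_one]

end Model

end

end MNAR

namespace MNAR

noncomputable section

lemma integrable_fun_mul {𝒲 : Type*} [MeasurableSpace 𝒲] {P : Measure 𝒲} {f g : 𝒲 → ℝ}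
    (hf : MemLp f 2 P) (hg : MemLp g 2 P) : Integrable (fun w => f w * g w) P :=
  hf.integrable_mul hg

/-- The Cauchy-Schwarz inequality for integrals. -/
lemma sq_integral_mul_le {𝒲 : Type*} [MeasurableSpace 𝒲] {P : Measure 𝒲} {f g : 𝒲 → ℝ}
    (hf : MemLp f 2 P) (hg : MemLp g 2 P) :
    (∫ w, f w * g w ∂P) ^ 2 ≤ (∫ w, f w ^ 2 ∂P) * ∫ w, g w ^ 2 ∂P := by
  -- The quadratic t ↦ ∫ (t g + f)² is nonnegative, so its discriminant is not positive.
  have h : ∀ t : ℝ, 0 ≤ (∫ w, g w ^ 2 ∂P) * (t * t) + (2 * ∫ w, f w * g w ∂P) * t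
      + ∫ w, f w ^ 2 ∂P := by
    intro t
    have i1 : Integrable (fun w => t * t * g w ^ 2) P := hg.integrable_sq.const_mul _
    have i2 : Integrable (fun w => 2 * t * (f w * g w)) P := (hf.integrable_mul hg).const_mul _
    have i12 : Integrable (fun w => t * t * g w ^ 2 + 2 * t * (f w * g w)) P := i1.add i2
    have h1 : 0 ≤ ∫ w, (t * t * g w ^ 2 + 2 * t * (f w * g w) + f w ^ 2) ∂P :=
      integral_nonneg fun w => by
        have : t * t * g w ^ 2 + 2 * t * (f w * g w) + f w ^ 2 = (t * g w + f w) ^ 2 := by ring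
        simp only [Pi.zero_apply, this]
        positivity
    rw [integral_add i12 hf.integrable_sq, integral_add i1 i2, integral_const_mul,
      integral_const_mul] at h1
    linarith
  have hd := discrim_le_zero h
  rw [discrim] at hd
  nlinarith

namespace Model

set_option linter.unusedSectionVars false

variable {r p : ℕ} {M : Model r p} {S : Set (Obs r)} {c C ρ : ℝ}

/-! ### The moment functions as linear forms -/

variable (M) in
/-- The vector `(u_K(X)ᵀ, U(Z))ᵀ`. -/
def ut (K : ℕ) (w : Obs r) : Fin K ⊕ Unit → ℝ :=
  Sum.elim (M.u K (xVec w)) (fun _ => M.U (zVec w))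

/-- The first block of a vector. -/
abbrev fstBlock {K : ℕ} (v : Fin K ⊕ Unit → ℝ) : Fin K → ℝ := fun k => v (Sum.inl k)

lemma dotProduct_sum_type {K : ℕ} (v w : Fin K ⊕ Unit → ℝ) :
    v ⬝ᵥ w = fstBlock v ⬝ᵥ fstBlock w + v (Sum.inr ()) * w (Sum.inr ()) := by
  simp [dotProduct, fstBlock, Fintype.sum_sum_type]

lemma eucl_sq_sum_type {K : ℕ} (v : Fin K ⊕ Unit → ℝ) :
    eucl v ^ 2 = eucl (fstBlock v) ^ 2 + v (Sum.inr ()) ^ 2 := by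
  rw [eucl_sq, eucl_sq, dotProduct_sum_type, sq]

lemma dotProduct_ut {K : ℕ} (v : Fin K ⊕ Unit → ℝ) (w : Obs r) :
    v ⬝ᵥ M.ut K w = fstBlock v ⬝ᵥ M.u K (xVec w) + v (Sum.inr ()) * M.U (zVec w) :=
  dotProduct_sum_type _ _

/-- The same rewriting as for the score. At the truth, combinations of the moments are thus the
functions `psi` whose f lies in the span of u_K, so the representers φ apply to them. -/
lemma dotProduct_g {K : ℕ} (v : Fin K ⊕ Unit → ℝ) (w : Obs r)
    (η : EuclideanSpace ℝ (Fin p) × ℝ) :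
    v ⬝ᵥ M.g K w η = M.resid η.1 w * (v ⬝ᵥ M.ut K w)
      + v (Sum.inr ()) * (η.2 - M.U (zVec w)) := by
  rw [dotProduct_ut, dotProduct_sum_type]
  have h1 : fstBlock (M.g K w η) = M.resid η.1 w • M.u K (xVec w) := by
    ext k; simp [g, fstBlock]
  rw [h1, dotProduct_smul, smul_eq_mul]
  simp only [g, Sum.elim_inr, resid]
  ring

lemma dotProduct_g_eq_psi {K : ℕ} (v : Fin K ⊕ Unit → ℝ) (w : Obs r) :
    v ⬝ᵥ M.g K w (M.γ₀, M.θ₀) = M.psi (fun w => fstBlock v ⬝ᵥ M.u K (xVec w)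
      + v (Sum.inr ()) * M.U (zVec w)) (v (Sum.inr ())) w := by
  rw [dotProduct_g, psi, dotProduct_ut]

lemma xMeas_sum {ι : Type*} (s : Finset ι) {f : ι → Obs r → ℝ} (hf : ∀ k, M.XMeas (f k)) :
    M.XMeas (fun w => ∑ k ∈ s, f k w) := by
  classical
  induction s using Finset.induction_on with
  | empty => simpa using aestronglyMeasurable_const
  | insert a s ha ih =>
    simp only [Finset.sum_insert ha]
    exact (hf a).add ih

variable (hR : M.Regular S c C ρ) (hM : M.Assumptions)

include hR hM

lemma xMeas_dotProduct_u {K : ℕ} (a : Fin K → ℝ) :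
    M.XMeas (fun w => a ⬝ᵥ M.u K (xVec w)) := by
  refine xMeas_comp (f := fun x => a ⬝ᵥ M.u K x) ?_
  have := hM.u_meas K
  unfold dotProduct
  fun_prop

lemma Regular.memLp_dotProduct_u {K : ℕ} (hK : p ≤ K) (a : Fin K → ℝ) :
    MemLp (fun w => a ⬝ᵥ M.u K (xVec w)) 2 M.P := by
  have := hM.isProb
  refine MemLp.of_bound ((xMeas_dotProduct_u hR hM a).mono sigmaX_le) (eucl a * (C * K)) ?_
  filter_upwards [hR.ae_mem] with w hw
  refine (abs_dotProduct_le _ _).trans ?_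
  have := eucl_nonneg a
  gcongr
  exact hR.eucl_u_le w hw K hK

lemma Regular.memLp_dotProduct_ut {K : ℕ} (hK : p ≤ K) (v : Fin K ⊕ Unit → ℝ) :
    MemLp (fun w => v ⬝ᵥ M.ut K w) 2 M.P := by
  simp only [dotProduct_ut]
  exact memLp_add_mul_U hM (hR.memLp_dotProduct_u hM hK _) _

lemma Regular.memLp_dotProduct_g {K : ℕ} (hK : p ≤ K) (v : Fin K ⊕ Unit → ℝ) :
    MemLp (fun w => v ⬝ᵥ M.g K w (M.γ₀, M.θ₀)) 2 M.P := by
  simp only [dotProduct_g_eq_psi]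
  exact hR.memLp_psi hM (memLp_add_mul_U hM (hR.memLp_dotProduct_u hM hK _) _) _

lemma Regular.integral_dotProduct_g {K : ℕ} (hK : p ≤ K) (v : Fin K ⊕ Unit → ℝ) :
    ∫ w, v ⬝ᵥ M.g K w (M.γ₀, M.θ₀) ∂M.P = 0 := by
  simp only [dotProduct_g_eq_psi]
  exact hR.integral_psi hM (zMeas_add_mul_U hM (xMeas_dotProduct_u hR hM _) _)
    (memLp_add_mul_U hM (hR.memLp_dotProduct_u hM hK _) _) _

lemma Regular.memLp_ut_apply {K : ℕ} (hK : p ≤ K) (k : Fin K ⊕ Unit) :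
    MemLp (fun w => M.ut K w k) 2 M.P := by
  simpa using hR.memLp_dotProduct_ut hM hK (Pi.single k 1)

lemma Regular.memLp_g_apply {K : ℕ} (hK : p ≤ K) (k : Fin K ⊕ Unit) :
    MemLp (fun w => M.g K w (M.γ₀, M.θ₀) k) 2 M.P := by
  simpa using hR.memLp_dotProduct_g hM hK (Pi.single k 1)

omit hR hM in
/-- Integrals of quadratic forms. -/
lemma integral_dotProduct_mul_dotProduct {κ : Type*} [Fintype κ] {P : Measure (Obs r)}
    {f : Obs r → κ → ℝ} (hf : ∀ k, MemLp (fun w => f w k) 2 P) (v v' : κ → ℝ) :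
    v ⬝ᵥ (Matrix.of fun i j => ∫ w, f w i * f w j ∂P) *ᵥ v'
      = ∫ w, (v ⬝ᵥ f w) * (v' ⬝ᵥ f w) ∂P := by
  have hi : ∀ a b, Integrable (fun w => v a * v' b * (f w a * f w b)) P := fun a b =>
    ((hf a).integrable_mul (hf b)).const_mul _
  have h1 : ∀ w, (v ⬝ᵥ f w) * (v' ⬝ᵥ f w) = ∑ a, ∑ b, v a * v' b * (f w a * f w b) := by
    intro w
    rw [dotProduct, dotProduct, Finset.sum_mul_sum]
    refine Finset.sum_congr rfl fun a _ => Finset.sum_congr rfl fun b _ => by ring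
  simp only [h1]
  rw [integral_finsetSum _ fun a _ => integrable_finsetSum _ fun b _ => hi a b]
  refine Finset.sum_congr rfl fun a _ => ?_
  rw [integral_finsetSum _ fun b _ => hi a b, Matrix.mulVec, dotProduct, Finset.mul_sum]
  refine Finset.sum_congr rfl fun b _ => ?_
  rw [integral_const_mul, Matrix.of_apply]
  ring

lemma Regular.dotProduct_D_mulVec {K : ℕ} (hK : p ≤ K) (v v' : Fin K ⊕ Unit → ℝ) :
    v ⬝ᵥ M.D K *ᵥ v' = ∫ w, (v ⬝ᵥ M.g K w (M.γ₀, M.θ₀)) * (v' ⬝ᵥ M.g K w (M.γ₀, M.θ₀)) ∂M.P :=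
  integral_dotProduct_mul_dotProduct (fun k => hR.memLp_g_apply hM hK k) v v'

omit hR hM in
variable (M) in
/-- Bounds on second moments which are uniform in the number of matching functions. -/
structure UniformEig (κ₁ κ₂ : ℝ) : Prop where
  pos : 0 < κ₁
  one_le : 1 ≤ κ₂
  le_u : ∀ K, p ≤ K → ∀ a : Fin K → ℝ, κ₁ * eucl a ^ 2 ≤ ∫ w, (a ⬝ᵥ M.u K (xVec w)) ^ 2 ∂M.P
  ut_le : ∀ K, p ≤ K → ∀ v : Fin K ⊕ Unit → ℝ,
    ∫ w, (v ⬝ᵥ M.ut K w) ^ 2 ∂M.P ≤ κ₂ * eucl v ^ 2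
  eig_D : ∀ K, p ≤ K → EigIn (M.D K) κ₁ κ₂

/-- By `Regular.integral_psi_mul`, v · Dv = E[O (v · (u_K, U))²] + v_last² Var U. The lower bound
cannot come from the first term alone, as U may be close to the span of u_K; the variance term
controls v_last, and the Gram matrix then controls the other block. -/
lemma Regular.exists_uniformEig : ∃ κ₁ κ₂, M.UniformEig κ₁ κ₂ := by
  obtain ⟨a₀, b₀, ha₀, hab⟩ := hM.eigen
  have hgram : ∀ K, p ≤ K → ∀ a : Fin K → ℝ,
      a ⬝ᵥ M.gram K *ᵥ a = ∫ w, (a ⬝ᵥ M.u K (xVec w)) ^ 2 ∂M.P := by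
    intro K hK a
    have h := integral_dotProduct_mul_dotProduct (P := M.P) (f := fun w => M.u K (xVec w))
      (fun k => by simpa using hR.memLp_dotProduct_u hM hK (Pi.single k 1)) a a
    simpa [sq, gram] using h
  have hlow : ∀ K, p ≤ K → ∀ a : Fin K → ℝ,
      a₀ * eucl a ^ 2 ≤ ∫ w, (a ⬝ᵥ M.u K (xVec w)) ^ 2 ∂M.P := by
    intro K hK a
    have h := (hab K hK).1.dotProduct_mulVec_nonneg a
    rw [Matrix.sub_mulVec, Matrix.smul_mulVec, Matrix.one_mulVec, dotProduct_sub,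
      dotProduct_smul] at h
    simp only [star_trivial, smul_eq_mul] at h
    rw [hgram K hK, ← eucl_sq] at h
    linarith
  have hup : ∀ K, p ≤ K → ∀ a : Fin K → ℝ,
      ∫ w, (a ⬝ᵥ M.u K (xVec w)) ^ 2 ∂M.P ≤ b₀ * eucl a ^ 2 := by
    intro K hK a
    have h := (hab K hK).2.dotProduct_mulVec_nonneg a
    rw [Matrix.sub_mulVec, Matrix.smul_mulVec, Matrix.one_mulVec, dotProduct_sub,
      dotProduct_smul] at h
    simp only [star_trivial, smul_eq_mul] at h
    rw [hgram K hK, ← eucl_sq] at h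
    linarith
  set m := ∫ w, M.U (zVec w) ^ 2 ∂M.P with hm
  have hm0 : 0 ≤ m := integral_nonneg fun w => sq_nonneg _
  have hV := varU_pos hM
  have hc := hR.c_pos
  have hUi := hM.U_sq.integrable_sq
  have hsqi : ∀ K, p ≤ K → ∀ v : Fin K ⊕ Unit → ℝ,
      Integrable (fun w => (v ⬝ᵥ M.ut K w) ^ 2) M.P := fun K hK v =>
    (hR.memLp_dotProduct_ut hM hK v).integrable_sq
  have hui : ∀ K, p ≤ K → ∀ a : Fin K → ℝ,
      Integrable (fun w => (a ⬝ᵥ M.u K (xVec w)) ^ 2) M.P := fun K hK v =>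
    (hR.memLp_dotProduct_u hM hK v).integrable_sq
  have hut : ∀ K, p ≤ K → ∀ v : Fin K ⊕ Unit → ℝ,
      ∫ w, (v ⬝ᵥ M.ut K w) ^ 2 ∂M.P ≤ 2 * (|b₀| + m) * eucl v ^ 2 := by
    intro K hK v
    have h1 : ∫ w, (v ⬝ᵥ M.ut K w) ^ 2 ∂M.P
        ≤ ∫ w, (2 * (fstBlock v ⬝ᵥ M.u K (xVec w)) ^ 2
          + 2 * v (Sum.inr ()) ^ 2 * M.U (zVec w) ^ 2) ∂M.P := by
      refine integral_mono (hsqi K hK v) (((hui K hK _).const_mul 2).add (hUi.const_mul _))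
        fun w => ?_
      simp only [dotProduct_ut]
      nlinarith [sq_nonneg (fstBlock v ⬝ᵥ M.u K (xVec w) - v (Sum.inr ()) * M.U (zVec w))]
    rw [integral_add ((hui K hK _).const_mul 2) (hUi.const_mul _), integral_const_mul,
      integral_const_mul] at h1
    have h2 := hup K hK (fstBlock v)
    have h3 := eucl_sq_sum_type v
    have h4 : b₀ * eucl (fstBlock v) ^ 2 ≤ |b₀| * eucl (fstBlock v) ^ 2 :=
      mul_le_mul_of_nonneg_right (le_abs_self _) (sq_nonneg _)
    rw [h3]
    nlinarith [mul_nonneg (abs_nonneg b₀) (sq_nonneg (v (Sum.inr ()))),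
      mul_nonneg hm0 (sq_nonneg (eucl (fstBlock v)))]
  have hD : ∀ K, p ≤ K → ∀ v : Fin K ⊕ Unit → ℝ, v ⬝ᵥ M.D K *ᵥ v
      = ∫ w, M.odds w * (v ⬝ᵥ M.ut K w) ^ 2 ∂M.P + v (Sum.inr ()) ^ 2 * M.varU := by
    intro K hK v
    rw [hR.dotProduct_D_mulVec hM hK]
    simp only [dotProduct_g_eq_psi, dotProduct_ut]
    have hF := memLp_add_mul_U hM (hR.memLp_dotProduct_u hM hK (fstBlock v)) (v (Sum.inr ()))
    have hFZ := zMeas_add_mul_U hM (xMeas_dotProduct_u hR hM (fstBlock v)) (v (Sum.inr ()))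
    rw [hR.integral_psi_mul hM hFZ hF hFZ hF]
    simp only [sq]
  have hOi : ∀ K, p ≤ K → ∀ v : Fin K ⊕ Unit → ℝ,
      Integrable (fun w => M.odds w * (v ⬝ᵥ M.ut K w) ^ 2) M.P := fun K hK v => by
    refine ((hR.memLp_odds_mul hM (hR.memLp_dotProduct_ut hM hK v)).integrable_mul
      (hR.memLp_dotProduct_ut hM hK v)).congr (ae_of_all _ fun w => ?_)
    simp only [Pi.mul_apply]
    ring
  -- Only the fraction s of the first term is used: passing from v · (u_K, U) to its u_K block costs
  -- s c m v_last², and this s makes the cost at most half of the variance term.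
  set s := min 1 (M.varU / (2 * c * (m + 1))) with hs
  have hs0 : 0 < s := lt_min one_pos (by positivity)
  have hs1 : s ≤ 1 := min_le_left _ _
  have hs2 : s * (c * m) ≤ M.varU / 2 := by
    have h1 : s ≤ M.varU / (2 * c * (m + 1)) := min_le_right _ _
    calc s * (c * m) ≤ M.varU / (2 * c * (m + 1)) * (c * (m + 1)) := by
          gcongr; linarith
      _ = M.varU / 2 := by field_simp
  refine ⟨min a₀ (min (s * c * a₀ / 2) (M.varU / 2)),
    max 1 (max (2 * (|b₀| + m)) (1 / c * (2 * (|b₀| + m)) + M.varU)), ?_, le_max_left _ _, ?_, ?_,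
    ?_⟩
  · exact lt_min ha₀ (lt_min (by positivity) (by positivity))
  · intro K hK a
    exact le_trans (by gcongr; exact min_le_left _ _) (hlow K hK a)
  · intro K hK v
    refine (hut K hK v).trans ?_
    gcongr
    exact (le_max_left _ _).trans (le_max_right _ _)
  · intro K hK
    refine ⟨?_, fun v => ?_, fun v => ?_⟩
    · ext i j
      simp only [Matrix.transpose_apply, D, Matrix.of_apply]
      simp only [mul_comm]
    · rw [hD K hK]
      have h1 : c * ∫ w, (v ⬝ᵥ M.ut K w) ^ 2 ∂M.P ≤ ∫ w, M.odds w * (v ⬝ᵥ M.ut K w) ^ 2 ∂M.P := by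
        rw [← integral_const_mul]
        refine integral_mono_ae ((hsqi K hK v).const_mul c) (hOi K hK v) ?_
        filter_upwards [hR.ae_mem] with w hw
        have := (hR.odds_bounds hM hw).1
        gcongr
      have h2 : ∫ w, (fstBlock v ⬝ᵥ M.u K (xVec w)) ^ 2 ∂M.P
          ≤ ∫ w, (2 * (v ⬝ᵥ M.ut K w) ^ 2 + 2 * v (Sum.inr ()) ^ 2 * M.U (zVec w) ^ 2) ∂M.P := by
        refine integral_mono (hui K hK _) (((hsqi K hK v).const_mul 2).add (hUi.const_mul _))
          fun w => ?_
        simp only [dotProduct_ut]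
        nlinarith [sq_nonneg (fstBlock v ⬝ᵥ M.u K (xVec w) + 2 * (v (Sum.inr ()) * M.U (zVec w)))]
      rw [integral_add ((hsqi K hK v).const_mul 2) (hUi.const_mul _), integral_const_mul,
        integral_const_mul] at h2
      have h3 := hlow K hK (fstBlock v)
      set X := ∫ w, (v ⬝ᵥ M.ut K w) ^ 2 ∂M.P with hX
      have hX0 : 0 ≤ X := integral_nonneg fun w => sq_nonneg _
      have h4 : s * (c * X) ≤ 1 * (c * X) := by gcongr
      have h5 : s * c * (a₀ * eucl (fstBlock v) ^ 2)
          ≤ s * c * (2 * X + 2 * v (Sum.inr ()) ^ 2 * m) := by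
        have : 0 ≤ s * c := by positivity
        gcongr
        exact h3.trans h2
      have h6 : s * (c * m) * v (Sum.inr ()) ^ 2 ≤ M.varU / 2 * v (Sum.inr ()) ^ 2 := by gcongr
      have h7 : min a₀ (min (s * c * a₀ / 2) (M.varU / 2)) ≤ s * c * a₀ / 2 :=
        (min_le_right _ _).trans (min_le_left _ _)
      have h8 : min a₀ (min (s * c * a₀ / 2) (M.varU / 2)) ≤ M.varU / 2 :=
        (min_le_right _ _).trans (min_le_right _ _)
      rw [eucl_sq_sum_type]
      have h9 := mul_le_mul_of_nonneg_right h7 (sq_nonneg (eucl (fstBlock v)))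
      have h10 := mul_le_mul_of_nonneg_right h8 (sq_nonneg (v (Sum.inr ())))
      nlinarith
    · rw [hD K hK]
      have h1 : ∫ w, M.odds w * (v ⬝ᵥ M.ut K w) ^ 2 ∂M.P ≤ 1 / c * ∫ w, (v ⬝ᵥ M.ut K w) ^ 2 ∂M.P := by
        rw [← integral_const_mul]
        refine integral_mono_ae (hOi K hK v) ((hsqi K hK v).const_mul _) ?_
        filter_upwards [hR.ae_mem] with w hw
        have := (hR.odds_bounds hM hw).2
        gcongr
      have h2 : v (Sum.inr ()) ^ 2 ≤ eucl v ^ 2 := by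
        rw [eucl_sq_sum_type]
        linarith [sq_nonneg (eucl (fstBlock v))]
      calc _ ≤ 1 / c * (2 * (|b₀| + m) * eucl v ^ 2) + eucl v ^ 2 * M.varU := by
            refine add_le_add (h1.trans ?_) (by gcongr)
            gcongr
            exact hut K hK v
        _ = (1 / c * (2 * (|b₀| + m)) + M.varU) * eucl v ^ 2 := by ring
        _ ≤ _ := by
            gcongr
            exact (le_max_right _ _).trans (le_max_right _ _)

/-! ### Projections on the span of the moment functions -/

omit hR in
/-- Square integrable functions of `X` are limits of linear combinations of the matching
functions. -/
lemma exists_tendsto_matching {f : Obs r → ℝ} (hfX : M.XMeas f) (hf : MemLp f 2 M.P) :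
    ∃ β : (K : ℕ) → Fin K → ℝ,
      Tendsto (fun K => ∫ w, (f w - β K ⬝ᵥ M.u K (xVec w)) ^ 2 ∂M.P) atTop (𝓝 0) := by
  obtain ⟨f', hf', hff'⟩ := hfX
  obtain ⟨h, hh, rfl⟩ := hf'.exists_eq_measurable_comp
  have hL : MemLp h 2 (M.P.map xVec) := by
    rw [memLp_map_measure_iff hh.aestronglyMeasurable measurable_xVec.aemeasurable]
    exact hf.ae_eq hff'
  have hcongr : ∀ (K : ℕ) (β : Fin K → ℝ), ∫ w, (f w - β ⬝ᵥ M.u K (xVec w)) ^ 2 ∂M.P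
      = ∫ w, (h (xVec w) - β ⬝ᵥ M.u K (xVec w)) ^ 2 ∂M.P := by
    intro K β
    refine integral_congr_ae ?_
    filter_upwards [hff'] with w hw
    rw [hw, Function.comp_apply]
  simp only [hcongr]
  set I : (K : ℕ) → (Fin K → ℝ) → ℝ := fun K β =>
    ∫ w, (h (xVec w) - β ⬝ᵥ M.u K (xVec w)) ^ 2 ∂M.P with hI
  have hI0 : ∀ K β, 0 ≤ I K β := fun K β => integral_nonneg fun w => sq_nonneg _
  have hbdd : ∀ K, BddBelow (range (I K)) := fun K => ⟨0, by rintro _ ⟨β, rfl⟩; exact hI0 K β⟩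
  -- Near-minimizers with vanishing slack give one sequence of coefficients serving all ε at once.
  have hex : ∀ K : ℕ, ∃ β, I K β < (⨅ β, I K β) + 1 / ((K : ℝ) + 1) := fun K =>
    exists_lt_of_ciInf_lt (lt_add_of_pos_right _ (by positivity))
  choose β hβ using hex
  refine ⟨β, ?_⟩
  have hinf : Tendsto (fun K => ⨅ β, I K β) atTop (𝓝 0) := by
    rw [Metric.tendsto_nhds]
    intro ε hε
    filter_upwards [hM.dense h hL ε hε] with K hK
    obtain ⟨β', hβ'⟩ := hK
    rw [Real.dist_eq, sub_zero, abs_of_nonneg (le_ciInf (hI0 K))]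
    exact (ciInf_le (hbdd K) β').trans_lt hβ'
  have hlim := hinf.add (tendsto_one_div_add_atTop_nhds_zero_nat (𝕜 := ℝ))
  rw [add_zero] at hlim
  exact tendsto_of_tendsto_of_tendsto_of_le_of_le tendsto_const_nhds hlim (fun K => hI0 K _)
    (fun K => (hβ K).le)

omit hR hM in
variable (M) in
/-- The mean derivative of the moment function `g_K` in the `j`-th parameter. -/
def meanDeriv (K : ℕ) (j : Fin p ⊕ Unit) : Fin K ⊕ Unit → ℝ :=
  fun k => M.ell j (fun w => M.ut K w k) ((Pi.single (Sum.inr ()) 1 : Fin K ⊕ Unit → ℝ) k)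

lemma Regular.integrable_dres_dir_mul {F : Obs r → ℝ} (hF : Integrable F M.P) (j : Fin p ⊕ Unit) :
    Integrable (fun w => M.dres M.γ₀ w (dir p j).1 * F w) M.P := by
  rcases j with j | _
  · refine hF.bdd_mul (c := C) (hR.aesm_dres hM j) ?_
    filter_upwards [hR.ae_mem] with w hw using hR.abs_dres_le hM hw j
  · simp [dir]

lemma Regular.dotProduct_meanDeriv {K : ℕ} (hK : p ≤ K) (v : Fin K ⊕ Unit → ℝ)
    (j : Fin p ⊕ Unit) :
    v ⬝ᵥ M.meanDeriv K j = M.ell j (fun w => v ⬝ᵥ M.ut K w) (v (Sum.inr ())) := by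
  have := hM.isProb
  have hi := fun k => hR.integrable_dres_dir_mul hM
    ((hR.memLp_ut_apply hM hK k).integrable one_le_two) j
  simp only [ell, meanDeriv, dotProduct, mul_add, Finset.sum_add_distrib]
  congr 1
  · have h : ∀ w, M.dres M.γ₀ w (dir p j).1 * ∑ k, v k * M.ut K w k
        = ∑ k, v k * (M.dres M.γ₀ w (dir p j).1 * M.ut K w k) := by
      intro w
      rw [Finset.mul_sum]
      exact Finset.sum_congr rfl fun k _ => by ring
    simp only [h]
    rw [integral_finsetSum _ fun k _ => (hi k).const_mul _]
    simp only [integral_const_mul]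
  · simp [Pi.single_apply]

omit hR hM in
variable (M) in
/-- The coefficients of the projection of the representer `φ_j` on the span of the moments. -/
def projCoef (K : ℕ) (j : Fin p ⊕ Unit) : Fin K ⊕ Unit → ℝ := (M.D K)⁻¹ *ᵥ M.meanDeriv K j

variable {κ₁ κ₂ : ℝ} (hE : M.UniformEig κ₁ κ₂)

include hE

lemma Regular.D_mulVec_projCoef {K : ℕ} (hK : p ≤ K) (j : Fin p ⊕ Unit) :
    M.D K *ᵥ M.projCoef K j = M.meanDeriv K j :=
  (hE.eig_D K hK).mulVec_inv hE.pos _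

/-- The mean derivative is the vector of pairings of φ_j with the moments, so the system defining
`projCoef` is the system of normal equations for projecting φ_j. -/
lemma Regular.integral_phi_mul_g {K : ℕ} (hK : p ≤ K) (v : Fin K ⊕ Unit → ℝ)
    (j : Fin p ⊕ Unit) :
    ∫ w, M.phi j w * (v ⬝ᵥ M.g K w (M.γ₀, M.θ₀)) ∂M.P = v ⬝ᵥ M.meanDeriv K j := by
  rw [hR.dotProduct_meanDeriv hM hK]
  simp only [dotProduct_g_eq_psi, dotProduct_ut]
  exact hR.integral_phi_mul_psi hM (xMeas_dotProduct_u hR hM _)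
    (hR.memLp_dotProduct_u hM hK _) _ j

/-- Pythagoras: by the normal equations the projection error is orthogonal to the span of the
moments. -/
lemma Regular.integral_sq_projCoef_le {K : ℕ} (hK : p ≤ K) (v : Fin K ⊕ Unit → ℝ)
    (j : Fin p ⊕ Unit) :
    ∫ w, (M.projCoef K j ⬝ᵥ M.g K w (M.γ₀, M.θ₀) - M.phi j w) ^ 2 ∂M.P
      ≤ ∫ w, (v ⬝ᵥ M.g K w (M.γ₀, M.θ₀) - M.phi j w) ^ 2 ∂M.P := by
  set b := M.projCoef K j with hb
  have hbL := (hR.memLp_dotProduct_g hM hK b).sub (hR.memLp_phi hM j)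
  have hdL := hR.memLp_dotProduct_g hM hK (v - b)
  have hcross : ∫ w, ((v - b) ⬝ᵥ M.g K w (M.γ₀, M.θ₀))
      * (b ⬝ᵥ M.g K w (M.γ₀, M.θ₀) - M.phi j w) ∂M.P = 0 := by
    have h1 : ∀ w, ((v - b) ⬝ᵥ M.g K w (M.γ₀, M.θ₀))
        * (b ⬝ᵥ M.g K w (M.γ₀, M.θ₀) - M.phi j w)
        = ((v - b) ⬝ᵥ M.g K w (M.γ₀, M.θ₀)) * (b ⬝ᵥ M.g K w (M.γ₀, M.θ₀))
          - M.phi j w * ((v - b) ⬝ᵥ M.g K w (M.γ₀, M.θ₀)) := fun w => by ring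
    simp only [h1]
    rw [integral_sub (integrable_fun_mul hdL (hR.memLp_dotProduct_g hM hK b))
      (integrable_fun_mul (hR.memLp_phi hM j) hdL), hR.integral_phi_mul_g hM hE hK,
      ← hR.dotProduct_D_mulVec hM hK, hR.D_mulVec_projCoef hM hE hK, sub_self]
  have h2 : ∀ w, (v ⬝ᵥ M.g K w (M.γ₀, M.θ₀) - M.phi j w) ^ 2
      = ((v - b) ⬝ᵥ M.g K w (M.γ₀, M.θ₀)) ^ 2
        + 2 * (((v - b) ⬝ᵥ M.g K w (M.γ₀, M.θ₀)) * (b ⬝ᵥ M.g K w (M.γ₀, M.θ₀) - M.phi j w))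
        + (b ⬝ᵥ M.g K w (M.γ₀, M.θ₀) - M.phi j w) ^ 2 := by
    intro w
    rw [sub_dotProduct]
    ring
  have i1 := hdL.integrable_sq
  have i2 : Integrable (fun w => 2 * (((v - b) ⬝ᵥ M.g K w (M.γ₀, M.θ₀))
      * (b ⬝ᵥ M.g K w (M.γ₀, M.θ₀) - M.phi j w))) M.P := (hdL.integrable_mul hbL).const_mul 2
  have i12 : Integrable (fun w => ((v - b) ⬝ᵥ M.g K w (M.γ₀, M.θ₀)) ^ 2
        + 2 * (((v - b) ⬝ᵥ M.g K w (M.γ₀, M.θ₀)) * (b ⬝ᵥ M.g K w (M.γ₀, M.θ₀) - M.phi j w))) M.P :=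
    i1.add i2
  have i3 : Integrable (fun w => (b ⬝ᵥ M.g K w (M.γ₀, M.θ₀) - M.phi j w) ^ 2) M.P :=
    hbL.integrable_sq
  simp only [h2]
  rw [integral_add i12 i3, integral_add i1 i2, integral_const_mul, hcross]
  have : 0 ≤ ∫ w, ((v - b) ⬝ᵥ M.g K w (M.γ₀, M.θ₀)) ^ 2 ∂M.P :=
    integral_nonneg fun w => sq_nonneg _
  linarith

/-- The projections of the representers on the span of the moments converge to the
representers. -/
theorem Regular.tendsto_projCoef (j : Fin p ⊕ Unit) :
    Tendsto (fun K => ∫ w, (M.projCoef K j ⬝ᵥ M.g K w (M.γ₀, M.θ₀) - M.phi j w) ^ 2 ∂M.P) atTop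
      (𝓝 0) := by
  -- The X-part of φ_j. Its remaining part, a multiple of (1 - T/π) U + (θ₀ - U), is exactly a
  -- multiple of the last moment, so only f has to be approximated.
  set f : Obs r → ℝ := fun w => ∑ k, M.effCoef j (Sum.inl k) * M.mFun w k
    + (-M.effCoef j (Sum.inr ())) * M.rFun w with hf
  have hmL : ∀ k, MemLp (fun w => M.mFun w k) 2 M.P := fun k => hR.memLp_effF hM (Sum.inl k)
  have hrL : MemLp M.rFun 2 M.P := hR.memLp_condRatio hM hM.U_sq
  have hmX : ∀ k, M.XMeas (fun w => M.mFun w k) := fun k => xMeas_condRatio _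
  have hrX : M.XMeas M.rFun := xMeas_condRatio _
  have hfL : MemLp f 2 M.P :=
    (memLp_finsetSum _ fun k _ => (hmL k).const_mul _).add (hrL.const_mul _)
  have hfX : M.XMeas f := by
    refine AEStronglyMeasurable.add ?_ (hrX.const_mul _)
    exact xMeas_sum _ fun k => (hmX k).const_mul _
  obtain ⟨β, hβ⟩ := exists_tendsto_matching hM hfX hfL
  have hphi : ∀ w, M.phi j w = M.resid M.γ₀ w * (f w + M.effCoef j (Sum.inr ()) * M.U (zVec w))
      + M.effCoef j (Sum.inr ()) * (M.θ₀ - M.U (zVec w)) := by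
    intro w
    simp only [phi, Seff_eq, Fintype.sum_sum_type, effF, effβ, Sum.elim_inl, Sum.elim_inr,
      Finset.univ_unique, Finset.sum_singleton, zero_mul, add_zero, hf]
    have : ∀ k, M.effCoef j (Sum.inl k) * (M.resid M.γ₀ w * M.mFun w k)
        = M.resid M.γ₀ w * (M.effCoef j (Sum.inl k) * M.mFun w k) := fun k => by ring
    simp only [this, ← Finset.mul_sum]
    rw [show (default : Unit) = () from rfl]
    ring
  have hlim := hβ.const_mul (C ^ 2)
  rw [mul_zero] at hlim
  refine tendsto_of_tendsto_of_tendsto_of_le_of_le' tendsto_const_nhds hlim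
    (Eventually.of_forall fun K => integral_nonneg fun w => sq_nonneg _) ?_
  filter_upwards [eventually_ge_atTop p] with K hK
  set v : Fin K ⊕ Unit → ℝ := Sum.elim (β K) (fun _ => M.effCoef j (Sum.inr ())) with hv
  refine (hR.integral_sq_projCoef_le hM hE hK v j).trans ?_
  rw [← integral_const_mul]
  refine integral_mono_ae ?_ ?_ ?_
  · exact ((hR.memLp_dotProduct_g hM hK v).sub (hR.memLp_phi hM j)).integrable_sq
  · exact ((hfL.sub (hR.memLp_dotProduct_u hM hK (β K))).integrable_sq).const_mul _
  · filter_upwards [hR.ae_mem] with w hw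
    have h1 : v ⬝ᵥ M.g K w (M.γ₀, M.θ₀) - M.phi j w
        = -M.resid M.γ₀ w * (f w - β K ⬝ᵥ M.u K (xVec w)) := by
      rw [hphi, dotProduct_g, dotProduct_ut]
      have : fstBlock v = β K := rfl
      rw [this]
      simp only [hv, Sum.elim_inr]
      ring
    simp only [h1, mul_pow]
    have h2 := hR.abs_resid_le w hw _ hM.γ₀_mem'
    have h3 : (-M.resid M.γ₀ w) ^ 2 ≤ C ^ 2 := by
      rw [neg_sq]
      exact sq_le_sq' (by linarith [neg_abs_le (M.resid M.γ₀ w)]) ((le_abs_self _).trans h2)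
    gcongr

/-- Convergence of b · g_K in L² bounds b · Db, and D ≥ κ₁ uniformly in K. Without this uniform
bound the errors tested against b could grow with K. -/
lemma Regular.exists_eucl_projCoef_le :
    ∃ B, 0 < B ∧ ∀ j, ∀ᶠ K in atTop, eucl (M.projCoef K j) ≤ B := by
  have h : ∀ j, ∀ᶠ K in atTop, eucl (M.projCoef K j)
      ≤ √((2 + 2 * ∫ w, M.phi j w ^ 2 ∂M.P) / κ₁) := by
    intro j
    have hlim := hR.tendsto_projCoef hM hE j
    filter_upwards [eventually_ge_atTop p, hlim.eventually (gt_mem_nhds one_pos)] with K hK hlt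
    refine Real.le_sqrt_of_sq_le ?_
    rw [le_div_iff₀ hE.pos]
    set b := M.projCoef K j with hb
    have h1 := (hE.eig_D K hK).lower b
    rw [hR.dotProduct_D_mulVec hM hK] at h1
    have hbL := hR.memLp_dotProduct_g hM hK b
    have hφ := hR.memLp_phi hM j
    have h2 : ∫ w, (b ⬝ᵥ M.g K w (M.γ₀, M.θ₀)) * (b ⬝ᵥ M.g K w (M.γ₀, M.θ₀)) ∂M.P
        ≤ ∫ w, (2 * (b ⬝ᵥ M.g K w (M.γ₀, M.θ₀) - M.phi j w) ^ 2 + 2 * M.phi j w ^ 2) ∂M.P := by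
      refine integral_mono (hbL.integrable_mul hbL) ?_ fun w => ?_
      · exact ((hbL.sub hφ).integrable_sq.const_mul 2).add (hφ.integrable_sq.const_mul 2)
      · simp only
        nlinarith [sq_nonneg (b ⬝ᵥ M.g K w (M.γ₀, M.θ₀) - 2 * M.phi j w)]
    have i1 : Integrable (fun w => 2 * (b ⬝ᵥ M.g K w (M.γ₀, M.θ₀) - M.phi j w) ^ 2) M.P :=
      (hbL.sub hφ).integrable_sq.const_mul 2
    rw [integral_add i1 (hφ.integrable_sq.const_mul 2), integral_const_mul,
      integral_const_mul] at h2
    linarith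
  refine ⟨1 + ∑ j, √((2 + 2 * ∫ w, M.phi j w ^ 2 ∂M.P) / κ₁), by positivity, fun j => ?_⟩
  filter_upwards [h j] with K hK
  refine hK.trans ?_
  have := Finset.single_le_sum (f := fun j => √((2 + 2 * ∫ w, M.phi j w ^ 2 ∂M.P) / κ₁))
    (fun _ _ => Real.sqrt_nonneg _) (Finset.mem_univ j)
  linarith

/-- The mean derivatives of the projected moments converge to the second moments of the
representers. -/
lemma Regular.tendsto_projCoef_meanDeriv (j k : Fin p ⊕ Unit) :
    Tendsto (fun K => M.projCoef K j ⬝ᵥ M.meanDeriv K k) atTop (𝓝 (M.phiCov j k)) := by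
  have hφj := hR.memLp_phi hM j
  have hφk := hR.memLp_phi hM k
  have hlim := ((hR.tendsto_projCoef hM hE j).mul_const (∫ w, M.phi k w ^ 2 ∂M.P))
  rw [zero_mul] at hlim
  have hlim2 := (Real.continuous_sqrt.tendsto _).comp hlim
  rw [Real.sqrt_zero] at hlim2
  rw [tendsto_iff_dist_tendsto_zero]
  refine tendsto_of_tendsto_of_tendsto_of_le_of_le' tendsto_const_nhds hlim2
    (Eventually.of_forall fun _ => dist_nonneg) ?_
  filter_upwards [eventually_ge_atTop p] with K hK
  have hbL := hR.memLp_dotProduct_g hM hK (M.projCoef K j)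
  -- The mean derivative is a pairing with φ_k, so the error is the pairing of φ_k with the
  -- projection error of φ_j.
  have h1 : M.projCoef K j ⬝ᵥ M.meanDeriv K k - M.phiCov j k
      = ∫ w, (M.projCoef K j ⬝ᵥ M.g K w (M.γ₀, M.θ₀) - M.phi j w) * M.phi k w ∂M.P := by
    have h2 : ∀ w, (M.projCoef K j ⬝ᵥ M.g K w (M.γ₀, M.θ₀) - M.phi j w) * M.phi k w
        = M.phi k w * (M.projCoef K j ⬝ᵥ M.g K w (M.γ₀, M.θ₀)) - M.phi j w * M.phi k w :=
      fun w => by ring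
    simp only [h2]
    rw [integral_sub (integrable_fun_mul hφk hbL) (integrable_fun_mul hφj hφk),
      hR.integral_phi_mul_g hM hE hK, hR.integral_phi_mul_phi hM, phiCov]
  rw [Real.dist_eq, h1]
  refine Real.abs_le_sqrt ?_
  exact sq_integral_mul_le (hbL.sub hφj) hφk

end Model

end

end MNAR

namespace MNAR

noncomputable section

/-- For N = 0 the empirical mean is 0 by convention, so only an inequality holds for every N. -/
lemma emp_const_le {𝒲 : Type*} {N : ℕ} {d : ℕ → 𝒲} {q : ℝ} (hq : 0 ≤ q) :
    emp N d (fun _ => q) ≤ q := by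
  rcases eq_or_ne N 0 with rfl | hN
  · simpa [emp] using hq
  · rw [emp_const hN]

namespace Model

set_option linter.unusedSectionVars false

variable {r p : ℕ} {M : Model r p} {S : Set (Obs r)} {c C ρ : ℝ} {K N : ℕ} {d : ℕ → Obs r}
  {B : ℝ}

/-! ### Bounds for a given sample -/

variable (M) in
/-- The empirical mean of the moment function. -/
def gbar (K N : ℕ) (d : ℕ → Obs r) (η : EuclideanSpace ℝ (Fin p) × ℝ) : Fin K ⊕ Unit → ℝ :=
  fun k => emp N d fun w => M.g K w η k

variable (M) in
/-- The derivative of the empirical mean of the moment function at `γ` in the direction `h`. -/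
def dgbar (K N : ℕ) (d : ℕ → Obs r) (γ : EuclideanSpace ℝ (Fin p))
    (h : EuclideanSpace ℝ (Fin p) × ℝ) : Fin K ⊕ Unit → ℝ :=
  fun k => emp N d (fun w => M.dres γ w h.1 * M.ut K w k)
    + (Pi.single (Sum.inr ()) 1 : Fin K ⊕ Unit → ℝ) k * h.2

lemma dotProduct_emp {κ : Type*} [Fintype κ] (f : Obs r → κ → ℝ) (v : κ → ℝ) :
    v ⬝ᵥ (fun k => emp N d fun w => f w k) = emp N d fun w => v ⬝ᵥ f w := by
  simp only [dotProduct]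
  rw [emp_sum]
  exact Finset.sum_congr rfl fun k _ => (emp_const_mul _ _).symm

lemma dotProduct_gbar (v : Fin K ⊕ Unit → ℝ) (η : EuclideanSpace ℝ (Fin p) × ℝ) :
    v ⬝ᵥ M.gbar K N d η = emp N d fun w => v ⬝ᵥ M.g K w η := dotProduct_emp _ _

lemma dotProduct_dgbar (v : Fin K ⊕ Unit → ℝ) (γ : EuclideanSpace ℝ (Fin p))
    (h : EuclideanSpace ℝ (Fin p) × ℝ) :
    v ⬝ᵥ M.dgbar K N d γ h
      = emp N d (fun w => M.dres γ w h.1 * (v ⬝ᵥ M.ut K w)) + v (Sum.inr ()) * h.2 := by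
  have h1 : M.dgbar K N d γ h = (fun k => emp N d fun w => (M.dres γ w h.1 • M.ut K w) k)
      + h.2 • (Pi.single (Sum.inr ()) 1 : Fin K ⊕ Unit → ℝ) := by
    ext k
    simp [dgbar, mul_comm]
  rw [h1, dotProduct_add, dotProduct_emp, dotProduct_smul, dotProduct_single]
  simp only [dotProduct_smul, smul_eq_mul]
  ring

lemma G_eq (hN : N ≠ 0) (η : EuclideanSpace ℝ (Fin p) × ℝ) :
    M.G K N d η = (N : ℝ) • M.gbar K N d η := by
  have : (N : ℝ) ≠ 0 := by exact_mod_cast hN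
  ext k
  simp [G, gbar, emp, this]

lemma dotProduct_Dhat_mulVec (η : EuclideanSpace ℝ (Fin p) × ℝ) (v v' : Fin K ⊕ Unit → ℝ) :
    v ⬝ᵥ M.Dhat K N d η *ᵥ v' = emp N d fun w => (v ⬝ᵥ M.g K w η) * (v' ⬝ᵥ M.g K w η) := by
  rw [Dhat, Matrix.smul_mulVec, dotProduct_smul, Matrix.sum_mulVec, dotProduct_sum, emp,
    smul_eq_mul]
  congr 1
  refine Finset.sum_congr rfl fun i _ => ?_
  rw [Matrix.vecMulVec_mulVec, dotProduct_smul, dotProduct_comm (M.g K (d i) η) v']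
  simp

/-- The empirical second moments of `(u_K(X)ᵀ, U(Z))ᵀ` are bounded by `B`. -/
def EmpBound (M : Model r p) (K N : ℕ) (d : ℕ → Obs r) (B : ℝ) : Prop :=
  ∀ v : Fin K ⊕ Unit → ℝ, emp N d (fun w => (v ⬝ᵥ M.ut K w) ^ 2) ≤ B * eucl v ^ 2

lemma EmpBound.abs_emp_mul_le (hB : M.EmpBound K N d B) (hB0 : 0 ≤ B) {f : Obs r → ℝ} {q : ℝ}
    (hq : 0 ≤ q) (hf : ∀ i, |f (d i)| ≤ q) (v : Fin K ⊕ Unit → ℝ) :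
    |emp N d fun w => f w * (v ⬝ᵥ M.ut K w)| ≤ q * √B * eucl v := by
  refine (emp_mul_le_sqrt f fun w => v ⬝ᵥ M.ut K w).trans ?_
  have h1 : √(emp N d fun w => f w ^ 2) ≤ q := by
    refine Real.sqrt_le_iff.2 ⟨hq, ?_⟩
    refine (emp_mono (g := fun _ => q ^ 2) fun i => ?_).trans (emp_const_le (sq_nonneg q))
    exact sq_le_sq' (by linarith [neg_abs_le (f (d i)), hf i]) ((le_abs_self _).trans (hf i))
  have h2 : √(emp N d fun w => (v ⬝ᵥ M.ut K w) ^ 2) ≤ √B * eucl v := by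
    refine Real.sqrt_le_iff.2 ⟨mul_nonneg (Real.sqrt_nonneg _) (eucl_nonneg _), ?_⟩
    rw [mul_pow, Real.sq_sqrt hB0]
    exact hB v
  calc _ ≤ q * (√B * eucl v) := mul_le_mul h1 h2 (Real.sqrt_nonneg _) hq
    _ = _ := by ring

variable (hR : M.Regular S c C ρ)

include hR

/-- Mean value inequality on the closed ball of radius |γ - γ₀|, where the derivative differs from
its value at γ₀ by at most C |γ - γ₀|. -/
lemma Regular.abs_resid_taylor {w : Obs r} (hw : w ∈ S) {γ : EuclideanSpace ℝ (Fin p)}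
    (hγ : γ ∈ Metric.ball M.γ₀ ρ) :
    |M.resid γ w - M.resid M.γ₀ w - M.dres M.γ₀ w (γ - M.γ₀)| ≤ C * ‖γ - M.γ₀‖ ^ 2 := by
  have hC : 0 ≤ C := zero_le_one.trans hR.one_le
  have hsub : Metric.closedBall M.γ₀ ‖γ - M.γ₀‖ ⊆ Metric.ball M.γ₀ ρ :=
    Metric.closedBall_subset_ball (by rwa [← dist_eq_norm])
  have h := (convex_closedBall M.γ₀ ‖γ - M.γ₀‖).norm_image_sub_le_of_norm_hasFDerivWithin_le'
    (f := fun γ => M.resid γ w) (f' := fun γ => M.dres γ w) (φ := M.dres M.γ₀ w)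
    (C := C * ‖γ - M.γ₀‖) (x := M.γ₀) (y := γ)
    (fun x hx => (hR.hasFDerivAt w hw x (hsub hx)).hasFDerivWithinAt)
    (fun x hx => by
      refine (hR.dres_lip w hw x (hsub hx) _ (Metric.mem_ball_self hR.ρ_pos)).trans ?_
      gcongr
      rwa [Metric.mem_closedBall, dist_eq_norm] at hx)
    (Metric.mem_closedBall_self (norm_nonneg _)) (by simp [dist_eq_norm])
  calc _ ≤ C * ‖γ - M.γ₀‖ * ‖γ - M.γ₀‖ := h
    _ = _ := by ring

lemma Regular.abs_resid_sub_le {w : Obs r} (hw : w ∈ S) {γ : EuclideanSpace ℝ (Fin p)}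
    (hγ : γ ∈ Metric.ball M.γ₀ ρ) :
    |M.resid γ w - M.resid M.γ₀ w| ≤ C * ‖γ - M.γ₀‖ :=
  (convex_ball M.γ₀ ρ).norm_image_sub_le_of_norm_hasFDerivWithin_le
    (f := fun γ => M.resid γ w) (f' := fun γ => M.dres γ w)
    (fun x hx => (hR.hasFDerivAt w hw x hx).hasFDerivWithinAt)
    (fun x hx => hR.dres_le w hw x hx) (Metric.mem_ball_self hR.ρ_pos) hγ

variable (hd : ∀ i, d i ∈ S)

include hd

/-- Second order expansion of the empirical moments. -/
lemma Regular.eucl_gbar_taylor (hB : M.EmpBound K N d B) (hB0 : 0 ≤ B) (hN : N ≠ 0)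
    {η : EuclideanSpace ℝ (Fin p) × ℝ} (hη : η.1 ∈ Metric.ball M.γ₀ ρ) :
    eucl (M.gbar K N d η - M.gbar K N d (M.γ₀, M.θ₀)
      - M.dgbar K N d M.γ₀ (η - (M.γ₀, M.θ₀))) ≤ C * √B * ‖η.1 - M.γ₀‖ ^ 2 := by
  have hC : 0 ≤ C := zero_le_one.trans hR.one_le
  refine eucl_le_of_forall (fun v => ?_) (by positivity)
  rw [dotProduct_sub, dotProduct_sub, dotProduct_gbar, dotProduct_gbar, dotProduct_dgbar]
  -- The moments are affine in θ with no θ-γ interaction, so the remainder involves only the Taylor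
  -- remainder in γ.
  have h1 : (emp N d fun w => v ⬝ᵥ M.g K w η) - (emp N d fun w => v ⬝ᵥ M.g K w (M.γ₀, M.θ₀))
      - (emp N d (fun w => M.dres M.γ₀ w (η - (M.γ₀, M.θ₀)).1 * (v ⬝ᵥ M.ut K w))
        + v (Sum.inr ()) * (η - (M.γ₀, M.θ₀)).2)
      = emp N d fun w => (M.resid η.1 w - M.resid M.γ₀ w - M.dres M.γ₀ w (η.1 - M.γ₀))
        * (v ⬝ᵥ M.ut K w) := by
    have h2 : v (Sum.inr ()) * (η - (M.γ₀, M.θ₀)).2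
        = emp N d fun _ => v (Sum.inr ()) * (η.2 - M.θ₀) := by rw [emp_const hN]; rfl
    rw [h2, ← emp_sub, ← emp_add, ← emp_sub]
    congr 1
    ext w
    simp only [dotProduct_g, Prod.fst_sub]
    ring
  rw [h1]
  refine (hB.abs_emp_mul_le hB0 (q := C * ‖η.1 - M.γ₀‖ ^ 2) (by positivity)
    (fun i => hR.abs_resid_taylor (hd i) hη) v).trans (le_of_eq ?_)
  ring

lemma Regular.eucl_dgbar_sub_le (hB : M.EmpBound K N d B) (hB0 : 0 ≤ B)
    {γ : EuclideanSpace ℝ (Fin p)} (hγ : γ ∈ Metric.ball M.γ₀ ρ)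
    (h : EuclideanSpace ℝ (Fin p) × ℝ) :
    eucl (M.dgbar K N d γ h - M.dgbar K N d M.γ₀ h) ≤ C * √B * ‖γ - M.γ₀‖ * ‖h.1‖ := by
  have hC : 0 ≤ C := zero_le_one.trans hR.one_le
  refine eucl_le_of_forall (fun v => ?_) (by positivity)
  rw [dotProduct_sub, dotProduct_dgbar, dotProduct_dgbar, add_sub_add_right_eq_sub, ← emp_sub]
  have h1 : (fun w => M.dres γ w h.1 * (v ⬝ᵥ M.ut K w) - M.dres M.γ₀ w h.1 * (v ⬝ᵥ M.ut K w))
      = fun w => ((M.dres γ w - M.dres M.γ₀ w) h.1) * (v ⬝ᵥ M.ut K w) := by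
    ext w
    simp only [sub_apply]
    ring
  rw [h1]
  refine (hB.abs_emp_mul_le hB0 (q := C * ‖γ - M.γ₀‖ * ‖h.1‖) (by positivity)
    (fun i => ?_) v).trans (le_of_eq (by ring))
  refine ((M.dres γ (d i) - M.dres M.γ₀ (d i)).le_opNorm h.1).trans ?_
  gcongr
  exact hR.dres_lip _ (hd i) _ hγ _ (Metric.mem_ball_self hR.ρ_pos)

omit hR hd in
lemma EmpBound.emp_U_sq_le (hB : M.EmpBound K N d B) :
    emp N d (fun w => M.U (zVec w) ^ 2) ≤ B := by
  have h := hB (Pi.single (Sum.inr ()) 1)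
  have h1 : eucl (Pi.single (Sum.inr ()) 1 : Fin K ⊕ Unit → ℝ) ^ 2 = 1 := by
    rw [eucl_sq]; simp
  rw [h1] at h
  simpa [ut] using h

omit hR hd in
lemma sq_inr_le (v : Fin K ⊕ Unit → ℝ) : v (Sum.inr ()) ^ 2 ≤ eucl v ^ 2 := by
  rw [← sq_abs]
  exact pow_le_pow_left₀ (abs_nonneg _) (abs_le_eucl v _) 2

/-- A bound for the second moments of the moment functions. -/
lemma Regular.emp_sq_g_le (hB : M.EmpBound K N d B) {η : EuclideanSpace ℝ (Fin p) × ℝ} {τ : ℝ}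
    (hη : η.1 ∈ M.Γ) (hτ : |η.2| ≤ τ) (v : Fin K ⊕ Unit → ℝ) :
    emp N d (fun w => (v ⬝ᵥ M.g K w η) ^ 2) ≤ 3 * (C ^ 2 * B + τ ^ 2 + B) * eucl v ^ 2 := by
  have hτ0 : 0 ≤ τ := (abs_nonneg _).trans hτ
  have h1 : emp N d (fun w => (v ⬝ᵥ M.g K w η) ^ 2)
      ≤ emp N d fun w => 3 * C ^ 2 * (v ⬝ᵥ M.ut K w) ^ 2 + 3 * (v (Sum.inr ()) ^ 2 * τ ^ 2)
        + 3 * v (Sum.inr ()) ^ 2 * M.U (zVec w) ^ 2 := by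
    refine emp_mono fun i => ?_
    rw [dotProduct_g]
    have h2 := hR.abs_resid_le _ (hd i) _ hη
    have h3 : M.resid η.1 (d i) ^ 2 ≤ C ^ 2 :=
      sq_le_sq' (by linarith [neg_abs_le (M.resid η.1 (d i))]) ((le_abs_self _).trans h2)
    have h4 : η.2 ^ 2 ≤ τ ^ 2 := sq_le_sq' (by linarith [neg_abs_le η.2]) ((le_abs_self _).trans hτ)
    have h5 := mul_le_mul_of_nonneg_right h3 (sq_nonneg (v ⬝ᵥ M.ut K (d i)))
    have h6 := mul_le_mul_of_nonneg_left h4 (sq_nonneg (v (Sum.inr ())))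
    set a := M.resid η.1 (d i) * (v ⬝ᵥ M.ut K (d i)) with ha
    set b := v (Sum.inr ()) * η.2 with hb
    set e := v (Sum.inr ()) * M.U (zVec (d i)) with he
    have h7 : a + v (Sum.inr ()) * (η.2 - M.U (zVec (d i))) = a + b - e := by rw [hb, he]; ring
    have h8 : (a + b - e) ^ 2 ≤ 3 * a ^ 2 + 3 * b ^ 2 + 3 * e ^ 2 := by
      nlinarith [sq_nonneg (a - b), sq_nonneg (a + e), sq_nonneg (b + e)]
    rw [h7]
    refine h8.trans ?_
    rw [ha, hb, he, mul_pow, mul_pow, mul_pow]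
    linarith
  rw [emp_add, emp_add, emp_const_mul (3 * C ^ 2),
    emp_const_mul (3 * v (Sum.inr ()) ^ 2) fun w => M.U (zVec w) ^ 2] at h1
  have h2 := hB v
  have h3 := hB.emp_U_sq_le
  have h4 := sq_inr_le v
  have h5 : emp N d (fun _ => 3 * (v (Sum.inr ()) ^ 2 * τ ^ 2)) ≤ 3 * (v (Sum.inr ()) ^ 2 * τ ^ 2) :=
    emp_const_le (by positivity)
  have hU0 : 0 ≤ emp N d (fun w => M.U (zVec w) ^ 2) := emp_nonneg fun i => sq_nonneg _
  have h6 : 3 * C ^ 2 * emp N d (fun w => (v ⬝ᵥ M.ut K w) ^ 2) ≤ 3 * C ^ 2 * (B * eucl v ^ 2) := by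
    gcongr
  have h7 : 3 * (v (Sum.inr ()) ^ 2 * τ ^ 2) ≤ 3 * (eucl v ^ 2 * τ ^ 2) := by gcongr
  have h8 : 3 * v (Sum.inr ()) ^ 2 * emp N d (fun w => M.U (zVec w) ^ 2) ≤ 3 * eucl v ^ 2 * B := by
    gcongr
  linarith

/-- The estimated second moments of the moment functions are Lipschitz in the parameter. -/
lemma Regular.abs_Dhat_sub_le (hB : M.EmpBound K N d B) (hB0 : 0 ≤ B)
    {η : EuclideanSpace ℝ (Fin p) × ℝ} (hη : η.1 ∈ Metric.ball M.γ₀ ρ) {τ : ℝ}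
    (hτ : |η.2| ≤ τ) (hτ₀ : |M.θ₀| ≤ τ) (v v' : Fin K ⊕ Unit → ℝ) :
    |v ⬝ᵥ (M.Dhat K N d η - M.Dhat K N d (M.γ₀, M.θ₀)) *ᵥ v'|
      ≤ 2 * √(2 * C ^ 2 * (B + 1)) * √(3 * (C ^ 2 * B + τ ^ 2 + B)) * ‖η - (M.γ₀, M.θ₀)‖
        * eucl v * eucl v' := by
  have hC : 0 ≤ C := zero_le_one.trans hR.one_le
  set δ := ‖η - (M.γ₀, M.θ₀)‖ with hδ
  have hδ0 : 0 ≤ δ := norm_nonneg _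
  have hδ1 : ‖η.1 - M.γ₀‖ ≤ δ := norm_fst_le (η - (M.γ₀, M.θ₀))
  have hδ2 : |η.2 - M.θ₀| ≤ δ := norm_snd_le (η - (M.γ₀, M.θ₀))
  have hγ₀ : M.γ₀ ∈ M.Γ := interior_subset (hR.ball_sub (Metric.mem_ball_self hR.ρ_pos))
  have hηΓ : η.1 ∈ M.Γ := interior_subset (hR.ball_sub hη)
  set Δ : (Fin K ⊕ Unit → ℝ) → Obs r → ℝ := fun v w =>
    v ⬝ᵥ M.g K w η - v ⬝ᵥ M.g K w (M.γ₀, M.θ₀) with hΔ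
  have hΔb : ∀ v, √(emp N d fun w => Δ v w ^ 2) ≤ √(2 * C ^ 2 * (B + 1)) * δ * eucl v := by
    intro v
    refine Real.sqrt_le_iff.2 ⟨mul_nonneg (by positivity) (eucl_nonneg _), ?_⟩
    rw [mul_pow, mul_pow, Real.sq_sqrt (by positivity)]
    have h1 : (emp N d fun w => Δ v w ^ 2)
        ≤ emp N d fun w => 2 * C ^ 2 * δ ^ 2 * (v ⬝ᵥ M.ut K w) ^ 2
          + 2 * C ^ 2 * δ ^ 2 * v (Sum.inr ()) ^ 2 := by
      refine emp_mono fun i => ?_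
      have h2 : Δ v (d i) = (M.resid η.1 (d i) - M.resid M.γ₀ (d i)) * (v ⬝ᵥ M.ut K (d i))
          + v (Sum.inr ()) * (η.2 - M.θ₀) := by
        simp only [hΔ, dotProduct_g]
        ring
      have h3 := (hR.abs_resid_sub_le (hd i) hη).trans (mul_le_mul_of_nonneg_left hδ1 hC)
      have h4 : (M.resid η.1 (d i) - M.resid M.γ₀ (d i)) ^ 2 ≤ (C * δ) ^ 2 := by
        rw [← sq_abs]; gcongr
      -- The normalization 1 ≤ C lets one constant serve both the γ and the θ increment.
      have h5 : (η.2 - M.θ₀) ^ 2 ≤ (C * δ) ^ 2 := by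
        rw [← sq_abs]
        gcongr
        exact hδ2.trans (le_mul_of_one_le_left hδ0 hR.one_le)
      have h6 := mul_le_mul_of_nonneg_right h4 (sq_nonneg (v ⬝ᵥ M.ut K (d i)))
      have h7 := mul_le_mul_of_nonneg_right h5 (sq_nonneg (v (Sum.inr ())))
      rw [h2]
      nlinarith [sq_nonneg ((M.resid η.1 (d i) - M.resid M.γ₀ (d i)) * (v ⬝ᵥ M.ut K (d i))
        - v (Sum.inr ()) * (η.2 - M.θ₀))]
    rw [emp_add, emp_const_mul] at h1
    have h2 : emp N d (fun _ => 2 * C ^ 2 * δ ^ 2 * v (Sum.inr ()) ^ 2)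
        ≤ 2 * C ^ 2 * δ ^ 2 * v (Sum.inr ()) ^ 2 := emp_const_le (by positivity)
    have h3 : 2 * C ^ 2 * δ ^ 2 * v (Sum.inr ()) ^ 2 ≤ 2 * C ^ 2 * δ ^ 2 * eucl v ^ 2 := by
      have := sq_inr_le v
      gcongr
    have h4 : 2 * C ^ 2 * δ ^ 2 * emp N d (fun w => (v ⬝ᵥ M.ut K w) ^ 2)
        ≤ 2 * C ^ 2 * δ ^ 2 * (B * eucl v ^ 2) := by
      have := hB v
      gcongr
    linarith
  have hgb : ∀ (ξ : EuclideanSpace ℝ (Fin p) × ℝ), ξ.1 ∈ M.Γ → |ξ.2| ≤ τ → ∀ v,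
      √(emp N d fun w => (v ⬝ᵥ M.g K w ξ) ^ 2) ≤ √(3 * (C ^ 2 * B + τ ^ 2 + B)) * eucl v := by
    intro ξ hξ hξτ v
    refine Real.sqrt_le_iff.2 ⟨mul_nonneg (by positivity) (eucl_nonneg _), ?_⟩
    rw [mul_pow, Real.sq_sqrt (by positivity)]
    exact hR.emp_sq_g_le hd hB hξ hξτ v
  -- Difference of products: one factor is changed at a time, and each piece is bounded by
  -- Cauchy–Schwarz.
  have hsplit : v ⬝ᵥ (M.Dhat K N d η - M.Dhat K N d (M.γ₀, M.θ₀)) *ᵥ v'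
      = (emp N d fun w => Δ v w * (v' ⬝ᵥ M.g K w η))
        + emp N d fun w => (v ⬝ᵥ M.g K w (M.γ₀, M.θ₀)) * Δ v' w := by
    rw [Matrix.sub_mulVec, dotProduct_sub, dotProduct_Dhat_mulVec, dotProduct_Dhat_mulVec,
      ← emp_sub, ← emp_add]
    congr 1
    ext w
    simp only [hΔ]
    ring
  rw [hsplit]
  refine (abs_add_le _ _).trans ?_
  have h1 := (emp_mul_le_sqrt (N := N) (d := d) (Δ v) fun w => v' ⬝ᵥ M.g K w η).trans
    (mul_le_mul (hΔb v) (hgb η hηΓ hτ v') (Real.sqrt_nonneg _)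
      (mul_nonneg (by positivity) (eucl_nonneg _)))
  have h2 := (emp_mul_le_sqrt (N := N) (d := d) (fun w => v ⬝ᵥ M.g K w (M.γ₀, M.θ₀)) (Δ v')).trans
    (mul_le_mul (hgb _ hγ₀ hτ₀ v) (hΔb v') (Real.sqrt_nonneg _)
      (mul_nonneg (by positivity) (eucl_nonneg _)))
  refine (add_le_add h1 h2).trans (le_of_eq ?_)
  ring

/-! ### Minimizers of the criterion -/

variable {A : Matrix (Fin K ⊕ Unit) (Fin K ⊕ Unit) ℝ} {c₁ C₁ : ℝ}
  {η : EuclideanSpace ℝ (Fin p) × ℝ}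

omit hR hd in
lemma IsGMM.isMinOn_gbar (hN : N ≠ 0) (h : M.IsGMM K N d A η) :
    IsMinOn (fun η' => M.gbar K N d η' ⬝ᵥ (A⁻¹ *ᵥ M.gbar K N d η')) (M.Γ ×ˢ M.Θ) η := by
  intro η' hη'
  have h1 := h.2 hη'
  have hN' : (0 : ℝ) < (N : ℝ) * N := by
    have : (0 : ℝ) < N := by exact_mod_cast Nat.pos_of_ne_zero hN
    positivity
  have h2 : M.G K N d η ⬝ᵥ (A⁻¹ *ᵥ M.G K N d η) ≤ M.G K N d η' ⬝ᵥ (A⁻¹ *ᵥ M.G K N d η') := h1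
  simp only [G_eq hN, Matrix.mulVec_smul, smul_dotProduct, dotProduct_smul, smul_eq_mul,
    ← mul_assoc] at h2
  exact le_of_mul_le_mul_left h2 hN'

omit hd in
-- The criterion at the minimizer is at most its value at the truth, and both values are comparable
-- with squared norms of the sample moments.
lemma IsGMM.eucl_gbar_le (hM : M.Assumptions) (hN : N ≠ 0) (hA : EigIn A c₁ C₁) (hc₁ : 0 < c₁)
    (hC₁ : 0 < C₁) (h : M.IsGMM K N d A η) :
    eucl (M.gbar K N d η) ≤ √(C₁ / c₁) * eucl (M.gbar K N d (M.γ₀, M.θ₀)) := by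
  have h0 : (M.γ₀, M.θ₀) ∈ M.Γ ×ˢ M.Θ :=
    ⟨interior_subset hM.γ₀_mem, interior_subset hM.θ₀_mem⟩
  have h1 := h.isMinOn_gbar hN h0
  have h2 : M.gbar K N d η ⬝ᵥ (A⁻¹ *ᵥ M.gbar K N d η)
    ≤ M.gbar K N d (M.γ₀, M.θ₀) ⬝ᵥ (A⁻¹ *ᵥ M.gbar K N d (M.γ₀, M.θ₀)) := h1
  have h3 := (hA.inv_lower hc₁ hC₁ (M.gbar K N d η)).trans
    (h2.trans (hA.inv_upper hc₁ (M.gbar K N d (M.γ₀, M.θ₀))))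
  rw [div_le_div_iff₀ hC₁ hc₁] at h3
  refine le_of_sq_le_sq ?_ (mul_nonneg (Real.sqrt_nonneg _) (eucl_nonneg _))
  rw [mul_pow, Real.sq_sqrt (by positivity), div_mul_eq_mul_div, le_div_iff₀ hc₁]
  linarith

lemma Regular.hasDerivAt_gbar (hM : M.Assumptions) (hη : η.1 ∈ Metric.ball M.γ₀ ρ) (hN : N ≠ 0)
    (h : EuclideanSpace ℝ (Fin p) × ℝ) (k : Fin K ⊕ Unit) :
    HasDerivAt (fun s : ℝ => M.gbar K N d (η + s • h) k) (M.dgbar K N d η.1 h k) 0 := by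
  have hpt : ∀ i, HasDerivAt (fun s : ℝ => M.g K (d i) (η + s • h) k)
      (M.dres η.1 (d i) h.1 * M.ut K (d i) k
        + (Pi.single (Sum.inr ()) 1 : Fin K ⊕ Unit → ℝ) k * h.2) 0 := by
    intro i
    have hline : HasDerivAt (fun s : ℝ => η + s • h) h 0 := by
      simpa using ((hasDerivAt_id (0 : ℝ)).smul_const h).const_add η
    have hF := hR.hasFDerivAt_moment hM (hd i) (η := η + (0 : ℝ) • h) (by simpa using hη)
      (M.ut K (d i) k) ((Pi.single (Sum.inr ()) 1 : Fin K ⊕ Unit → ℝ) k) (M.U (zVec (d i)))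
    have h1 := hF.comp_hasDerivAt (0 : ℝ) hline
    have h2 : (fun s : ℝ => M.g K (d i) (η + s • h) k) = (fun η' : EuclideanSpace ℝ (Fin p) × ℝ =>
        M.resid η'.1 (d i) * M.ut K (d i) k
          + (Pi.single (Sum.inr ()) 1 : Fin K ⊕ Unit → ℝ) k * (η'.2 - M.U (zVec (d i))))
          ∘ fun s : ℝ => η + s • h := by
      ext s
      have := dotProduct_g (M := M) (Pi.single k (1 : ℝ)) (d i) (η + s • h)
      simp only [single_dotProduct, one_mul] at this
      rw [this]
      simp [Pi.single_apply, eq_comm]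
    rw [h2]
    refine h1.congr_deriv ?_
    simp only [add_apply, smul_apply, ContinuousLinearMap.comp_apply,
      ContinuousLinearMap.coe_fst', ContinuousLinearMap.coe_snd', zero_smul, add_zero, smul_eq_mul]
    ring
  have hsum := (HasDerivAt.fun_sum fun i (_ : i ∈ Finset.range N) => hpt i).const_mul
    ((N : ℝ)⁻¹)
  have hval : M.dgbar K N d η.1 h k = (N : ℝ)⁻¹ * ∑ i ∈ Finset.range N,
      (M.dres η.1 (d i) h.1 * M.ut K (d i) k
        + (Pi.single (Sum.inr ()) 1 : Fin K ⊕ Unit → ℝ) k * h.2) := by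
    have h3 : (Pi.single (Sum.inr ()) 1 : Fin K ⊕ Unit → ℝ) k * h.2
        = emp N d fun _ => (Pi.single (Sum.inr ()) 1 : Fin K ⊕ Unit → ℝ) k * h.2 :=
      (emp_const hN _).symm
    have h4 : M.dgbar K N d η.1 h k = emp N d fun w => M.dres η.1 w h.1 * M.ut K w k
        + (Pi.single (Sum.inr ()) 1 : Fin K ⊕ Unit → ℝ) k * h.2 := by
      rw [emp_add, ← h3, dgbar]
    rw [h4, emp]
  rw [hval]
  exact hsum

/-- The first order condition of an interior minimizer. -/
lemma Regular.first_order (hM : M.Assumptions) (hη : η.1 ∈ Metric.ball M.γ₀ ρ)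
    (hθ : η.2 ∈ interior M.Θ) (hN : N ≠ 0) (hA : Aᵀ = A) (hmin : M.IsGMM K N d A η)
    (h : EuclideanSpace ℝ (Fin p) × ℝ) :
    (A⁻¹ *ᵥ M.gbar K N d η) ⬝ᵥ M.dgbar K N d η.1 h = 0 := by
  have hAi : A⁻¹ᵀ = A⁻¹ := by rw [Matrix.transpose_nonsing_inv, hA]
  have hder : HasDerivAt (fun s : ℝ => ∑ k, M.gbar K N d (η + s • h) k *
      (∑ l, A⁻¹ k l * M.gbar K N d (η + s • h) l))
      (∑ k, (M.dgbar K N d η.1 h k * (∑ l, A⁻¹ k l * M.gbar K N d (η + (0 : ℝ) • h) l)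
        + M.gbar K N d (η + (0 : ℝ) • h) k * ∑ l, A⁻¹ k l * M.dgbar K N d η.1 h l)) 0 := by
    refine HasDerivAt.fun_sum fun k _ => ?_
    refine (hR.hasDerivAt_gbar hd hM hη hN h k).mul ?_
    exact HasDerivAt.fun_sum fun l _ => (hR.hasDerivAt_gbar hd hM hη hN h l).const_mul _
  -- Since η is interior to Γ × Θ, small steps in any direction stay admissible.
  have hloc : IsLocalMin (fun s : ℝ => ∑ k, M.gbar K N d (η + s • h) k *
      (∑ l, A⁻¹ k l * M.gbar K N d (η + s • h) l)) 0 := by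
    have hnhds : M.Γ ×ˢ M.Θ ∈ 𝓝 (η + (0 : ℝ) • h) := by
      rw [zero_smul, add_zero]
      exact prod_mem_nhds (mem_interior_iff_mem_nhds.1 (hR.ball_sub hη))
        (mem_interior_iff_mem_nhds.1 hθ)
    have hcont : ContinuousAt (fun s : ℝ => η + s • h) 0 := by fun_prop
    filter_upwards [hcont.eventually_mem hnhds] with s hs
    have h1 : M.gbar K N d η ⬝ᵥ (A⁻¹ *ᵥ M.gbar K N d η)
      ≤ M.gbar K N d (η + s • h) ⬝ᵥ (A⁻¹ *ᵥ M.gbar K N d (η + s • h)) :=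
      hmin.isMinOn_gbar hN hs
    simpa [dotProduct, Matrix.mulVec] using h1
  have h0 := hloc.hasDerivAt_eq_zero hder
  rw [zero_smul, add_zero, Finset.sum_add_distrib] at h0
  have e1 : ∑ k, M.dgbar K N d η.1 h k * (∑ l, A⁻¹ k l * M.gbar K N d η l)
      = (A⁻¹ *ᵥ M.gbar K N d η) ⬝ᵥ M.dgbar K N d η.1 h := by
    rw [dotProduct_comm]; rfl
  have e2 : ∑ k, M.gbar K N d η k * (∑ l, A⁻¹ k l * M.dgbar K N d η.1 h l)
      = (A⁻¹ *ᵥ M.gbar K N d η) ⬝ᵥ M.dgbar K N d η.1 h := by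
    have : ∑ k, M.gbar K N d η k * (∑ l, A⁻¹ k l * M.dgbar K N d η.1 h l)
        = M.gbar K N d η ⬝ᵥ A⁻¹ *ᵥ M.dgbar K N d η.1 h := rfl
    rw [this, Matrix.dotProduct_mulVec, ← Matrix.mulVec_transpose, hAi]
  rw [e1, e2] at h0
  linarith

omit hR hd in
lemma norm_dir_fst_le (j : Fin p ⊕ Unit) : ‖(dir p j).1‖ ≤ 1 := by
  rcases j with j | _ <;> simp [dir]

/-- The linearized first order condition, tested against a vector `b` with `D b` the mean
derivative. -/
theorem Regular.abs_linearization_le (hM : M.Assumptions) (hB : M.EmpBound K N d B)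
    (hB0 : 0 ≤ B) (hη : η.1 ∈ Metric.ball M.γ₀ ρ) (hθ : η.2 ∈ interior M.Θ) (hN : N ≠ 0)
    (hA : EigIn A c₁ C₁) (hc₁ : 0 < c₁) (hmin : M.IsGMM K N d A η) {b : Fin K ⊕ Unit → ℝ}
    {j : Fin p ⊕ Unit} (hb : M.D K *ᵥ b = M.meanDeriv K j) :
    |b ⬝ᵥ M.gbar K N d (M.γ₀, M.θ₀) + b ⬝ᵥ M.dgbar K N d M.γ₀ (η - (M.γ₀, M.θ₀))|
      ≤ eucl b * (C * √B * ‖η - (M.γ₀, M.θ₀)‖ ^ 2)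
        + (eucl (M.dgbar K N d M.γ₀ (dir p j) - M.meanDeriv K j)
          + C * √B * ‖η - (M.γ₀, M.θ₀)‖ + eucl (fstBlock ((A - M.D K) *ᵥ b)))
          * (eucl (M.gbar K N d η) / c₁) := by
  have hC : 0 ≤ C := zero_le_one.trans hR.one_le
  set lam := A⁻¹ *ᵥ M.gbar K N d η with hlam
  have hfo := fun h => hR.first_order hd hM hη hθ hN hA.symm hmin h
  -- The derivative of the moments in θ is the last unit vector, so the first order condition in θ
  -- says exactly this. It matters because U has only two moments: the last entry of (D̂ - D) b
  -- involves products of two square integrable functions and would have no rate, while the first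
  -- block suffices here.
  have hlam0 : lam (Sum.inr ()) = 0 := by
    have h1 := hfo (0, 1)
    rw [dotProduct_dgbar] at h1
    simpa [emp] using h1
  have hlamle : eucl lam ≤ eucl (M.gbar K N d η) / c₁ := hA.eucl_inv_le hc₁ _
  have hδ1 : ‖η.1 - M.γ₀‖ ≤ ‖η - (M.γ₀, M.θ₀)‖ := norm_fst_le (η - (M.γ₀, M.θ₀))
  have hT := hR.eucl_gbar_taylor hd hB hB0 hN hη
  set R := M.gbar K N d η - M.gbar K N d (M.γ₀, M.θ₀)
      - M.dgbar K N d M.γ₀ (η - (M.γ₀, M.θ₀)) with hRdef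
  set δ := ‖η - (M.γ₀, M.θ₀)‖ with hδ
  have hbG : b ⬝ᵥ M.gbar K N d η = (A *ᵥ b) ⬝ᵥ lam := by
    rw [← hA.dotProduct_comm, hlam, hA.mulVec_inv hc₁]
  -- A b is (A - D) b plus the mean derivative; the mean derivative is compared with the sample
  -- derivative at η, which is orthogonal to λ. Each surviving term is a small vector paired with λ,
  -- itself of the order of ḡ(η).
  have hAb : (A *ᵥ b) ⬝ᵥ lam = -((M.dgbar K N d M.γ₀ (dir p j) - M.meanDeriv K j) ⬝ᵥ lam)
      - (M.dgbar K N d η.1 (dir p j) - M.dgbar K N d M.γ₀ (dir p j)) ⬝ᵥ lam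
      + fstBlock ((A - M.D K) *ᵥ b) ⬝ᵥ fstBlock lam := by
    have h1 : ((A - M.D K) *ᵥ b) ⬝ᵥ lam = fstBlock ((A - M.D K) *ᵥ b) ⬝ᵥ fstBlock lam := by
      rw [dotProduct_sum_type, hlam0, mul_zero, add_zero]
    have h2 := hfo (dir p j)
    rw [← h1, Matrix.sub_mulVec, hb, sub_dotProduct, sub_dotProduct, sub_dotProduct]
    rw [dotProduct_comm] at h2
    rw [h2]
    ring
  have hid : b ⬝ᵥ M.gbar K N d (M.γ₀, M.θ₀) + b ⬝ᵥ M.dgbar K N d M.γ₀ (η - (M.γ₀, M.θ₀))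
      = (A *ᵥ b) ⬝ᵥ lam - b ⬝ᵥ R := by
    rw [← hbG, hRdef, dotProduct_sub, dotProduct_sub]
    ring
  have b1 : |b ⬝ᵥ R| ≤ eucl b * (C * √B * δ ^ 2) := by
    refine (abs_dotProduct_le _ _).trans (mul_le_mul_of_nonneg_left (hT.trans ?_) (eucl_nonneg _))
    gcongr
  have hl0 := eucl_nonneg lam
  have b2 : |(M.dgbar K N d M.γ₀ (dir p j) - M.meanDeriv K j) ⬝ᵥ lam|
      ≤ eucl (M.dgbar K N d M.γ₀ (dir p j) - M.meanDeriv K j) * eucl lam := abs_dotProduct_le _ _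
  have b3 : |(M.dgbar K N d η.1 (dir p j) - M.dgbar K N d M.γ₀ (dir p j)) ⬝ᵥ lam|
      ≤ C * √B * δ * eucl lam := by
    refine (abs_dotProduct_le _ _).trans (mul_le_mul_of_nonneg_right ?_ hl0)
    refine (hR.eucl_dgbar_sub_le hd hB hB0 hη _).trans ?_
    calc C * √B * ‖η.1 - M.γ₀‖ * ‖(dir p j).1‖ ≤ C * √B * δ * 1 := by
          gcongr
          exact norm_dir_fst_le j
      _ = _ := by ring
  have b4 : |fstBlock ((A - M.D K) *ᵥ b) ⬝ᵥ fstBlock lam|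
      ≤ eucl (fstBlock ((A - M.D K) *ᵥ b)) * eucl lam := by
    refine (abs_dotProduct_le _ _).trans (mul_le_mul_of_nonneg_left ?_ (eucl_nonneg _))
    refine le_of_sq_le_sq ?_ hl0
    rw [eucl_sq_sum_type lam]
    linarith [sq_nonneg (lam (Sum.inr ()))]
  rw [hid, hAb]
  have key : (eucl (M.dgbar K N d M.γ₀ (dir p j) - M.meanDeriv K j) + C * √B * δ
      + eucl (fstBlock ((A - M.D K) *ᵥ b))) * eucl lam
      ≤ (eucl (M.dgbar K N d M.γ₀ (dir p j) - M.meanDeriv K j) + C * √B * δ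
      + eucl (fstBlock ((A - M.D K) *ᵥ b))) * (eucl (M.gbar K N d η) / c₁) := by
    have h1 := eucl_nonneg (M.dgbar K N d M.γ₀ (dir p j) - M.meanDeriv K j)
    have h2 := eucl_nonneg (fstBlock ((A - M.D K) *ᵥ b))
    have h3 : 0 ≤ δ := norm_nonneg _
    gcongr
  rw [abs_le] at b1 b2 b3 b4 ⊢
  constructor <;> linarith [b1.1, b1.2, b2.1, b2.2, b3.1, b3.2, b4.1, b4.2]

end Model

end

end MNAR

/-! ### Operator bounds for sample moments and the arithmetic of the rates -/

namespace MNAR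

noncomputable section

/-- One scalar random variable, the Frobenius distance of the second moment matrices, controls all
test vectors simultaneously. -/
lemma emp_dotProduct_mul_sub {r : ℕ} {κ : Type*} [Fintype κ] {P : Measure (Obs r)}
    {f : Obs r → κ → ℝ} (hf : ∀ k, MemLp (fun w => f w k) 2 P) (N : ℕ) (d : ℕ → Obs r)
    (v v' : κ → ℝ) :
    |emp N d (fun w => (v ⬝ᵥ f w) * (v' ⬝ᵥ f w)) - ∫ w, (v ⬝ᵥ f w) * (v' ⬝ᵥ f w) ∂P|
      ≤ √(∑ k, ∑ l, (emp N d (fun w => f w k * f w l) - ∫ w, f w k * f w l ∂P) ^ 2)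
        * (eucl v * eucl v') := by
  have h1 : emp N d (fun w => (v ⬝ᵥ f w) * (v' ⬝ᵥ f w))
      = v ⬝ᵥ (Matrix.of fun k l => emp N d fun w => f w k * f w l) *ᵥ v' := by
    have h2 : (fun w => (v ⬝ᵥ f w) * (v' ⬝ᵥ f w))
        = fun w => ∑ k, ∑ l, v k * v' l * (f w k * f w l) := by
      ext w
      rw [dotProduct, dotProduct, Finset.sum_mul_sum]
      exact Finset.sum_congr rfl fun a _ => Finset.sum_congr rfl fun b _ => by ring
    rw [h2, emp_sum]
    refine Finset.sum_congr rfl fun k _ => ?_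
    rw [emp_sum, Matrix.mulVec, dotProduct, Finset.mul_sum]
    refine Finset.sum_congr rfl fun l _ => ?_
    rw [emp_const_mul, Matrix.of_apply]
    ring
  rw [h1, ← Model.integral_dotProduct_mul_dotProduct hf, ← dotProduct_sub, ← Matrix.sub_mulVec]
  refine (abs_dotProduct_le _ _).trans ?_
  have h3 := eucl_mulVec_sq_le ((Matrix.of fun k l => emp N d fun w => f w k * f w l)
    - Matrix.of fun k l => ∫ w, f w k * f w l ∂P) v'
  have h4 := Real.le_sqrt_of_sq_le h3
  rw [Real.sqrt_mul' _ (sq_nonneg _), Real.sqrt_sq (eucl_nonneg _)] at h4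
  calc _ ≤ eucl v * _ := mul_le_mul_of_nonneg_left h4 (eucl_nonneg v)
    _ = _ := by
        simp only [Matrix.sub_apply, Matrix.of_apply]
        ring

/-- For Chebyshev with weight √(NK): a sum of second moments of order K is negligible precisely
because K³/N → 0. -/
lemma sqrt_mul_self_mul {n k : ℝ} (hn : 0 < n) (hk : 0 < k) :
    √(n * k) * k = √(k ^ 3 / n) * n := by
  have h1 : (√(n * k) * k) ^ 2 = (√(k ^ 3 / n) * n) ^ 2 := by
    rw [mul_pow, mul_pow, Real.sq_sqrt (by positivity), Real.sq_sqrt (by positivity)]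
    field_simp
  exact (sq_eq_sq₀ (by positivity) (by positivity)).1 h1

/-- The companion for weight √(N/K), which tolerates sums of second moments of order K². -/
lemma sqrt_div_self_mul_sq {n k : ℝ} (hn : 0 < n) (hk : 0 < k) :
    √(n / k) * k ^ 2 = √(k ^ 3 / n) * n := by
  have h1 : (√(n / k) * k ^ 2) ^ 2 = (√(k ^ 3 / n) * n) ^ 2 := by
    rw [mul_pow, mul_pow, Real.sq_sqrt (by positivity), Real.sq_sqrt (by positivity)]
    field_simp
  exact (sq_eq_sq₀ (by positivity) (by positivity)).1 h1

lemma tendsto_zero_of_le_mul {α : Type*} {l : Filter α} {a f : α → ℝ}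
    (h : Tendsto (fun x => a x * f x ^ 2) l (𝓝 0)) (ha : ∀ᶠ x in l, 1 ≤ a x) :
    Tendsto f l (𝓝 0) := by
  have h2 : Tendsto (fun x => f x ^ 2) l (𝓝 0) := by
    refine tendsto_of_tendsto_of_tendsto_of_le_of_le' tendsto_const_nhds h
      (Eventually.of_forall fun x => sq_nonneg _) ?_
    filter_upwards [ha] with x hx
    exact le_mul_of_one_le_left (sq_nonneg _) hx
  have h3 := (Real.continuous_sqrt.tendsto _).comp h2
  rw [Real.sqrt_zero] at h3
  refine (tendsto_zero_iff_abs_tendsto_zero f).2 (h3.congr fun x => ?_)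
  simp [Real.sqrt_sq_eq_abs]

namespace Model

set_option linter.unusedSectionVars false

variable {r p : ℕ} {M : Model r p} {S : Set (Obs r)} {c C ρ : ℝ} {κ₁ κ₂ : ℝ}
  {Ω : Type*} [MeasurableSpace Ω] {μ : Measure Ω} [IsProbabilityMeasure μ] {W : ℕ → Ω → Obs r}
  {K : ℕ → ℕ}

/-! ### Sample moments with a growing number of matching functions -/

variable (hR : M.Regular S c C ρ) (hM : M.Assumptions) (hE : M.UniformEig κ₁ κ₂)
  (hS : IsIIDSample μ M.P W) (hK : Tendsto K atTop atTop)
  (hKN : Tendsto (fun N : ℕ => (K N : ℝ) ^ 3 / N) atTop (𝓝 0))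

include hK in
/-- Size conditions which hold eventually. -/
lemma eventually_size : ∀ᶠ N in atTop, N ≠ 0 ∧ p ≤ K N ∧ 1 ≤ K N := by
  filter_upwards [eventually_ne_atTop 0, hK.eventually_ge_atTop p, hK.eventually_ge_atTop 1]
    with N h1 h2 h3 using ⟨h1, h2, h3⟩

include hK hKN in
lemma eventually_le_size : ∀ᶠ N in atTop, K N ≤ N := by
  filter_upwards [eventually_size (p := 0) hK, hKN.eventually (gt_mem_nhds one_pos)] with N h1 h2
  obtain ⟨hN, _, hK1⟩ := h1
  have hN' : (0 : ℝ) < N := by exact_mod_cast Nat.pos_of_ne_zero hN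
  rw [div_lt_one hN'] at h2
  have h3 : K N ^ 3 < N := by exact_mod_cast h2
  exact (Nat.le_self_pow (by norm_num) _).trans h3.le

include hKN in
lemma tendsto_sqrt_size (q : ℝ) :
    Tendsto (fun N : ℕ => q * √((K N : ℝ) ^ 3 / N)) atTop (𝓝 0) := by
  have h := ((Real.continuous_sqrt.tendsto _).comp hKN).const_mul q
  simpa using h

include hR hM

include hE in
lemma Regular.integral_sq_u_le {k : ℕ} (hk : p ≤ k) (i : Fin k) :
    ∫ w, M.u k (xVec w) i ^ 2 ∂M.P ≤ κ₂ := by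
  have h := hE.ut_le k hk (Pi.single (Sum.inl i) 1)
  rw [eucl_sq] at h
  simpa [ut] using h

lemma Regular.memLp_u_apply {k : ℕ} (hk : p ≤ k) (i : Fin k) :
    MemLp (fun w => M.u k (xVec w) i) 2 M.P := by
  simpa using hR.memLp_dotProduct_u hM hk (Pi.single i 1)

/-- Products of a bounded multiple of a matching function with a square integrable function. -/
lemma Regular.memLp_mul_u_mul {k : ℕ} (hk : p ≤ k) (i : Fin k) {a b : Obs r → ℝ} {q : ℝ}
    (ha : AEStronglyMeasurable a M.P) (hq : ∀ w ∈ S, |a w| ≤ q) (hb : MemLp b 2 M.P) :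
    MemLp (fun w => a w * M.u k (xVec w) i * b w) 2 M.P := by
  refine MemLp.of_le_mul (c := q * (C * k)) hb
    ((ha.mul (hR.memLp_u_apply hM hk i).aestronglyMeasurable).mul hb.aestronglyMeasurable) ?_
  filter_upwards [hR.ae_mem] with w hw
  have h1 := (abs_le_eucl (M.u k (xVec w)) i).trans (hR.eucl_u_le w hw k hk)
  have h2 := hq w hw
  have h3 : 0 ≤ q := (abs_nonneg _).trans h2
  rw [norm_mul, norm_mul]
  simp only [Real.norm_eq_abs]
  gcongr

/-- Sums of second moments of products with the matching functions. -/
lemma Regular.sum_integral_sq_mul_u_mul_le {k : ℕ} (hk : p ≤ k) {a b : Obs r → ℝ} {q : ℝ}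
    (ha : AEStronglyMeasurable a M.P) (hq : ∀ w ∈ S, |a w| ≤ q) (hb : MemLp b 2 M.P) :
    ∑ i, ∫ w, (a w * M.u k (xVec w) i * b w) ^ 2 ∂M.P
      ≤ q ^ 2 * (C * k) ^ 2 * ∫ w, b w ^ 2 ∂M.P := by
  have hi := fun i => (hR.memLp_mul_u_mul hM hk i ha hq hb).integrable_sq
  rw [← integral_finsetSum _ fun i _ => hi i, ← integral_const_mul]
  refine integral_mono_ae (integrable_finsetSum _ fun i _ => hi i) (hb.integrable_sq.const_mul _) ?_
  filter_upwards [hR.ae_mem] with w hw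
  have h1 := hR.eucl_u_le w hw k hk
  have h2 := hq w hw
  have h3 : ∑ i, (a w * M.u k (xVec w) i * b w) ^ 2
      = a w ^ 2 * eucl (M.u k (xVec w)) ^ 2 * b w ^ 2 := by
    rw [eucl_sq, dotProduct, Finset.mul_sum, Finset.sum_mul]
    exact Finset.sum_congr rfl fun i _ => by ring
  have h4 : a w ^ 2 ≤ q ^ 2 := sq_le_sq' (by linarith [neg_abs_le (a w)]) ((le_abs_self _).trans h2)
  have h5 : eucl (M.u k (xVec w)) ^ 2 ≤ (C * k) ^ 2 := pow_le_pow_left₀ (eucl_nonneg _) h1 2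
  simp only [h3]
  gcongr

include hS hK hKN

include hE in
/-- The sample second moments converge in the Frobenius norm. -/
theorem Regular.tendsto_frobenius {a b : Obs r → ℝ} {q : ℝ}
    (ha : AEStronglyMeasurable a M.P) (hq : ∀ w ∈ S, |a w| ≤ q) (hb : MemLp b 2 M.P)
    {f : (k : ℕ) → Obs r → Fin k ⊕ Unit → ℝ}
    (hf : ∀ k w, f k w = Sum.elim (fun i => a w * M.u k (xVec w) i) fun _ => b w) :
    Tendsto (fun x : ℕ × Ω => ∑ k, ∑ l, (emp x.1 (fun i => W i x.2)
        (fun w => f (K x.1) w k * f (K x.1) w l)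
      - ∫ w, f (K x.1) w k * f (K x.1) w l ∂M.P) ^ 2) (inProb μ) (𝓝 0) := by
  have hau : ∀ {k : ℕ}, p ≤ k → ∀ i : Fin k, MemLp (fun w => a w * M.u k (xVec w) i) 2 M.P := by
    intro k hk i
    refine MemLp.of_le_mul (c := q) (hR.memLp_u_apply hM hk i)
      (ha.mul (hR.memLp_u_apply hM hk i).aestronglyMeasurable) ?_
    filter_upwards [hR.ae_mem] with w hw
    rw [norm_mul]
    gcongr
    exact hq w hw
  have hausq : ∀ {k : ℕ}, p ≤ k → ∀ i : Fin k,
      ∫ w, (a w * M.u k (xVec w) i) ^ 2 ∂M.P ≤ q ^ 2 * κ₂ := by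
    intro k hk i
    have h1 : ∫ w, (a w * M.u k (xVec w) i) ^ 2 ∂M.P
        ≤ ∫ w, q ^ 2 * M.u k (xVec w) i ^ 2 ∂M.P := by
      refine integral_mono_ae (hau hk i).integrable_sq
        ((hR.memLp_u_apply hM hk i).integrable_sq.const_mul _) ?_
      filter_upwards [hR.ae_mem] with w hw
      have h2 := hq w hw
      have h4 : a w ^ 2 ≤ q ^ 2 :=
        sq_le_sq' (by linarith [neg_abs_le (a w)]) ((le_abs_self _).trans h2)
      simp only [mul_pow]
      gcongr
    rw [integral_const_mul] at h1
    refine h1.trans ?_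
    have := hR.integral_sq_u_le hM hE hk i
    gcongr
  -- Summing over one index uses |u_K| ≤ CK pointwise and costs K²; the other index contributes K
  -- bounded second moments. This is where K³/N is needed.
  have h11 := hS.tendsto_sum_sq_emp_sub (ι := fun N => Fin (K N) × Fin (K N))
    (f := fun N kl w => a w * M.u (K N) (xVec w) kl.1 * (a w * M.u (K N) (xVec w) kl.2))
    (a := fun _ => 1) (c := fun N => q ^ 2 * C ^ 2 * (q ^ 2 * κ₂) * ((K N : ℝ) ^ 3 / N))
    (fun _ => zero_le_one) ?_ (by simpa using hKN.const_mul (q ^ 2 * C ^ 2 * (q ^ 2 * κ₂)))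
  swap
  · filter_upwards [eventually_size (p := p) hK] with N ⟨hN, hp, _⟩
    refine ⟨fun kl => hR.memLp_mul_u_mul hM hp kl.1 ha hq (hau hp kl.2), ?_⟩
    have hN' : (N : ℝ) ≠ 0 := by exact_mod_cast hN
    rw [one_mul, Fintype.sum_prod_type_right]
    calc _ ≤ ∑ l : Fin (K N), q ^ 2 * (C * K N) ^ 2 * (q ^ 2 * κ₂) := by
          refine Finset.sum_le_sum fun l _ => ?_
          refine (hR.sum_integral_sq_mul_u_mul_le hM hp ha hq (hau hp l)).trans ?_
          have := hausq hp l
          gcongr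
      _ = _ := by
          rw [Finset.sum_const, Finset.card_univ, Fintype.card_fin, nsmul_eq_mul]
          field_simp
  have h12 := hS.tendsto_sum_sq_emp_sub (ι := fun N => Fin (K N))
    (f := fun N k w => a w * M.u (K N) (xVec w) k * b w)
    (a := fun _ => 1) (c := fun N => q ^ 2 * C ^ 2 * (∫ w, b w ^ 2 ∂M.P) * ((K N : ℝ) ^ 3 / N))
    (fun _ => zero_le_one) ?_
      (by simpa using hKN.const_mul (q ^ 2 * C ^ 2 * (∫ w, b w ^ 2 ∂M.P)))
  swap
  · filter_upwards [eventually_size (p := p) hK] with N ⟨hN, hp, hK1⟩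
    refine ⟨fun k => hR.memLp_mul_u_mul hM hp k ha hq hb, ?_⟩
    have hN' : (N : ℝ) ≠ 0 := by exact_mod_cast hN
    have hK1' : (1 : ℝ) ≤ K N := by exact_mod_cast hK1
    have hb0 : 0 ≤ ∫ w, b w ^ 2 ∂M.P := integral_nonneg fun w => sq_nonneg _
    rw [one_mul]
    refine (hR.sum_integral_sq_mul_u_mul_le hM hp ha hq hb).trans ?_
    calc q ^ 2 * (C * K N) ^ 2 * ∫ w, b w ^ 2 ∂M.P
        = q ^ 2 * C ^ 2 * (∫ w, b w ^ 2 ∂M.P) * (K N : ℝ) ^ 2 := by ring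
      _ ≤ q ^ 2 * C ^ 2 * (∫ w, b w ^ 2 ∂M.P) * (K N : ℝ) ^ 3 := by
          have : (K N : ℝ) ^ 2 ≤ (K N : ℝ) ^ 3 := pow_le_pow_right₀ hK1' (by norm_num)
          gcongr
      _ = _ := by field_simp
  -- The corner entry is the mean of b², which is only integrable: Chebyshev is unavailable, and the
  -- law of large numbers gives convergence without a rate.
  have h22 := (((hS.tendsto_emp (integrable_fun_mul hb hb)).sub_const
    (∫ w, b w * b w ∂M.P))).pow 2
  rw [sub_self, zero_pow two_ne_zero] at h22
  have hsum := (h11.add (h12.const_mul 2)).add h22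
  simp only [mul_zero, add_zero] at hsum
  refine hsum.congr fun x => ?_
  simp only [hf, Fintype.sum_sum_type, Sum.elim_inl, Sum.elim_inr, Finset.univ_unique,
    Finset.sum_singleton, Finset.sum_add_distrib, one_mul, Fintype.sum_prod_type]
  have hcomm : ∀ k, (fun w => b w * (a w * M.u (K x.1) (xVec w) k))
      = fun w => a w * M.u (K x.1) (xVec w) k * b w := fun k => by ext w; ring
  simp only [hcomm]
  ring

omit hR hM hE hS hK hKN in
lemma ut_eq (k : ℕ) (w : Obs r) : M.ut k w
    = Sum.elim (fun i => (1 : ℝ) * M.u k (xVec w) i) fun _ => M.U (zVec w) := by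
  simp [ut]

include hE

/-- The sample second moments of `(u_K(X)ᵀ, U)ᵀ` are uniformly close to the moments. -/
lemma Regular.eventually_abs_emp_ut_sub_le {ε : ℝ} (hε : 0 < ε) :
    ∀ᶠ x in inProb μ, ∀ v : Fin (K x.1) ⊕ Unit → ℝ,
      |emp x.1 (fun i => W i x.2) (fun w => (v ⬝ᵥ M.ut (K x.1) w) ^ 2)
        - ∫ w, (v ⬝ᵥ M.ut (K x.1) w) ^ 2 ∂M.P| ≤ ε * eucl v ^ 2 := by
  have hF := hR.tendsto_frobenius hM hE hS hK hKN (a := fun _ => 1) (q := 1)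
    aestronglyMeasurable_const (by simp) hM.U_sq (f := M.ut) ut_eq
  have hF2 := (Real.continuous_sqrt.tendsto _).comp hF
  rw [Real.sqrt_zero] at hF2
  filter_upwards [hF2.eventually (gt_mem_nhds hε),
    tendsto_fst_inProb.eventually (eventually_size (p := p) hK)] with x hx ⟨_, hp, _⟩ v
  have h := emp_dotProduct_mul_sub (P := M.P) (f := M.ut (K x.1))
    (fun k => hR.memLp_ut_apply hM hp k) x.1 (fun i => W i x.2) v v
  simp only [← sq] at h
  refine h.trans ?_
  have : 0 ≤ eucl v ^ 2 := sq_nonneg _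
  exact mul_le_mul_of_nonneg_right hx.le this

theorem Regular.eventually_empBound :
    ∀ᶠ x in inProb μ, M.EmpBound (K x.1) x.1 (fun i => W i x.2) (κ₂ + 1) := by
  filter_upwards [hR.eventually_abs_emp_ut_sub_le hM hE hS hK hKN one_pos,
    tendsto_fst_inProb.eventually (eventually_size (p := p) hK)] with x hx ⟨_, hp, _⟩ v
  have h1 := (abs_le.1 (hx v)).2
  have h2 := hE.ut_le _ hp v
  linarith

omit hR hM hE hS hK hKN [IsProbabilityMeasure μ] [MeasurableSpace Ω] in
lemma dotProduct_W0_mulVec (k N : ℕ) (d : ℕ → Obs r) (v : Fin k ⊕ Unit → ℝ) :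
    v ⬝ᵥ M.W0 k N d *ᵥ v = emp N d (fun w => (fstBlock v ⬝ᵥ M.u k (xVec w)) ^ 2)
      + v (Sum.inr ()) ^ 2 := by
  have hv : v = Sum.elim (fstBlock v) (fun _ => v (Sum.inr ())) := by
    ext i; rcases i with i | _ <;> rfl
  have h1 : M.W0 k N d *ᵥ v = Sum.elim (((N : ℝ)⁻¹ • ∑ i ∈ Finset.range N,
      Matrix.vecMulVec (M.u k (xVec (d i))) (M.u k (xVec (d i)))) *ᵥ fstBlock v)
      (fun _ => v (Sum.inr ())) := by
    conv_lhs => rw [hv, W0, Matrix.fromBlocks_mulVec]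
    simp
  rw [h1, dotProduct_sum_type]
  congr 1
  · have h2 : fstBlock (Sum.elim (((N : ℝ)⁻¹ • ∑ i ∈ Finset.range N,
      Matrix.vecMulVec (M.u k (xVec (d i))) (M.u k (xVec (d i)))) *ᵥ fstBlock v)
      (fun _ => v (Sum.inr ()))) = ((N : ℝ)⁻¹ • ∑ i ∈ Finset.range N,
      Matrix.vecMulVec (M.u k (xVec (d i))) (M.u k (xVec (d i)))) *ᵥ fstBlock v := rfl
    rw [h2, Matrix.smul_mulVec, dotProduct_smul, Matrix.sum_mulVec, dotProduct_sum, emp,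
      smul_eq_mul]
    congr 1
    refine Finset.sum_congr rfl fun i _ => ?_
    rw [Matrix.vecMulVec_mulVec, dotProduct_smul, dotProduct_comm (M.u k (xVec (d i)))]
    simp [sq]
  · simp [sq]

/-- The first-step matrix has eigenvalues bounded away from zero and infinity. -/
theorem Regular.eventually_eigIn_W0 :
    ∀ᶠ x in inProb μ, EigIn (M.W0 (K x.1) x.1 (fun i => W i x.2)) (min (κ₁ / 2) 1)
      (κ₂ + κ₁ / 2) := by
  have hκ := hE.pos
  filter_upwards [hR.eventually_abs_emp_ut_sub_le hM hE hS hK hKN (half_pos hκ),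
    tendsto_fst_inProb.eventually (eventually_size (p := p) hK)] with x hx ⟨_, hp, _⟩
  have key : ∀ v : Fin (K x.1) ⊕ Unit → ℝ,
      |emp x.1 (fun i => W i x.2) (fun w => (fstBlock v ⬝ᵥ M.u (K x.1) (xVec w)) ^ 2)
        - ∫ w, (fstBlock v ⬝ᵥ M.u (K x.1) (xVec w)) ^ 2 ∂M.P| ≤ κ₁ / 2 * eucl (fstBlock v) ^ 2 ∧
      ∫ w, (fstBlock v ⬝ᵥ M.u (K x.1) (xVec w)) ^ 2 ∂M.P ≤ κ₂ * eucl (fstBlock v) ^ 2 := by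
    intro v
    -- Testing with zero last coordinate isolates the Gram matrix of u_K.
    have h1 := hx (Sum.elim (fstBlock v) 0)
    have h2 := hE.ut_le _ hp (Sum.elim (fstBlock v) 0)
    rw [eucl_sq_sum_type] at h1 h2
    have h3 : fstBlock (Sum.elim (fstBlock v) (0 : Unit → ℝ)) = fstBlock v := rfl
    simp only [dotProduct_ut, h3] at h1 h2
    simp only [Sum.elim_inr, Pi.zero_apply, zero_mul, add_zero, zero_pow two_ne_zero] at h1 h2
    exact ⟨h1, h2⟩
  refine ⟨?_, fun v => ?_, fun v => ?_⟩
  · rw [W0, Matrix.fromBlocks_transpose]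
    simp [Matrix.transpose_sum, Matrix.transpose_vecMulVec]
  · obtain ⟨h1, h2⟩ := key v
    have h3 := hE.le_u _ hp (fstBlock v)
    have h4 := (abs_le.1 h1).1
    have h5 := mul_le_mul_of_nonneg_right (min_le_left (κ₁ / 2) 1) (sq_nonneg (eucl (fstBlock v)))
    have h6 := mul_le_mul_of_nonneg_right (min_le_right (κ₁ / 2) 1) (sq_nonneg (v (Sum.inr ())))
    rw [dotProduct_W0_mulVec, eucl_sq_sum_type]
    linarith
  · obtain ⟨h1, h2⟩ := key v
    have h4 := (abs_le.1 h1).2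
    have h5 : 1 * v (Sum.inr ()) ^ 2 ≤ (κ₂ + κ₁ / 2) * v (Sum.inr ()) ^ 2 := by
      gcongr
      linarith [hE.one_le]
    rw [dotProduct_W0_mulVec, eucl_sq_sum_type]
    linarith

/-- The sample second moment matrix at the true parameter is uniformly close to `D`. -/
theorem Regular.eventually_abs_Dhat_sub_D_le {ε : ℝ} (hε : 0 < ε) :
    ∀ᶠ x in inProb μ, ∀ v v' : Fin (K x.1) ⊕ Unit → ℝ,
      |v ⬝ᵥ (M.Dhat (K x.1) x.1 (fun i => W i x.2) (M.γ₀, M.θ₀) - M.D (K x.1)) *ᵥ v'|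
        ≤ ε * (eucl v * eucl v') := by
  have hb : MemLp (fun w => M.θ₀ - tInd w / M.prob (zVec w) M.γ₀ * M.U (zVec w)) 2 M.P := by
    have h := hR.memLp_g_apply hM (K := p) le_rfl (Sum.inr ())
    simpa [g] using h
  have hF := hR.tendsto_frobenius hM hE hS hK hKN (a := M.resid M.γ₀) (q := C)
    (Regular.aesm_resid hM) (fun w hw => hR.abs_resid_le w hw _ hM.γ₀_mem') hb
    (f := fun k w => M.g k w (M.γ₀, M.θ₀)) (fun k w => rfl)
  have hF2 := (Real.continuous_sqrt.tendsto _).comp hF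
  rw [Real.sqrt_zero] at hF2
  filter_upwards [hF2.eventually (gt_mem_nhds hε),
    tendsto_fst_inProb.eventually (eventually_size (p := p) hK)] with x hx ⟨_, hp, _⟩ v v'
  have h := emp_dotProduct_mul_sub (P := M.P) (f := fun w => M.g (K x.1) w (M.γ₀, M.θ₀))
    (fun k => hR.memLp_g_apply hM hp k) x.1 (fun i => W i x.2) v v'
  rw [Matrix.sub_mulVec, dotProduct_sub, dotProduct_Dhat_mulVec, hR.dotProduct_D_mulVec hM hp]
  refine h.trans ?_
  exact mul_le_mul_of_nonneg_right hx.le (mul_nonneg (eucl_nonneg _) (eucl_nonneg _))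

/-- `√(N K) |Ĝ(γ₀, θ₀)|² → 0`. -/
theorem Regular.tendsto_eucl_gbar :
    Tendsto (fun x : ℕ × Ω => √((x.1 : ℝ) * K x.1)
      * eucl (M.gbar (K x.1) x.1 (fun i => W i x.2) (M.γ₀, M.θ₀)) ^ 2) (inProb μ) (𝓝 0) := by
  have h := hS.tendsto_sum_sq_emp_sub (ι := fun N => Fin (K N) ⊕ Unit)
    (f := fun N k w => M.g (K N) w (M.γ₀, M.θ₀) k)
    (a := fun N => √((N : ℝ) * K N)) (c := fun N => 2 * κ₂ * √((K N : ℝ) ^ 3 / N))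
    (fun _ => Real.sqrt_nonneg _) ?_ (tendsto_sqrt_size hKN _)
  · refine h.congr' ?_
    filter_upwards [tendsto_fst_inProb.eventually (eventually_size (p := p) hK)] with x ⟨_, hp, _⟩
    rw [eucl_sq, dotProduct]
    congr 1
    refine Finset.sum_congr rfl fun k _ => ?_
    have h0 : ∫ w, M.g (K x.1) w (M.γ₀, M.θ₀) k ∂M.P = 0 := by
      simpa using hR.integral_dotProduct_g hM hp (Pi.single k 1)
    rw [h0, sub_zero, sq]
    rfl
  · filter_upwards [eventually_size (p := p) hK] with N ⟨hN, hp, hK1⟩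
    refine ⟨fun k => hR.memLp_g_apply hM hp k, ?_⟩
    have hN' : (0 : ℝ) < N := by exact_mod_cast Nat.pos_of_ne_zero hN
    have hK1' : (1 : ℝ) ≤ K N := by exact_mod_cast hK1
    have h1 : ∀ k : Fin (K N) ⊕ Unit, ∫ w, M.g (K N) w (M.γ₀, M.θ₀) k ^ 2 ∂M.P ≤ κ₂ := by
      intro k
      have h2 := (hE.eig_D _ hp).upper (Pi.single k 1)
      rw [hR.dotProduct_D_mulVec hM hp, eucl_sq] at h2
      simpa [sq] using h2
    have h2 : ∑ k, ∫ w, M.g (K N) w (M.γ₀, M.θ₀) k ^ 2 ∂M.P ≤ 2 * κ₂ * K N := by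
      refine (Finset.sum_le_sum fun k _ => h1 k).trans ?_
      simp only [Finset.sum_const, Finset.card_univ, Fintype.card_sum, Fintype.card_fin,
        Fintype.card_unit, nsmul_eq_mul]
      push_cast
      nlinarith [hE.one_le]
    calc √((N : ℝ) * K N) * _ ≤ √((N : ℝ) * K N) * (2 * κ₂ * K N) := by gcongr
      _ = 2 * κ₂ * (√((N : ℝ) * K N) * K N) := by ring
      _ = _ := by rw [sqrt_mul_self_mul hN' (by linarith)]; ring

lemma Regular.tendsto_eucl_gbar' :
    Tendsto (fun x : ℕ × Ω => eucl (M.gbar (K x.1) x.1 (fun i => W i x.2) (M.γ₀, M.θ₀)))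
      (inProb μ) (𝓝 0) := by
  refine tendsto_zero_of_le_mul (hR.tendsto_eucl_gbar hM hE hS hK hKN) ?_
  filter_upwards [tendsto_fst_inProb.eventually (eventually_size (p := p) hK)] with x ⟨hN, _, hK1⟩
  rw [Real.one_le_sqrt]
  exact_mod_cast Nat.mul_pos (Nat.pos_of_ne_zero hN) hK1

omit hR hM hE hS [IsProbabilityMeasure μ] in
lemma eventually_one_le_sqrt_div : ∀ᶠ x : ℕ × Ω in inProb μ, 1 ≤ √((x.1 : ℝ) / K x.1) := by
  filter_upwards [tendsto_fst_inProb.eventually (eventually_size (p := 0) hK),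
    tendsto_fst_inProb.eventually (eventually_le_size hK hKN)] with x ⟨_, _, hK1⟩ hle
  rw [Real.one_le_sqrt, one_le_div (by exact_mod_cast hK1)]
  exact_mod_cast hle

/-- `√(N / K) |∂_j Ĝ(γ₀, θ₀) - E[∂_j g_K]|² → 0`. -/
theorem Regular.tendsto_eucl_dgbar (j : Fin p ⊕ Unit) :
    Tendsto (fun x : ℕ × Ω => √((x.1 : ℝ) / K x.1)
      * eucl (M.dgbar (K x.1) x.1 (fun i => W i x.2) M.γ₀ (dir p j) - M.meanDeriv (K x.1) j) ^ 2)
      (inProb μ) (𝓝 0) := by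
  have hL : ∀ {k : ℕ}, p ≤ k → ∀ l : Fin k ⊕ Unit,
      MemLp (fun w => M.dres M.γ₀ w (dir p j).1 * M.ut k w l) 2 M.P ∧
      ∫ w, (M.dres M.γ₀ w (dir p j).1 * M.ut k w l) ^ 2 ∂M.P ≤ C ^ 2 * κ₂ := by
    intro k hk l
    have hut := hR.memLp_ut_apply hM hk l
    have hb : ∀ w ∈ S, |M.dres M.γ₀ w (dir p j).1| ≤ C := by
      intro w hw
      rcases j with j | _
      · exact hR.abs_dres_le hM hw j
      · simpa [dir] using zero_le_one.trans hR.one_le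
    have hm : AEStronglyMeasurable (fun w => M.dres M.γ₀ w (dir p j).1) M.P := by
      rcases j with j | _
      · exact hR.aesm_dres hM j
      · simpa [dir] using aestronglyMeasurable_const
    have h1 : MemLp (fun w => M.dres M.γ₀ w (dir p j).1 * M.ut k w l) 2 M.P := by
      refine MemLp.of_le_mul (c := C) hut (hm.mul hut.aestronglyMeasurable) ?_
      filter_upwards [hR.ae_mem] with w hw
      rw [norm_mul]
      gcongr
      exact hb w hw
    refine ⟨h1, ?_⟩
    have h2 : ∫ w, (M.dres M.γ₀ w (dir p j).1 * M.ut k w l) ^ 2 ∂M.P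
        ≤ ∫ w, C ^ 2 * M.ut k w l ^ 2 ∂M.P := by
      refine integral_mono_ae h1.integrable_sq (hut.integrable_sq.const_mul _) ?_
      filter_upwards [hR.ae_mem] with w hw
      have h3 := hb w hw
      have h4 : (M.dres M.γ₀ w (dir p j).1) ^ 2 ≤ C ^ 2 :=
        sq_le_sq' (by linarith [neg_abs_le (M.dres M.γ₀ w (dir p j).1)])
          ((le_abs_self _).trans h3)
      simp only [mul_pow]
      gcongr
    rw [integral_const_mul] at h2
    have h3 := hE.ut_le k hk (Pi.single l 1)
    rw [eucl_sq] at h3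
    simp only [single_dotProduct, one_mul, Pi.single_eq_same, mul_one] at h3
    refine h2.trans ?_
    gcongr
  have h := hS.tendsto_sum_sq_emp_sub (ι := fun N => Fin (K N) ⊕ Unit)
    (f := fun N k w => M.dres M.γ₀ w (dir p j).1 * M.ut (K N) w k)
    (a := fun N => √((N : ℝ) / K N)) (c := fun N => 2 * (C ^ 2 * κ₂) * √((K N : ℝ) ^ 3 / N))
    (fun _ => Real.sqrt_nonneg _) ?_ (tendsto_sqrt_size hKN _)
  · refine h.congr fun x => ?_
    rw [eucl_sq, dotProduct]
    congr 1
    refine Finset.sum_congr rfl fun k _ => ?_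
    simp only [Pi.sub_apply, dgbar, meanDeriv, ell]
    ring
  · filter_upwards [eventually_size (p := p) hK] with N ⟨hN, hp, hK1⟩
    refine ⟨fun k => (hL hp k).1, ?_⟩
    have hN' : (0 : ℝ) < N := by exact_mod_cast Nat.pos_of_ne_zero hN
    have hK1' : (1 : ℝ) ≤ K N := by exact_mod_cast hK1
    have hκ : 0 ≤ C ^ 2 * κ₂ := mul_nonneg (sq_nonneg _) (zero_le_one.trans hE.one_le)
    -- There are only K + 1 bounded terms; the count is relaxed to 2K² so that
    -- `sqrt_div_self_mul_sq` applies.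
    have h2 : ∑ k, ∫ w, (M.dres M.γ₀ w (dir p j).1 * M.ut (K N) w k) ^ 2 ∂M.P
        ≤ 2 * (C ^ 2 * κ₂) * K N ^ 2 := by
      refine (Finset.sum_le_sum fun k _ => (hL hp k).2).trans ?_
      simp only [Finset.sum_const, Finset.card_univ, Fintype.card_sum, Fintype.card_fin,
        Fintype.card_unit, nsmul_eq_mul]
      push_cast
      have : (K N : ℝ) + 1 ≤ 2 * K N ^ 2 := by nlinarith
      calc _ ≤ 2 * (K N : ℝ) ^ 2 * (C ^ 2 * κ₂) := by gcongr
        _ = _ := by ring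
    calc √((N : ℝ) / K N) * _ ≤ √((N : ℝ) / K N) * (2 * (C ^ 2 * κ₂) * K N ^ 2) := by gcongr
      _ = 2 * (C ^ 2 * κ₂) * (√((N : ℝ) / K N) * K N ^ 2) := by ring
      _ = _ := by rw [sqrt_div_self_mul_sq hN' (by linarith)]; ring

/-- `√(N / K) |((D̂ - D) b_j)₁|² → 0` for the coefficients `b_j` of the projected representers. -/
theorem Regular.tendsto_eucl_fstBlock (j : Fin p ⊕ Unit) :
    Tendsto (fun x : ℕ × Ω => √((x.1 : ℝ) / K x.1)
      * eucl (fstBlock ((M.Dhat (K x.1) x.1 (fun i => W i x.2) (M.γ₀, M.θ₀) - M.D (K x.1))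
        *ᵥ M.projCoef (K x.1) j)) ^ 2) (inProb μ) (𝓝 0) := by
  obtain ⟨B, hB, hbB⟩ := hR.exists_eucl_projCoef_le hM hE
  -- Only the first K rows are treated: there (1 - T/π) u_K is bounded by a multiple of K and b ·
  -- g_K is bounded in L² uniformly in K, so the summed second moments are of order K².
  have h := hS.tendsto_sum_sq_emp_sub (ι := fun N => Fin (K N))
    (f := fun N k w => M.resid M.γ₀ w * M.u (K N) (xVec w) k
      * (M.projCoef (K N) j ⬝ᵥ M.g (K N) w (M.γ₀, M.θ₀)))
    (a := fun N => √((N : ℝ) / K N))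
    (c := fun N => C ^ 2 * C ^ 2 * (κ₂ * B ^ 2) * √((K N : ℝ) ^ 3 / N))
    (fun _ => Real.sqrt_nonneg _) ?_ (tendsto_sqrt_size hKN _)
  · refine h.congr' ?_
    filter_upwards [tendsto_fst_inProb.eventually (eventually_size (p := p) hK)] with x ⟨_, hp, _⟩
    rw [eucl_sq, dotProduct]
    congr 1
    refine Finset.sum_congr rfl fun k _ => ?_
    set b := M.projCoef (K x.1) j
    have h1 : ((M.Dhat (K x.1) x.1 (fun i => W i x.2) (M.γ₀, M.θ₀) - M.D (K x.1)) *ᵥ b)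
        (Sum.inl k) = emp x.1 (fun i => W i x.2) (fun w => M.resid M.γ₀ w
          * M.u (K x.1) (xVec w) k * (b ⬝ᵥ M.g (K x.1) w (M.γ₀, M.θ₀)))
          - ∫ w, M.resid M.γ₀ w * M.u (K x.1) (xVec w) k
            * (b ⬝ᵥ M.g (K x.1) w (M.γ₀, M.θ₀)) ∂M.P := by
      have h2 : ((M.Dhat (K x.1) x.1 (fun i => W i x.2) (M.γ₀, M.θ₀) - M.D (K x.1)) *ᵥ b)
          (Sum.inl k) = (Pi.single (Sum.inl k) 1 : Fin (K x.1) ⊕ Unit → ℝ) ⬝ᵥ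
            ((M.Dhat (K x.1) x.1 (fun i => W i x.2) (M.γ₀, M.θ₀) - M.D (K x.1)) *ᵥ b) := by
        simp
      rw [h2, Matrix.sub_mulVec, dotProduct_sub, dotProduct_Dhat_mulVec,
        hR.dotProduct_D_mulVec hM hp]
      simp [g]
    rw [← h1, sq]
  · filter_upwards [eventually_size (p := p) hK, hK.eventually (hbB j)] with N ⟨hN, hp, hK1⟩ hb
    have hbg := hR.memLp_dotProduct_g hM hp (M.projCoef (K N) j)
    have hr : ∀ w ∈ S, |M.resid M.γ₀ w| ≤ C := fun w hw => hR.abs_resid_le w hw _ hM.γ₀_mem'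
    refine ⟨fun k => hR.memLp_mul_u_mul hM hp k (Regular.aesm_resid hM) hr hbg, ?_⟩
    have hN' : (0 : ℝ) < N := by exact_mod_cast Nat.pos_of_ne_zero hN
    have hK1' : (1 : ℝ) ≤ K N := by exact_mod_cast hK1
    have hκ : 0 ≤ κ₂ := zero_le_one.trans hE.one_le
    have h1 : ∫ w, (M.projCoef (K N) j ⬝ᵥ M.g (K N) w (M.γ₀, M.θ₀)) ^ 2 ∂M.P ≤ κ₂ * B ^ 2 := by
      have h2 := (hE.eig_D _ hp).upper (M.projCoef (K N) j)
      rw [hR.dotProduct_D_mulVec hM hp] at h2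
      simp only [← sq] at h2
      refine h2.trans ?_
      have := eucl_nonneg (M.projCoef (K N) j)
      gcongr
    calc _ ≤ √((N : ℝ) / K N) * (C ^ 2 * (C * K N) ^ 2 * (κ₂ * B ^ 2)) := by
          refine mul_le_mul_of_nonneg_left ?_ (Real.sqrt_nonneg _)
          refine (hR.sum_integral_sq_mul_u_mul_le hM hp (Regular.aesm_resid hM) hr hbg).trans ?_
          gcongr
      _ = C ^ 2 * C ^ 2 * (κ₂ * B ^ 2) * (√((N : ℝ) / K N) * K N ^ 2) := by ring
      _ = _ := by rw [sqrt_div_self_mul_sq hN' (by linarith)]; ring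

/-- The sample derivatives of the projected moments converge. -/
theorem Regular.tendsto_projCoef_dgbar (j k : Fin p ⊕ Unit) :
    Tendsto (fun x : ℕ × Ω => M.projCoef (K x.1) j ⬝ᵥ
      M.dgbar (K x.1) x.1 (fun i => W i x.2) M.γ₀ (dir p k)) (inProb μ) (𝓝 (M.phiCov j k)) := by
  obtain ⟨B, hB, hbB⟩ := hR.exists_eucl_projCoef_le hM hE
  have h1 := tendsto_zero_of_le_mul (hR.tendsto_eucl_dgbar hM hE hS hK hKN k)
    (eventually_one_le_sqrt_div hK hKN)
  have h2 : Tendsto (fun x : ℕ × Ω => M.projCoef (K x.1) j ⬝ᵥ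
      (M.dgbar (K x.1) x.1 (fun i => W i x.2) M.γ₀ (dir p k) - M.meanDeriv (K x.1) k))
      (inProb μ) (𝓝 0) := by
    have h3 := h1.const_mul B
    rw [mul_zero] at h3
    refine squeeze_zero_norm' ?_ h3
    filter_upwards [tendsto_fst_inProb.eventually (hK.eventually (hbB j))] with x hx
    refine (abs_dotProduct_le _ _).trans ?_
    exact mul_le_mul_of_nonneg_right hx (eucl_nonneg _)
  have h4 := h2.add ((hR.tendsto_projCoef_meanDeriv hM hE j k).comp (hK.comp tendsto_fst_inProb))
  rw [zero_add] at h4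
  refine h4.congr fun x => ?_
  simp [dotProduct_sub]

/-- The normalized projected moments are asymptotically the normalized means of the
representers. -/
theorem Regular.tendsto_projCoef_gbar (j : Fin p ⊕ Unit) :
    Tendsto (fun x : ℕ × Ω => √(x.1 : ℝ) * (M.projCoef (K x.1) j ⬝ᵥ
      M.gbar (K x.1) x.1 (fun i => W i x.2) (M.γ₀, M.θ₀)
        - emp x.1 (fun i => W i x.2) (M.phi j))) (inProb μ) (𝓝 0) := by
  have := hM.isProb
  have hφ := hR.memLp_phi hM j
  -- Chebyshev with weight N: after normalization by √N the second moment is at most the squared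
  -- projection error, which tends to zero.
  have h := hS.tendsto_sum_sq_emp_sub (ι := fun _ => Unit)
    (f := fun N _ w => M.projCoef (K N) j ⬝ᵥ M.g (K N) w (M.γ₀, M.θ₀) - M.phi j w)
    (a := fun N => N)
    (c := fun N => ∫ w, (M.projCoef (K N) j ⬝ᵥ M.g (K N) w (M.γ₀, M.θ₀) - M.phi j w) ^ 2 ∂M.P)
    (fun _ => Nat.cast_nonneg _) ?_ ((hR.tendsto_projCoef hM hE j).comp hK)
  · refine tendsto_zero_of_le_mul (a := fun _ => 1) ?_ (Eventually.of_forall fun _ => le_rfl)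
    refine h.congr' ?_
    filter_upwards [tendsto_fst_inProb.eventually (eventually_size (p := p) hK)] with x ⟨_, hp, _⟩
    have hbg := hR.memLp_dotProduct_g hM hp (M.projCoef (K x.1) j)
    rw [dotProduct_gbar, Finset.univ_unique, Finset.sum_singleton, emp_sub,
      integral_sub (hbg.integrable one_le_two) (hφ.integrable one_le_two),
      hR.integral_dotProduct_g hM hp, hR.integral_phi hM, mul_pow, Real.sq_sqrt (Nat.cast_nonneg _)]
    ring
  · filter_upwards [eventually_size (p := p) hK] with N ⟨_, hp, _⟩
    refine ⟨fun _ => (hR.memLp_dotProduct_g hM hp _).sub hφ, ?_⟩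
    rw [Finset.univ_unique, Finset.sum_singleton, mul_comm]

omit hE hK hKN in
-- From |x| ≤ 1 + x² and the variance bound: the normalized means of φ_j are bounded in mean, so
-- multiplying them by something tending to zero in probability gives a limit zero.
lemma Regular.integral_abs_sqrt_emp_phi_le (j : Fin p ⊕ Unit) :
    ∀ᶠ N : ℕ in atTop, Integrable (fun ω => √(N : ℝ) * emp N (fun i => W i ω) (M.phi j)) μ ∧
      ∫ ω, |√(N : ℝ) * emp N (fun i => W i ω) (M.phi j)| ∂μ ≤ 1 + ∫ w, M.phi j w ^ 2 ∂M.P := by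
  filter_upwards [eventually_ne_atTop 0] with N hN
  have hφ := hR.memLp_phi hM j
  have hL : MemLp (fun ω => √(N : ℝ) * emp N (fun i => W i ω) (M.phi j)) 2 μ :=
    (hS.memLp_emp hφ N).const_mul _
  refine ⟨hL.integrable one_le_two, ?_⟩
  have h1 := hS.integral_sq_emp_sub_le hφ hN
  rw [hR.integral_phi hM] at h1
  simp only [sub_zero] at h1
  have hN' : (0 : ℝ) < N := by exact_mod_cast Nat.pos_of_ne_zero hN
  have h2 : ∫ ω, |√(N : ℝ) * emp N (fun i => W i ω) (M.phi j)| ∂μ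
      ≤ ∫ ω, (1 + (√(N : ℝ) * emp N (fun i => W i ω) (M.phi j)) ^ 2) ∂μ := by
    refine integral_mono (hL.integrable one_le_two).abs
      ((integrable_const _).add hL.integrable_sq) fun ω => ?_
    simp only
    rw [← sq_abs]
    nlinarith [sq_nonneg (|√(N : ℝ) * emp N (fun i => W i ω) (M.phi j)| - 1)]
  rw [integral_add (integrable_const (μ := μ) (1 : ℝ)) hL.integrable_sq] at h2
  simp only [mul_pow, Real.sq_sqrt (Nat.cast_nonneg (α := ℝ) N)] at h2
  rw [integral_const_mul] at h2
  rw [le_div_iff₀ hN'] at h1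
  simp only [integral_const, probReal_univ, smul_eq_mul, mul_one] at h2
  linarith

end Model

end

end MNAR

namespace MNAR

noncomputable section

namespace Model

set_option linter.unusedSectionVars false

variable {r p : ℕ} {M : Model r p} {S : Set (Obs r)} {c C ρ : ℝ} {κ₁ κ₂ : ℝ}
  {Ω : Type*} [MeasurableSpace Ω] {μ : Measure Ω} [IsProbabilityMeasure μ] {W : ℕ → Ω → Obs r}
  {K : ℕ → ℕ}

/-! ### Consistency -/

lemma Assumptions.measurable_resid {γ : EuclideanSpace ℝ (Fin p)} (hM : M.Assumptions)
    (hγ : γ ∈ M.Γ) : Measurable (M.resid γ) :=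
  measurable_const.sub (measurable_tInd.div ((hM.prob_meas _ hγ).comp measurable_zVec))

variable (hR : M.Regular S c C ρ) (hM : M.Assumptions)

include hR hM

/-- A modulus of continuity, small in mean square, of `1 - T/π(Z; γ)` at a parameter. -/
lemma Regular.exists_modulus {γ₁ : EuclideanSpace ℝ (Fin p)} (hγ₁ : γ₁ ∈ M.Γ) {ε : ℝ}
    (hε : 0 < ε) :
    ∃ δ > 0, ∃ h : Obs r → ℝ, Integrable (fun w => h w ^ 2) M.P ∧ ∫ w, h w ^ 2 ∂M.P < ε ∧
      ∀ w ∈ S, ∀ γ ∈ M.Γ, dist γ γ₁ < δ → |M.resid γ w - M.resid γ₁ w| ≤ h w := by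
  have := hM.isProb
  have hC : 0 ≤ C := zero_le_one.trans hR.one_le
  have : Nonempty M.Γ := ⟨⟨γ₁, hγ₁⟩⟩
  -- The supremum over all γ near γ₁ need not be measurable; over a countable dense set it is.
  set e : ℕ → M.Γ := TopologicalSpace.denseSeq M.Γ with he
  set t : ℕ → ℕ → Obs r → ℝ := fun n i w =>
    if dist (e i : EuclideanSpace ℝ (Fin p)) γ₁ < 1 / ((n : ℝ) + 1) then
      |M.resid (e i) w - M.resid γ₁ w| else 0 with ht
  have ht0 : ∀ n i w, 0 ≤ t n i w := by
    intro n i w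
    simp only [ht]
    split
    · exact abs_nonneg _
    · exact le_rfl
  have ht2 : ∀ n i, ∀ w ∈ S, t n i w ≤ 2 * C := by
    intro n i w hw
    simp only [ht]
    split
    · have h1 := abs_le.1 (hR.abs_resid_le w hw _ (e i).2)
      have h2 := abs_le.1 (hR.abs_resid_le w hw _ hγ₁)
      rw [abs_le]
      constructor <;> linarith [h1.1, h1.2, h2.1, h2.2]
    · positivity
  have hbdd : ∀ n, ∀ w ∈ S, BddAbove (range fun i => t n i w) := fun n w hw =>
    ⟨2 * C, by rintro _ ⟨i, rfl⟩; exact ht2 n i w hw⟩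
  set h : ℕ → Obs r → ℝ := fun n w => ⨆ i, t n i w with hh
  have hmeas : ∀ n, Measurable (h n) := by
    intro n
    refine Measurable.iSup fun i => ?_
    simp only [ht]
    split
    · have h1 := hM.measurable_resid (e i).2
      have h2 := hM.measurable_resid hγ₁
      exact (h1.sub h2).abs
    · exact measurable_const
  have hh0 : ∀ n w, 0 ≤ h n w := fun n w => Real.iSup_nonneg fun i => ht0 n i w
  have hh2 : ∀ n, ∀ w ∈ S, h n w ≤ 2 * C := fun n w hw => ciSup_le fun i => ht2 n i w hw
  -- The local oscillations are bounded by 2C and tend to zero pointwise on S by continuity at γ₁.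
  have hlim : Tendsto (fun n => ∫ w, h n w ^ 2 ∂M.P) atTop (𝓝 (∫ _, (0 : ℝ) ∂M.P)) := by
    refine tendsto_integral_of_dominated_convergence (fun _ => (2 * C) ^ 2)
      (fun n => ((hmeas n).pow_const 2).aestronglyMeasurable) (integrable_const _) (fun n => ?_) ?_
    · filter_upwards [hR.ae_mem] with w hw
      rw [Real.norm_eq_abs, abs_of_nonneg (sq_nonneg _)]
      exact pow_le_pow_left₀ (hh0 n w) (hh2 n w hw) 2
    · filter_upwards [hR.ae_mem] with w hw
      have h1 : Tendsto (fun n => h n w) atTop (𝓝 0) := by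
        rw [Metric.tendsto_atTop]
        intro a ha
        obtain ⟨δ, hδ, hδa⟩ := Metric.continuousWithinAt_iff.1 (hR.resid_cont w hw γ₁ hγ₁) (a / 2)
          (half_pos ha)
        obtain ⟨n₀, hn₀⟩ := exists_nat_one_div_lt hδ
        refine ⟨n₀, fun n hn => ?_⟩
        rw [Real.dist_eq, sub_zero, abs_of_nonneg (hh0 n w)]
        refine lt_of_le_of_lt (ciSup_le fun i => ?_) (half_lt_self ha)
        simp only [ht]
        split
        · rename_i hi
          refine (hδa (e i).2 (hi.trans ((Nat.one_div_le_one_div hn).trans_lt hn₀))).le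
        · exact (half_pos ha).le
      simpa using h1.pow 2
  rw [integral_zero] at hlim
  obtain ⟨n, hn⟩ := (hlim.eventually (gt_mem_nhds hε)).exists
  refine ⟨1 / ((n : ℝ) + 1), by positivity, h n, ?_, hn, ?_⟩
  · refine Integrable.of_bound ((hmeas n).pow_const 2).aestronglyMeasurable ((2 * C) ^ 2) ?_
    filter_upwards [hR.ae_mem] with w hw
    rw [Real.norm_eq_abs, abs_of_nonneg (sq_nonneg _)]
    exact pow_le_pow_left₀ (hh0 n w) (hh2 n w hw) 2
  · intro w hw γ hγ hdist
    -- The neighbourhood is open in Γ, so the dense points inside it approximate all its points, and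
    -- continuity in γ extends the bound to them.
    set O : Set M.Γ := {γ' | dist (γ' : EuclideanSpace ℝ (Fin p)) γ₁ < 1 / ((n : ℝ) + 1)} with hO
    have hOo : IsOpen O := isOpen_lt (by fun_prop) continuous_const
    have hcl : (⟨γ, hγ⟩ : M.Γ) ∈ closure (O ∩ range e) :=
      (TopologicalSpace.denseRange_denseSeq M.Γ).open_subset_closure_inter hOo hdist
    have hcont : Continuous fun γ' : M.Γ => |M.resid γ' w - M.resid γ₁ w| :=
      ((continuousOn_iff_continuous_domRestrict.1 (hR.resid_cont w hw)).sub continuous_const).abs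
    have hclosed : IsClosed {γ' : M.Γ | |M.resid γ' w - M.resid γ₁ w| ≤ h n w} :=
      isClosed_le hcont continuous_const
    have hsub : O ∩ range e ⊆ {γ' : M.Γ | |M.resid γ' w - M.resid γ₁ w| ≤ h n w} := by
      rintro _ ⟨hγ', i, rfl⟩
      have h1 := le_ciSup (hbdd n w hw) i
      have hi : dist (e i : EuclideanSpace ℝ (Fin p)) γ₁ < 1 / ((n : ℝ) + 1) := hγ'
      simp only [ht, if_pos hi] at h1
      exact h1
    exact hclosed.closure_subset_iff.2 hsub hcl

variable (hE : M.UniformEig κ₁ κ₂)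
  (hS : IsIIDSample μ M.P W) (hK : Tendsto K atTop atTop)
  (hKN : Tendsto (fun N : ℕ => (K N : ℝ) ^ 3 / N) atTop (𝓝 0))

include hE hS hK hKN

/-- A wrong value of `γ` has a neighbourhood which is eventually avoided by parameters at which the
sample moments vanish asymptotically. -/
lemma Regular.eventually_le_dist {γ₁ : EuclideanSpace ℝ (Fin p)} (hγ₁ : γ₁ ∈ M.Γ)
    (hne : γ₁ ≠ M.γ₀) :
    ∃ δ > 0, ∀ η : ℕ × Ω → EuclideanSpace ℝ (Fin p) × ℝ, (∀ᶠ x in inProb μ, (η x).1 ∈ M.Γ) →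
      Tendsto (fun x => eucl (M.gbar (K x.1) x.1 (fun i => W i x.2) (η x))) (inProb μ) (𝓝 0) →
      ∀ᶠ x in inProb μ, δ ≤ dist (η x).1 γ₁ := by
  have := hM.isProb
  have hC : 0 ≤ C := zero_le_one.trans hR.one_le
  have hκ : 0 ≤ κ₂ := zero_le_one.trans hE.one_le
  set f := M.P[M.resid γ₁ | sigmaX r] with hf
  have hrm := hM.measurable_resid hγ₁
  have hrL : MemLp (M.resid γ₁) 2 M.P := by
    refine MemLp.of_bound hrm.aestronglyMeasurable C ?_
    filter_upwards [hR.ae_mem] with w hw using hR.abs_resid_le w hw _ hγ₁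
  have hfL : MemLp f 2 M.P := hrL.condExp one_le_two
  have hfX : M.XMeas f := stronglyMeasurable_condExp.aestronglyMeasurable
  have hrf : ∫ w, M.resid γ₁ w * f w ∂M.P = ∫ w, f w ^ 2 ∂M.P := by
    have h1 := condExp_mul_of_aestronglyMeasurable_right (m := sigmaX r) hfX
      (hrL.integrable_mul hfL) (hrL.integrable one_le_two)
    have h2 : ∫ w, M.resid γ₁ w * f w ∂M.P = ∫ w, (M.P[M.resid γ₁ * f | sigmaX r]) w ∂M.P :=
      (integral_condExp sigmaX_le).symm
    rw [h2]
    refine integral_congr_ae ?_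
    filter_upwards [h1] with w hw
    rw [hw, Pi.mul_apply, sq]
  set e := ∫ w, f w ^ 2 ∂M.P with he
  -- Identification enters here: f = E[1 - T/π(Z; γ₁) | X] vanishes almost surely only if γ₁ = γ₀.
  -- Testing the moments against an approximation of f then detects γ₁.
  have he0 : 0 < e := by
    refine lt_of_le_of_ne (integral_nonneg fun w => sq_nonneg _) fun h0 => hne ?_
    refine hM.identified _ hγ₁ ?_
    have h1 := (integral_eq_zero_iff_of_nonneg (fun w => sq_nonneg (f w)) hfL.integrable_sq).1 h0.symm
    filter_upwards [h1] with w hw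
    exact pow_eq_zero_iff two_ne_zero |>.1 hw
  obtain ⟨β, hβ⟩ := exists_tendsto_matching hM hfX hfL
  set Bβ := √((2 + 2 * e) / κ₁) with hBβ
  have hBev : ∀ᶠ k in atTop, eucl (β k) ≤ Bβ := by
    filter_upwards [eventually_ge_atTop p, hβ.eventually (gt_mem_nhds one_pos)] with k hk hlt
    refine Real.le_sqrt_of_sq_le ?_
    rw [le_div_iff₀ hE.pos]
    have h1 := hE.le_u k hk (β k)
    have hbL := hR.memLp_dotProduct_u hM hk (β k)
    have h2 : ∫ w, (β k ⬝ᵥ M.u k (xVec w)) ^ 2 ∂M.P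
        ≤ ∫ w, (2 * (f w - β k ⬝ᵥ M.u k (xVec w)) ^ 2 + 2 * f w ^ 2) ∂M.P := by
      refine integral_mono hbL.integrable_sq
        (((hfL.sub hbL).integrable_sq.const_mul 2).add (hfL.integrable_sq.const_mul 2))
        fun w => ?_
      simp only
      nlinarith [sq_nonneg (β k ⬝ᵥ M.u k (xVec w) - 2 * f w)]
    have i1 : Integrable (fun w => 2 * (f w - β k ⬝ᵥ M.u k (xVec w)) ^ 2) M.P :=
      (hfL.sub hbL).integrable_sq.const_mul 2
    rw [integral_add i1 (hfL.integrable_sq.const_mul 2), integral_const_mul,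
      integral_const_mul] at h2
    linarith
  -- Chosen so that an oscillation s, paired with a test function of empirical norm at most √(κ₂ +
  -- 1) Bβ, contributes at most e/4.
  set s := e / (4 * ((√(κ₂ + 1) + 1) * (Bβ + 1))) with hs
  have hBβ0 : 0 ≤ Bβ := Real.sqrt_nonneg _
  have hs0 : 0 < s := by positivity
  obtain ⟨δ, hδ, h, hhi, hhs, hhb⟩ := hR.exists_modulus hM hγ₁ (pow_pos hs0 2)
  refine ⟨δ, hδ, fun η hηΓ hη => ?_⟩
  have e1 := (hS.tendsto_emp (integrable_fun_mul hrL hfL)).eventually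
    (lt_mem_nhds (a := 3 / 4 * e) (by rw [hrf]; linarith))
  have e2 : ∀ᶠ x in inProb μ, emp x.1 (fun i => W i x.2)
      (fun w => |β (K x.1) ⬝ᵥ M.u (K x.1) (xVec w) - f w|) < e / (4 * C) := by
    have hlim := ((Real.continuous_sqrt.tendsto _).comp hβ).comp hK
    rw [Real.sqrt_zero] at hlim
    have h1 := hS.tendsto_emp_of_integral
      (f := fun N w => |β (K N) ⬝ᵥ M.u (K N) (xVec w) - f w|) ?_ hlim
    · have hC' : 0 < C := zero_lt_one.trans_le hR.one_le
      exact h1.eventually (gt_mem_nhds (by positivity))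
    · filter_upwards [hK.eventually_ge_atTop p] with N hN
      have hL := (hR.memLp_dotProduct_u hM hN (β (K N))).sub hfL
      refine ⟨(hL.integrable one_le_two).abs, fun w => abs_nonneg _, ?_⟩
      have h2 := sq_integral_mul_le hL.abs (memLp_const (μ := M.P) (1 : ℝ))
      simp only [mul_one, one_pow, integral_const, probReal_univ, smul_eq_mul] at h2
      refine (le_abs_self _).trans (Real.abs_le_sqrt (h2.trans (le_of_eq ?_)))
      refine integral_congr_ae (ae_of_all _ fun w => ?_)
      have : |(fun w => β (K N) ⬝ᵥ M.u (K N) (xVec w)) - f| w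
        = |β (K N) ⬝ᵥ M.u (K N) (xVec w) - f w| := rfl
      simp only [this, sq_abs]
      ring
  have e3 := (hS.tendsto_emp hhi).eventually (gt_mem_nhds hhs)
  have hpos : 0 < e / (4 * (Bβ + 1)) := by positivity
  have e4 := hη.eventually (gt_mem_nhds hpos)
  have e5 := hR.eventually_empBound hM hE hS hK hKN
  have e6 : ∀ᶠ x in inProb μ, ∀ i, W i x.2 ∈ S :=
    eventually_inProb_of_ae (p := fun x => ∀ i, W i x.2 ∈ S)
      (Eventually.of_forall fun _ => hS.ae_forall hR.ae_mem)
  have e7 := (tendsto_fst_inProb (μ := μ)).eventually (hK.eventually hBev)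
  filter_upwards [e1, e2, e3, e4, e5, e6, e7, hηΓ] with x h1 h2 h3 h4 h5 h6 h7 hγ
  by_contra hcon
  rw [not_le] at hcon
  set k := K x.1
  set d : ℕ → Obs r := fun i => W i x.2 with hd
  set v : Fin k ⊕ Unit → ℝ := Sum.elim (β k) 0 with hv
  have hve : eucl v = eucl (β k) := by
    rw [eucl, eucl, dotProduct_sum_type]
    simp [hv]
    rfl
  have hvu : ∀ w, v ⬝ᵥ M.ut k w = β k ⬝ᵥ M.u k (xVec w) := by
    intro w
    rw [dotProduct_ut]
    simp [hv]
    rfl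
  -- The first term exceeds 3e/4 by the law of large numbers. The error of approximating f and that
  -- of moving γ near γ₁ cost at most e/4 each, so the left side exceeds e/4, which is impossible
  -- once ḡ(η) is small.
  have hsplit : v ⬝ᵥ M.gbar k x.1 d (η x) = emp x.1 d (fun w => M.resid γ₁ w * f w)
      + emp x.1 d (fun w => M.resid γ₁ w * (β k ⬝ᵥ M.u k (xVec w) - f w))
      + emp x.1 d (fun w => (M.resid (η x).1 w - M.resid γ₁ w) * (v ⬝ᵥ M.ut k w)) := by
    rw [dotProduct_gbar, ← emp_add, ← emp_add]
    congr 1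
    ext w
    rw [dotProduct_g, hvu]
    simp only [hv, Sum.elim_inr, Pi.zero_apply]
    ring
  have t2 : |emp x.1 d (fun w => M.resid γ₁ w * (β k ⬝ᵥ M.u k (xVec w) - f w))| ≤ e / 4 := by
    refine (abs_emp_le _).trans ?_
    have : emp x.1 d (fun w => |M.resid γ₁ w * (β k ⬝ᵥ M.u k (xVec w) - f w)|)
        ≤ emp x.1 d (fun w => C * |β k ⬝ᵥ M.u k (xVec w) - f w|) := by
      refine emp_mono fun i => ?_
      rw [abs_mul]
      gcongr
      exact hR.abs_resid_le _ (h6 i) _ hγ₁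
    refine this.trans ?_
    rw [emp_const_mul]
    have hC' : 0 < C := zero_lt_one.trans_le hR.one_le
    calc C * _ ≤ C * (e / (4 * C)) := by gcongr
      _ = e / 4 := by field_simp
  have t3 : |emp x.1 d (fun w => (M.resid (η x).1 w - M.resid γ₁ w) * (v ⬝ᵥ M.ut k w))|
      ≤ e / 4 := by
    refine (emp_mul_le_sqrt _ fun w => v ⬝ᵥ M.ut k w).trans ?_
    have a1 : √(emp x.1 d fun w => (M.resid (η x).1 w - M.resid γ₁ w) ^ 2) ≤ s := by
      refine Real.sqrt_le_iff.2 ⟨hs0.le, le_trans (emp_mono fun i => ?_) h3.le⟩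
      rw [← sq_abs]
      exact pow_le_pow_left₀ (abs_nonneg _) (hhb _ (h6 i) _ hγ hcon) 2
    have a2 : √(emp x.1 d fun w => (v ⬝ᵥ M.ut k w) ^ 2) ≤ √(κ₂ + 1) * Bβ := by
      refine Real.sqrt_le_iff.2 ⟨by positivity, ?_⟩
      rw [mul_pow, Real.sq_sqrt (by positivity)]
      refine (h5 v).trans ?_
      rw [hve]
      have := eucl_nonneg (β k)
      gcongr
    calc _ ≤ s * (√(κ₂ + 1) * Bβ) := mul_le_mul a1 a2 (Real.sqrt_nonneg _) hs0.le
      _ ≤ s * ((√(κ₂ + 1) + 1) * (Bβ + 1)) := by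
          have := Real.sqrt_nonneg (κ₂ + 1)
          gcongr <;> linarith
      _ = e / 4 := by rw [hs]; field_simp
  have t4 : |v ⬝ᵥ M.gbar k x.1 d (η x)| < e / 4 := by
    refine (abs_dotProduct_le _ _).trans_lt ?_
    rw [hve]
    calc eucl (β k) * eucl (M.gbar k x.1 d (η x)) ≤ (Bβ + 1) * eucl (M.gbar k x.1 d (η x)) := by
          have := eucl_nonneg (M.gbar k x.1 d (η x))
          gcongr
          linarith
      _ < (Bβ + 1) * (e / (4 * (Bβ + 1))) := by gcongr
      _ = e / 4 := by field_simp
  rw [abs_le] at t2 t3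
  rw [abs_lt] at t4
  linarith [t2.1, t3.1, t4.2]

/-- Parameters at which the sample moments vanish asymptotically are consistent. -/
theorem Regular.tendsto_of_gbar {η : ℕ × Ω → EuclideanSpace ℝ (Fin p) × ℝ}
    (hηΓ : ∀ᶠ x in inProb μ, (η x).1 ∈ M.Γ)
    (hη : Tendsto (fun x => eucl (M.gbar (K x.1) x.1 (fun i => W i x.2) (η x))) (inProb μ)
      (𝓝 0)) :
    Tendsto η (inProb μ) (𝓝 (M.γ₀, M.θ₀)) := by
  have := hM.isProb
  have hC : 0 ≤ C := zero_le_one.trans hR.one_le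
  have hκ : 0 ≤ κ₂ := zero_le_one.trans hE.one_le
  have h1 : Tendsto (fun x => (η x).1) (inProb μ) (𝓝 M.γ₀) := by
    rw [Metric.tendsto_nhds]
    intro ε hε
    have hcomp : IsCompact (M.Γ \ Metric.ball M.γ₀ ε) := hM.Γ_compact.diff Metric.isOpen_ball
    have key : ∀ᶠ x in inProb μ, (η x).1 ∉ M.Γ \ Metric.ball M.γ₀ ε := by
      -- Finitely many of the avoided neighbourhoods cover the compact set of parameters at distance
      -- at least ε from γ₀.
      refine hcomp.induction_on (p := fun s => ∀ᶠ x in inProb μ, (η x).1 ∉ s)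
        (Eventually.of_forall fun x => notMem_empty _)
        (fun s t hst ht => ht.mono fun x hx h => hx (hst h))
        (fun s t hs ht => by
          filter_upwards [hs, ht] with x h1 h2 h3
          exact h3.elim h1 h2) fun γ₁ hγ₁ => ?_
      have hne : γ₁ ≠ M.γ₀ := by
        rintro rfl
        exact hγ₁.2 (Metric.mem_ball_self hε)
      obtain ⟨δ, hδ, h⟩ := hR.eventually_le_dist hM hE hS hK hKN hγ₁.1 hne
      refine ⟨Metric.ball γ₁ δ, mem_nhdsWithin_of_mem_nhds (Metric.ball_mem_nhds _ hδ), ?_⟩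
      filter_upwards [h η hηΓ hη] with x hx hx'
      exact absurd (Metric.mem_ball.1 hx') (not_lt.2 hx)
    filter_upwards [key, hηΓ] with x hx hx'
    by_contra hcon
    exact hx ⟨hx', hcon⟩
  refine h1.prodMk_nhds ?_
  have hball := h1.eventually_mem (Metric.ball_mem_nhds M.γ₀ hR.ρ_pos)
  have hnorm : Tendsto (fun x => ‖(η x).1 - M.γ₀‖) (inProb μ) (𝓝 0) := by
    have := (h1.sub_const M.γ₀).norm
    simpa using this
  have hU := hS.tendsto_emp (hM.U_sq.integrable one_le_two)
  have hUr := hS.tendsto_emp ((hR.memLp_resid_mul hM hM.U_sq).integrable one_le_two)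
  rw [hR.integral_resid_mul hM hM.zMeas_U (hM.U_sq.integrable one_le_two)] at hUr
  have hA : Tendsto (fun x : ℕ × Ω => M.gbar (K x.1) x.1 (fun i => W i x.2) (η x) (Sum.inr ()))
      (inProb μ) (𝓝 0) := squeeze_zero_norm (fun x => abs_le_eucl _ _) hη
  have hB : Tendsto (fun x : ℕ × Ω => emp x.1 (fun i => W i x.2)
      fun w => (M.resid (η x).1 w - M.resid M.γ₀ w) * M.U (zVec w)) (inProb μ) (𝓝 0) := by
    have h2 := hnorm.const_mul (C * √(κ₂ + 1))
    rw [mul_zero] at h2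
    refine squeeze_zero_norm' ?_ h2
    filter_upwards [hball, hR.eventually_empBound hM hE hS hK hKN,
      eventually_inProb_of_ae (p := fun x => ∀ i, W i x.2 ∈ S)
      (Eventually.of_forall fun _ => hS.ae_forall hR.ae_mem)] with x hx hb hd
    have h3 := hb.abs_emp_mul_le (by positivity) (q := C * ‖(η x).1 - M.γ₀‖) (by positivity)
      (f := fun w => M.resid (η x).1 w - M.resid M.γ₀ w)
      (fun i => hR.abs_resid_sub_le (hd i) hx) (Pi.single (Sum.inr ()) 1)
    have h4 : eucl (Pi.single (Sum.inr ()) 1 : Fin (K x.1) ⊕ Unit → ℝ) = 1 := by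
      rw [eucl]; simp
    rw [h4] at h3
    simp only [single_dotProduct, one_mul, ut, Sum.elim_inr] at h3
    rw [Real.norm_eq_abs]
    linarith
  -- The last moment solves explicitly for θ: it is that moment plus the mean of U minus the mean of
  -- (1 - T/π(Z; γ)) U, and the latter splits into its value at γ₀ and a small increment.
  have hsum := ((hA.add hU).sub hB).sub hUr
  simp only [zero_add, sub_zero] at hsum
  refine hsum.congr' ?_
  filter_upwards [tendsto_fst_inProb.eventually (eventually_ne_atTop 0)] with x hN
  have h2 : M.gbar (K x.1) x.1 (fun i => W i x.2) (η x) (Sum.inr ())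
      = emp x.1 (fun i => W i x.2) fun w => (η x).2 - (M.U (zVec w)
        - M.resid (η x).1 w * M.U (zVec w)) := by
    rw [gbar]
    congr 1
    ext w
    simp only [g, Sum.elim_inr, resid]
    ring
  rw [h2, emp_sub, emp_sub, emp_const hN]
  have h3 : (emp x.1 (fun i => W i x.2) fun w =>
      (M.resid (η x).1 w - M.resid M.γ₀ w) * M.U (zVec w))
      = emp x.1 (fun i => W i x.2) (fun w => M.resid (η x).1 w * M.U (zVec w))
        - emp x.1 (fun i => W i x.2) (fun w => M.resid M.γ₀ w * M.U (zVec w)) := by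
    rw [← emp_sub]
    congr 1
    ext w
    ring
  rw [h3]
  ring

end Model

end

end MNAR

namespace MNAR

noncomputable section

/-- The components `(γᵀ, θ)` of a parameter. -/
def coord {p : ℕ} (h : EuclideanSpace ℝ (Fin p) × ℝ) : Fin p ⊕ Unit → ℝ :=
  Sum.elim (fun j => h.1 j) (fun _ => h.2)

lemma norm_le_eucl_coord {p : ℕ} (h : EuclideanSpace ℝ (Fin p) × ℝ) : ‖h‖ ≤ eucl (coord h) := by
  have h0 : eucl (coord h) ^ 2 = ‖h.1‖ ^ 2 + h.2 ^ 2 := by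
    rw [eucl_sq, dotProduct, Fintype.sum_sum_type, EuclideanSpace.norm_sq_eq]
    simp [coord, sq]
  refine (norm_prod_le_iff).2 ⟨?_, ?_⟩ <;> refine le_of_sq_le_sq ?_ (eucl_nonneg _) <;> rw [h0]
  · linarith [sq_nonneg h.2]
  · rw [Real.norm_eq_abs, sq_abs]
    linarith [sq_nonneg ‖h.1‖]

/-! ### Frobenius norms and perturbed linear systems -/

section Frob

variable {κ : Type*} [Fintype κ]

/-- The Frobenius norm of a matrix. -/
def frob (B : Matrix κ κ ℝ) : ℝ := √(∑ i, ∑ j, B i j ^ 2)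

lemma frob_nonneg (B : Matrix κ κ ℝ) : 0 ≤ frob B := Real.sqrt_nonneg _

lemma eucl_mulVec_le (B : Matrix κ κ ℝ) (v : κ → ℝ) : eucl (B *ᵥ v) ≤ frob B * eucl v := by
  have h := Real.le_sqrt_of_sq_le (eucl_mulVec_sq_le B v)
  rwa [Real.sqrt_mul' _ (sq_nonneg _), Real.sqrt_sq (eucl_nonneg _)] at h

lemma eucl_le_sum_abs (v : κ → ℝ) : eucl v ≤ ∑ k, |v k| := by
  refine Real.sqrt_le_iff.2 ⟨Finset.sum_nonneg fun _ _ => abs_nonneg _, ?_⟩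
  rw [sq, Finset.sum_mul]
  refine Finset.sum_le_sum fun k _ => ?_
  rw [← abs_mul_abs_self (v k)]
  exact mul_le_mul_of_nonneg_left
    (Finset.single_le_sum (f := fun k => |v k|) (fun _ _ => abs_nonneg _) (Finset.mem_univ k))
    (abs_nonneg _)

lemma tendsto_frob_sub {α : Type*} {l : Filter α} {A : α → Matrix κ κ ℝ} {B : Matrix κ κ ℝ}
    (h : ∀ i j, Tendsto (fun x => A x i j) l (𝓝 (B i j))) :
    Tendsto (fun x => frob (A x - B)) l (𝓝 0) := by
  have h1 : Tendsto (fun x => ∑ i, ∑ j, (A x i j - B i j) ^ 2) l (𝓝 0) := by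
    have : (0 : ℝ) = ∑ i : κ, ∑ j : κ, (B i j - B i j) ^ 2 := by simp
    rw [this]
    exact tendsto_finsetSum _ fun i _ => tendsto_finsetSum _ fun j _ =>
      ((h i j).sub_const _).pow 2
  have h2 := (Real.continuous_sqrt.tendsto _).comp h1
  rwa [Real.sqrt_zero] at h2

/-- Solving a linear system whose matrix is close to an invertible one. -/
lemma eucl_add_mulVec_le [DecidableEq κ] {H₀ : Matrix κ κ ℝ} (hH₀ : IsUnit H₀.det)
    (H : Matrix κ κ ℝ) (v w : κ → ℝ) :
    eucl (v + H₀⁻¹ *ᵥ w)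
      ≤ frob H₀⁻¹ * eucl (H *ᵥ v + w) + frob H₀⁻¹ * (frob (H - H₀) * eucl v) := by
  have h : v + H₀⁻¹ *ᵥ w = H₀⁻¹ *ᵥ (H *ᵥ v + w) + -(H₀⁻¹ *ᵥ ((H - H₀) *ᵥ v)) := by
    rw [Matrix.sub_mulVec, Matrix.mulVec_sub, Matrix.mulVec_add, Matrix.mulVec_mulVec _ H₀⁻¹ H₀,
      Matrix.nonsing_inv_mul _ hH₀, Matrix.one_mulVec]
    abel
  rw [h]
  refine (eucl_add_le _ _).trans ?_
  rw [eucl_neg]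
  refine add_le_add (eucl_mulVec_le _ _) ((eucl_mulVec_le _ _).trans ?_)
  exact mul_le_mul_of_nonneg_left (eucl_mulVec_le _ _) (frob_nonneg _)

end Frob

namespace Model

set_option linter.unusedSectionVars false

variable {r p : ℕ} {M : Model r p} {S : Set (Obs r)} {c C ρ : ℝ} {κ₁ κ₂ : ℝ}
  {Ω : Type*} [MeasurableSpace Ω] {μ : Measure Ω} [IsProbabilityMeasure μ] {W : ℕ → Ω → Obs r}
  {K : ℕ → ℕ}

/-! ### Asymptotic expansion of the estimators -/

lemma dotProduct_dgbar_eq_sum {k N : ℕ} {d : ℕ → Obs r} (v : Fin k ⊕ Unit → ℝ)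
    (γ : EuclideanSpace ℝ (Fin p)) (h : EuclideanSpace ℝ (Fin p) × ℝ) :
    v ⬝ᵥ M.dgbar k N d γ h = ∑ j, (v ⬝ᵥ M.dgbar k N d γ (dir p j)) * coord h j := by
  have h1 : ∀ w, M.dres γ w h.1 = ∑ j, h.1 j * M.dres γ w (EuclideanSpace.single j 1) := by
    intro w
    conv_lhs => rw [← (EuclideanSpace.basisFun (Fin p) ℝ).sum_repr h.1]
    simp
  have h2 : emp N d (fun w => M.dres γ w h.1 * (v ⬝ᵥ M.ut k w))
      = ∑ j, h.1 j * emp N d fun w => M.dres γ w (EuclideanSpace.single j 1) * (v ⬝ᵥ M.ut k w) := by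
    simp only [← emp_const_mul, ← emp_sum]
    congr 1
    ext w
    rw [h1, Finset.sum_mul]
    exact Finset.sum_congr rfl fun j _ => by ring
  have h3 : emp N d (fun _ => (0 : ℝ)) = 0 := by simp [emp]
  simp only [dotProduct_dgbar, Fintype.sum_sum_type, dir, coord, Sum.elim_inl, Sum.elim_inr, h2,
    mul_zero, add_zero, map_zero, zero_mul, Finset.univ_unique, Finset.sum_singleton, mul_one, h3,
    zero_add]
  congr 1
  exact Finset.sum_congr rfl fun j _ => by ring

variable (M) in
/-- The sample derivatives of the projected moments. -/
def projJac (k N : ℕ) (d : ℕ → Obs r) : Matrix (Fin p ⊕ Unit) (Fin p ⊕ Unit) ℝ :=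
  Matrix.of fun i j => M.projCoef k i ⬝ᵥ M.dgbar k N d M.γ₀ (dir p j)

lemma projJac_mulVec {k N : ℕ} {d : ℕ → Obs r} (h : EuclideanSpace ℝ (Fin p) × ℝ)
    (j : Fin p ⊕ Unit) :
    (M.projJac k N d *ᵥ coord h) j = M.projCoef k j ⬝ᵥ M.dgbar k N d M.γ₀ h := by
  rw [dotProduct_dgbar_eq_sum]
  rfl

variable (hR : M.Regular S c C ρ) (hM : M.Assumptions) (hE : M.UniformEig κ₁ κ₂)
  (hS : IsIIDSample μ M.P W) (hK : Tendsto K atTop atTop)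
  (hKN : Tendsto (fun N : ℕ => (K N : ℝ) ^ 3 / N) atTop (𝓝 0))

include hK in
-- √N |ξ g| is the geometric mean of the two given quantities, hence at most their arithmetic mean.
-- The unequal weights √(N/K) and √(NK) reflect that ξ and g need not have the same rate.
lemma tendsto_sqrt_mul_mul {ξ g : ℕ × Ω → ℝ}
    (hξ : Tendsto (fun x => √((x.1 : ℝ) / K x.1) * ξ x ^ 2) (inProb μ) (𝓝 0))
    (hg : Tendsto (fun x => √((x.1 : ℝ) * K x.1) * g x ^ 2) (inProb μ) (𝓝 0)) :
    Tendsto (fun x => √(x.1 : ℝ) * (ξ x * g x)) (inProb μ) (𝓝 0) := by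
  have h := (hξ.add hg).div_const 2
  rw [add_zero, zero_div] at h
  refine squeeze_zero_norm' ?_ h
  filter_upwards [tendsto_fst_inProb.eventually (eventually_size (p := 0) hK)] with x ⟨hN, _, hK1⟩
  have hN' : (0 : ℝ) < x.1 := by exact_mod_cast Nat.pos_of_ne_zero hN
  have hK' : (0 : ℝ) < K x.1 := by exact_mod_cast hK1
  have h1 : √((x.1 : ℝ) / K x.1) * √((x.1 : ℝ) * K x.1) = x.1 := by
    rw [← Real.sqrt_mul (by positivity)]
    have : (x.1 : ℝ) / K x.1 * (x.1 * K x.1) = (x.1 : ℝ) ^ 2 := by field_simp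
    rw [this, Real.sqrt_sq hN'.le]
  refine abs_le_of_sq_le_sq ?_ (by positivity)
  have h2 : (√(x.1 : ℝ) * (ξ x * g x)) ^ 2
      = (√((x.1 : ℝ) / K x.1) * ξ x ^ 2) * (√((x.1 : ℝ) * K x.1) * g x ^ 2) := by
    rw [mul_pow, Real.sq_sqrt hN'.le]
    calc (x.1 : ℝ) * (ξ x * g x) ^ 2
        = (√((x.1 : ℝ) / K x.1) * √((x.1 : ℝ) * K x.1)) * (ξ x * g x) ^ 2 := by rw [h1]
      _ = _ := by ring
  rw [h2]
  nlinarith [sq_nonneg (√((x.1 : ℝ) / K x.1) * ξ x ^ 2 - √((x.1 : ℝ) * K x.1) * g x ^ 2)]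

include hR hS in
lemma Regular.eventually_mem : ∀ᶠ x in inProb μ, ∀ i, W i x.2 ∈ S :=
  eventually_inProb_of_ae (p := fun x => ∀ i, W i x.2 ∈ S)
    (Eventually.of_forall fun _ => hS.ae_forall hR.ae_mem)

include hR hM hE hS hK hKN

lemma Regular.tendsto_projJac :
    Tendsto (fun x : ℕ × Ω => frob (M.projJac (K x.1) x.1 (fun i => W i x.2) - M.phiCov))
      (inProb μ) (𝓝 0) :=
  tendsto_frob_sub fun i j => hR.tendsto_projCoef_dgbar hM hE hS hK hKN i j

variable {A : (x : ℕ × Ω) → Matrix (Fin (K x.1) ⊕ Unit) (Fin (K x.1) ⊕ Unit) ℝ}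
  {η : ℕ × Ω → EuclideanSpace ℝ (Fin p) × ℝ} {c₁ C₁ : ℝ} (hc₁ : 0 < c₁) (hC₁ : 0 < C₁)
  (hA : ∀ᶠ x in inProb μ, EigIn (A x) c₁ C₁)
  (hη : ∀ᶠ x in inProb μ, M.IsGMM (K x.1) x.1 (fun i => W i x.2) (A x) (η x))

include hc₁ hC₁ hA hη

lemma Regular.eventually_eucl_gbar_le :
    ∀ᶠ x in inProb μ, eucl (M.gbar (K x.1) x.1 (fun i => W i x.2) (η x))
      ≤ √(C₁ / c₁) * eucl (M.gbar (K x.1) x.1 (fun i => W i x.2) (M.γ₀, M.θ₀)) := by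
  filter_upwards [hA, hη, tendsto_fst_inProb.eventually (eventually_ne_atTop 0)] with x h1 h2 hN
  exact IsGMM.eucl_gbar_le hR hM hN h1 hc₁ hC₁ h2

/-- Consistency of estimators with a well-conditioned criterion. -/
theorem Regular.tendsto_gmm : Tendsto η (inProb μ) (𝓝 (M.γ₀, M.θ₀)) := by
  refine hR.tendsto_of_gbar hM hE hS hK hKN (hη.mono fun x h => h.1.1) ?_
  have h := (hR.tendsto_eucl_gbar' hM hE hS hK hKN).const_mul √(C₁ / c₁)
  rw [mul_zero] at h
  refine squeeze_zero_norm' ?_ h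
  filter_upwards [hR.eventually_eucl_gbar_le hM hE hS hK hKN hc₁ hC₁ hA hη] with x hx
  rwa [Real.norm_eq_abs, abs_of_nonneg (eucl_nonneg _)]

/-- The rate of convergence of the estimators. -/
theorem Regular.exists_rate :
    ∃ q, 0 < q ∧ ∀ᶠ x in inProb μ, eucl (coord (η x - (M.γ₀, M.θ₀)))
      ≤ q * eucl (M.gbar (K x.1) x.1 (fun i => W i x.2) (M.γ₀, M.θ₀)) := by
  have hC : 0 ≤ C := zero_le_one.trans hR.one_le
  have hκ : 0 ≤ κ₂ := zero_le_one.trans hE.one_le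
  have hcons := hR.tendsto_gmm hM hE hS hK hKN hc₁ hC₁ hA hη
  have hnorm : Tendsto (fun x => ‖η x - (M.γ₀, M.θ₀)‖) (inProb μ) (𝓝 0) := by
    simpa using (hcons.sub_const (M.γ₀, M.θ₀)).norm
  obtain ⟨Bb, hBb, hbB⟩ := hR.exists_eucl_projCoef_le hM hE
  have hbB' : ∀ᶠ k in atTop, ∀ j, eucl (M.projCoef k j) ≤ Bb := eventually_all.2 hbB
  have hunit := hR.isUnit_phiCov hM
  set m := frob M.phiCov⁻¹ with hm
  have hm0 : 0 ≤ m := frob_nonneg _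
  set n : ℝ := ((Fintype.card (Fin p ⊕ Unit) : ℕ) : ℝ) with hn
  have hn0 : 0 ≤ n := Nat.cast_nonneg _
  set e : ℕ × Ω → ℝ := fun x => frob (M.projJac (K x.1) x.1 (fun i => W i x.2) - M.phiCov)
  have he : ∀ᶠ x in inProb μ, m * e x < 1 / 4 := by
    have h := (hR.tendsto_projJac hM hE hS hK hKN).const_mul m
    rw [mul_zero] at h
    exact h.eventually (gt_mem_nhds (by norm_num))
  -- By consistency the quadratic remainder is a small multiple of |h|. It and the error of the
  -- sample Jacobian take a quarter of |h| each, and both are absorbed on the left.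
  have hsmall : ∀ᶠ x in inProb μ,
      m * (n * (Bb * (C * √(κ₂ + 1)))) * ‖η x - (M.γ₀, M.θ₀)‖ < 1 / 4 := by
    have h := hnorm.const_mul (m * (n * (Bb * (C * √(κ₂ + 1)))))
    rw [mul_zero] at h
    exact h.eventually (gt_mem_nhds (by norm_num))
  have hball : ∀ᶠ x in inProb μ, (η x).1 ∈ Metric.ball M.γ₀ ρ :=
    ((continuous_fst.tendsto _).comp hcons).eventually_mem (Metric.ball_mem_nhds M.γ₀ hR.ρ_pos)
  refine ⟨2 * (m * (n * (Bb * (√(C₁ / c₁) + 1)))) + 1, by positivity, ?_⟩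
  filter_upwards [he, hsmall, hball, hR.eventually_mem hS,
    hR.eventually_empBound hM hE hS hK hKN,
    hR.eventually_eucl_gbar_le hM hE hS hK hKN hc₁ hC₁ hA hη,
    tendsto_fst_inProb.eventually (eventually_ne_atTop 0),
    tendsto_fst_inProb.eventually (hK.eventually hbB')] with x h1 h2 h3 h4 h5 h6 hN hb
  set d : ℕ → Obs r := fun i => W i x.2
  set h := η x - (M.γ₀, M.θ₀) with hh
  set G := eucl (M.gbar (K x.1) x.1 d (M.γ₀, M.θ₀)) with hG
  have hG0 : 0 ≤ G := eucl_nonneg _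
  have hT := hR.eucl_gbar_taylor h4 h5 (by positivity) hN h3
  have hδ : ‖(η x).1 - M.γ₀‖ ≤ ‖h‖ := norm_fst_le h
  have hle := norm_le_eucl_coord h
  have hcomp : ∀ j, |(M.projJac (K x.1) x.1 d *ᵥ coord h) j|
      ≤ Bb * ((√(C₁ / c₁) + 1) * G + C * √(κ₂ + 1) * ‖h‖ * eucl (coord h)) := by
    intro j
    rw [projJac_mulVec]
    refine (abs_dotProduct_le _ _).trans (mul_le_mul (hb j) ?_ (eucl_nonneg _) hBb.le)
    set R := M.gbar (K x.1) x.1 d (η x) - M.gbar (K x.1) x.1 d (M.γ₀, M.θ₀)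
      - M.dgbar (K x.1) x.1 d M.γ₀ h with hRdef
    -- Testing with b_j reduces the K + 1 equations to p + 1, whose matrix converges to the
    -- invertible E[φφᵀ]; the right side involves only the sample moments at η and at the truth, and
    -- the remainder.
    have hd : M.dgbar (K x.1) x.1 d M.γ₀ h = M.gbar (K x.1) x.1 d (η x)
        + (-M.gbar (K x.1) x.1 d (M.γ₀, M.θ₀) + -R) := by rw [hRdef]; abel
    rw [hd]
    have t1 := eucl_add_le (M.gbar (K x.1) x.1 d (η x)) (-M.gbar (K x.1) x.1 d (M.γ₀, M.θ₀) + -R)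
    have t2 := eucl_add_le (-M.gbar (K x.1) x.1 d (M.γ₀, M.θ₀)) (-R)
    rw [eucl_neg, eucl_neg] at t2
    have t3 : C * √(κ₂ + 1) * ‖(η x).1 - M.γ₀‖ ^ 2 ≤ C * √(κ₂ + 1) * ‖h‖ * eucl (coord h) := by
      rw [sq, ← mul_assoc]
      gcongr
      exact hδ.trans hle
    linarith
  have hsum : eucl (M.projJac (K x.1) x.1 d *ᵥ coord h)
      ≤ n * (Bb * ((√(C₁ / c₁) + 1) * G + C * √(κ₂ + 1) * ‖h‖ * eucl (coord h))) := by
    refine (eucl_le_sum_abs _).trans ((Finset.sum_le_sum fun j _ => hcomp j).trans (le_of_eq ?_))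
    rw [Finset.sum_const, Finset.card_univ, nsmul_eq_mul]
  have hmain := eucl_add_mulVec_le hunit (M.projJac (K x.1) x.1 d) (coord h) 0
  rw [Matrix.mulVec_zero, add_zero, add_zero] at hmain
  have k1 := mul_le_mul_of_nonneg_left hsum hm0
  have hE0 := eucl_nonneg (coord h)
  have k2 := mul_le_mul_of_nonneg_right h1.le hE0
  have k3 := mul_le_mul_of_nonneg_right h2.le hE0
  have k4 : frob M.phiCov⁻¹ * (frob (M.projJac (K x.1) x.1 d - M.phiCov) * eucl (coord h))
    = m * e x * eucl (coord h) := by ring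
  rw [k4] at hmain
  have k5 : m * (n * (Bb * ((√(C₁ / c₁) + 1) * G + C * √(κ₂ + 1) * ‖h‖ * eucl (coord h))))
      = m * (n * (Bb * (√(C₁ / c₁) + 1))) * G
        + m * (n * (Bb * (C * √(κ₂ + 1)))) * ‖h‖ * eucl (coord h) := by ring
  rw [k5] at k1
  linarith

/-- The asymptotic linear expansion of the estimators. -/
theorem Regular.tendsto_linear_expansion
    (hξ : ∀ j, Tendsto (fun x : ℕ × Ω => √((x.1 : ℝ) / K x.1)
      * eucl (fstBlock ((A x - M.D (K x.1)) *ᵥ M.projCoef (K x.1) j)) ^ 2) (inProb μ) (𝓝 0))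
    (a : Fin p ⊕ Unit) :
    Tendsto (fun x : ℕ × Ω => √(x.1 : ℝ) * (coord (η x - (M.γ₀, M.θ₀)) a
      + emp x.1 (fun i => W i x.2) fun w => (M.effJac⁻¹ *ᵥ M.Seff w (M.γ₀, M.θ₀)) a))
      (inProb μ) (𝓝 0) := by
  have hC : 0 ≤ C := zero_le_one.trans hR.one_le
  have hκ : 0 ≤ κ₂ := zero_le_one.trans hE.one_le
  have hcons := hR.tendsto_gmm hM hE hS hK hKN hc₁ hC₁ hA hη
  obtain ⟨q, hq, hrate⟩ := hR.exists_rate hM hE hS hK hKN hc₁ hC₁ hA hη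
  obtain ⟨Bb, hBb, hbB⟩ := hR.exists_eucl_projCoef_le hM hE
  have hunit := hR.isUnit_phiCov hM
  set G : ℕ × Ω → ℝ := fun x => eucl (M.gbar (K x.1) x.1 (fun i => W i x.2) (M.γ₀, M.θ₀)) with hG
  have hGlim := hR.tendsto_eucl_gbar hM hE hS hK hKN
  have hsize := (tendsto_fst_inProb (μ := μ)).eventually (eventually_size (p := p) hK)
  have hG2 : Tendsto (fun x : ℕ × Ω => √(x.1 : ℝ) * G x ^ 2) (inProb μ) (𝓝 0) := by
    refine squeeze_zero_norm' ?_ hGlim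
    filter_upwards [hsize] with x ⟨hN, _, hK1⟩
    rw [Real.norm_eq_abs, abs_of_nonneg (by positivity)]
    have hK1' : (1 : ℝ) ≤ K x.1 := by exact_mod_cast hK1
    have : (x.1 : ℝ) ≤ x.1 * K x.1 := le_mul_of_one_le_right (Nat.cast_nonneg _) hK1'
    gcongr
  have hball : ∀ᶠ x in inProb μ, (η x).1 ∈ Metric.ball M.γ₀ ρ :=
    ((continuous_fst.tendsto _).comp hcons).eventually_mem (Metric.ball_mem_nhds M.γ₀ hR.ρ_pos)
  have hint : ∀ᶠ x in inProb μ, (η x).2 ∈ interior M.Θ :=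
    ((continuous_snd.tendsto _).comp hcons).eventually_mem
      (isOpen_interior.mem_nhds hM.θ₀_mem)
  have hfoc : ∀ j, Tendsto (fun x : ℕ × Ω => √(x.1 : ℝ) * (M.projCoef (K x.1) j ⬝ᵥ
      M.gbar (K x.1) x.1 (fun i => W i x.2) (M.γ₀, M.θ₀)
      + (M.projJac (K x.1) x.1 (fun i => W i x.2) *ᵥ coord (η x - (M.γ₀, M.θ₀))) j))
      (inProb μ) (𝓝 0) := by
    intro j
    -- Every term of the linearized condition is now a product: G times a derivative or weighting
    -- error, or G² from the rate of η.
    have l1 := tendsto_sqrt_mul_mul hK (hR.tendsto_eucl_dgbar hM hE hS hK hKN j) hGlim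
    have l2 := tendsto_sqrt_mul_mul hK (hξ j) hGlim
    set s := √(C₁ / c₁) / c₁ with hs
    have hs0 : 0 ≤ s := by positivity
    have l3 := (((hG2.const_mul (Bb * (C * √(κ₂ + 1) * q ^ 2)
      + C * √(κ₂ + 1) * q * s)).add (l1.const_mul s)).add (l2.const_mul s))
    simp only [mul_zero, add_zero] at l3
    refine squeeze_zero_norm' ?_ l3
    filter_upwards [hA, hη, hrate, hball, hint, hR.eventually_mem hS, hsize,
      hR.eventually_empBound hM hE hS hK hKN,
      hR.eventually_eucl_gbar_le hM hE hS hK hKN hc₁ hC₁ hA hη,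
      tendsto_fst_inProb.eventually (hK.eventually (hbB j))]
      with x h1 h2 h3 h4 h5 h6 ⟨hN, hp, _⟩ h7 h8 hb
    have key := hR.abs_linearization_le h6 hM h7 (by positivity) h4 h5 hN h1 hc₁ h2
      (hR.D_mulVec_projCoef hM hE hp j)
    rw [projJac_mulVec, norm_mul, Real.norm_eq_abs, Real.norm_eq_abs,
      abs_of_nonneg (Real.sqrt_nonneg _)]
    have hδ : ‖η x - (M.γ₀, M.θ₀)‖ ≤ q * G x := (norm_le_eucl_coord _).trans h3
    have hG0 : 0 ≤ G x := eucl_nonneg _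
    set ξ₁ := eucl (M.dgbar (K x.1) x.1 (fun i => W i x.2) M.γ₀ (dir p j) - M.meanDeriv (K x.1) j)
    set ξ₂ := eucl (fstBlock ((A x - M.D (K x.1)) *ᵥ M.projCoef (K x.1) j))
    have hξ1 : 0 ≤ ξ₁ := eucl_nonneg _
    have hξ2 : 0 ≤ ξ₂ := eucl_nonneg _
    have hb0 := eucl_nonneg (M.projCoef (K x.1) j)
    have hg0 := eucl_nonneg (M.gbar (K x.1) x.1 (fun i => W i x.2) (η x))
    refine (mul_le_mul_of_nonneg_left (key.trans (add_le_add
      (mul_le_mul hb (mul_le_mul_of_nonneg_left (pow_le_pow_left₀ (norm_nonneg _) hδ 2)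
        (by positivity)) (by positivity) hBb.le)
      (mul_le_mul (add_le_add_left (add_le_add_right (mul_le_mul_of_nonneg_left hδ
        (by positivity)) _) _) (div_le_div_of_nonneg_right h8 hc₁.le) (by positivity)
        (by positivity)))) (Real.sqrt_nonneg _)).trans (le_of_eq ?_)
    rw [hs]
    ring
  have hphi : ∀ j, Tendsto (fun x : ℕ × Ω => √(x.1 : ℝ) *
      ((M.projJac (K x.1) x.1 (fun i => W i x.2) *ᵥ coord (η x - (M.γ₀, M.θ₀))) j
        + emp x.1 (fun i => W i x.2) (M.phi j))) (inProb μ) (𝓝 0) := by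
    intro j
    -- The K-dependent projected moments are replaced by the fixed functions φ_j, to which a central
    -- limit theorem applies.
    have h := (hfoc j).sub (hR.tendsto_projCoef_gbar hM hE hS hK hKN j)
    rw [sub_zero] at h
    exact h.congr fun x => by ring
  set m := frob M.phiCov⁻¹ with hm
  have hm0 : 0 ≤ m := frob_nonneg _
  set e : ℕ × Ω → ℝ := fun x => frob (M.projJac (K x.1) x.1 (fun i => W i x.2) - M.phiCov)
    with he
  have helim : Tendsto e (inProb μ) (𝓝 0) := hR.tendsto_projJac hM hE hS hK hKN
  set F : ℕ × Ω → Fin p ⊕ Unit → ℝ := fun x j => emp x.1 (fun i => W i x.2) (M.phi j) with hF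
  set T : ℕ × Ω → ℝ := fun x => ∑ j, |√(x.1 : ℝ) *
      ((M.projJac (K x.1) x.1 (fun i => W i x.2) *ᵥ coord (η x - (M.γ₀, M.θ₀))) j + F x j)|
    with hT
  have hTlim : Tendsto T (inProb μ) (𝓝 0) := by
    have h := tendsto_finsetSum Finset.univ fun j (_ : j ∈ Finset.univ) => (hphi j).abs
    simp only [abs_zero, Finset.sum_const_zero] at h
    exact h
  have hTle : ∀ x, √(x.1 : ℝ) * eucl (M.projJac (K x.1) x.1 (fun i => W i x.2) *ᵥ
      coord (η x - (M.γ₀, M.θ₀)) + F x) ≤ T x := by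
    intro x
    rw [← abs_of_nonneg (Real.sqrt_nonneg (x.1 : ℝ)), ← eucl_smul]
    exact eucl_le_sum_abs _
  -- Bounded in mean times tending to zero in probability.
  have hFe : Tendsto (fun x => e x * (√(x.1 : ℝ) * eucl (F x))) (inProb μ) (𝓝 0) := by
    have h1 : ∀ j, Tendsto (fun x : ℕ × Ω => |(√(x.1 : ℝ) * F x j) * e x|) (inProb μ) (𝓝 0) :=
      fun j => by
        have h := tendsto_inProb_mul_of_integral_le (hR.integral_abs_sqrt_emp_phi_le hM hS j) helim
        simpa using h.abs
    have h2 := tendsto_finsetSum Finset.univ fun j (_ : j ∈ Finset.univ) => h1 j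
    simp only [Finset.sum_const_zero] at h2
    refine squeeze_zero_norm (fun x => ?_) h2
    have he0 : 0 ≤ e x := frob_nonneg _
    have hE0 := eucl_nonneg (F x)
    rw [Real.norm_eq_abs, abs_of_nonneg (by positivity)]
    simp only [abs_mul, abs_of_nonneg he0, abs_of_nonneg (Real.sqrt_nonneg (x.1 : ℝ)),
      ← Finset.sum_mul, ← Finset.mul_sum]
    rw [mul_comm]
    gcongr
    exact eucl_le_sum_abs _
  -- the remainder `e √N |h|`, with `√N |h| ≤ 2 (m T + m √N |F|)`
  have hhe : Tendsto (fun x => e x * (√(x.1 : ℝ) * eucl (coord (η x - (M.γ₀, M.θ₀)))))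
      (inProb μ) (𝓝 0) := by
    have h1 := ((helim.mul hTlim).const_mul (2 * m)).add (hFe.const_mul (2 * m))
    simp only [mul_zero, add_zero] at h1
    refine squeeze_zero_norm' ?_ h1
    have h2 := helim.const_mul m
    rw [mul_zero] at h2
    -- Once m e < 1/2 the Jacobian error is absorbed, so √N |h| is bounded by T and √N |F| without
    -- prior knowledge of a √N rate.
    filter_upwards [h2.eventually (gt_mem_nhds (one_half_pos (α := ℝ)))] with x hx
    set v := coord (η x - (M.γ₀, M.θ₀)) with hv
    set H := M.projJac (K x.1) x.1 (fun i => W i x.2) with hH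
    have he0 : 0 ≤ e x := frob_nonneg _
    have hv0 := eucl_nonneg v
    have hsq := Real.sqrt_nonneg (x.1 : ℝ)
    rw [Real.norm_eq_abs, abs_of_nonneg (by positivity)]
    have k1 := eucl_add_mulVec_le hunit H v 0
    rw [Matrix.mulVec_zero, add_zero, add_zero] at k1
    have k2 : eucl (H *ᵥ v) ≤ eucl (H *ᵥ v + F x) + eucl (F x) := by
      have := eucl_add_le (H *ᵥ v + F x) (-F x)
      rwa [eucl_neg, add_neg_cancel_right] at this
    have k3 : m * e x * eucl v ≤ 1 / 2 * eucl v := mul_le_mul_of_nonneg_right hx.le hv0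
    have k4 : eucl v ≤ 2 * m * (eucl (H *ᵥ v + F x) + eucl (F x)) := by
      have k5 := mul_le_mul_of_nonneg_left k2 hm0
      have k6 : frob M.phiCov⁻¹ * (frob (H - M.phiCov) * eucl v) = m * e x * eucl v := by ring
      rw [k6] at k1
      linarith
    calc e x * (√(x.1 : ℝ) * eucl v)
        ≤ e x * (√(x.1 : ℝ) * (2 * m * (eucl (H *ᵥ v + F x) + eucl (F x)))) := by gcongr
      _ = 2 * m * (e x * (√(x.1 : ℝ) * eucl (H *ᵥ v + F x)))
          + 2 * m * (e x * (√(x.1 : ℝ) * eucl (F x))) := by ring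
      _ ≤ _ := by
          have := hTle x
          gcongr
  have hfinal := (hTlim.const_mul m).add (hhe.const_mul m)
  simp only [mul_zero, add_zero] at hfinal
  refine squeeze_zero_norm (fun x => ?_) hfinal
  set v := coord (η x - (M.γ₀, M.θ₀)) with hv
  set H := M.projJac (K x.1) x.1 (fun i => W i x.2) with hH
  -- The solution of the limiting system is the efficient influence function up to sign, since
  -- E[φφᵀ]⁻¹ φ = J⁻¹ S_eff.
  have hemp : (emp x.1 (fun i => W i x.2) fun w => (M.effJac⁻¹ *ᵥ M.Seff w (M.γ₀, M.θ₀)) a)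
      = (M.phiCov⁻¹ *ᵥ F x) a := by
    have h1 : ∀ w, (M.effJac⁻¹ *ᵥ M.Seff w (M.γ₀, M.θ₀)) a
        = (M.phiCov⁻¹ a) ⬝ᵥ fun j => M.phi j w := fun w => by
      rw [← hR.inv_phiCov_mulVec hM]
      rfl
    simp only [h1]
    exact (dotProduct_emp (fun w j => M.phi j w) _).symm
  rw [hemp, norm_mul, Real.norm_eq_abs, Real.norm_eq_abs, abs_of_nonneg (Real.sqrt_nonneg _)]
  have k1 := (abs_le_eucl (v + M.phiCov⁻¹ *ᵥ F x) a).trans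
    (eucl_add_mulVec_le hunit H v (F x))
  refine (mul_le_mul_of_nonneg_left k1 (Real.sqrt_nonneg _)).trans ?_
  calc √(x.1 : ℝ) * (m * eucl (H *ᵥ v + F x) + m * (e x * eucl v))
      = m * (√(x.1 : ℝ) * eucl (H *ᵥ v + F x)) + m * (e x * (√(x.1 : ℝ) * eucl v)) := by ring
    _ ≤ _ := by
        have := hTle x
        gcongr

end Model

end

end MNAR

namespace MNAR

noncomputable section

namespace Model

set_option linter.unusedSectionVars false

variable {r p : ℕ} {M : Model r p} {S : Set (Obs r)} {c C ρ : ℝ} {κ₁ κ₂ : ℝ}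
  {Ω : Type*} [MeasurableSpace Ω] {μ : Measure Ω} [IsProbabilityMeasure μ] {W : ℕ → Ω → Obs r}
  {K : ℕ → ℕ}

/-! ### The feasible weighting matrix -/

variable (hR : M.Regular S c C ρ) (hM : M.Assumptions) (hE : M.UniformEig κ₁ κ₂)
  (hS : IsIIDSample μ M.P W) (hK : Tendsto K atTop atTop)
  (hKN : Tendsto (fun N : ℕ => (K N : ℝ) ^ 3 / N) atTop (𝓝 0))

include hR hM hE hS hK hKN

variable {η : ℕ × Ω → EuclideanSpace ℝ (Fin p) × ℝ}

lemma Regular.exists_abs_Dhat_sub_le (hη : Tendsto η (inProb μ) (𝓝 (M.γ₀, M.θ₀))) :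
    ∃ q, 0 ≤ q ∧ ∀ᶠ x in inProb μ, ∀ v v' : Fin (K x.1) ⊕ Unit → ℝ,
      |v ⬝ᵥ (M.Dhat (K x.1) x.1 (fun i => W i x.2) (η x)
        - M.Dhat (K x.1) x.1 (fun i => W i x.2) (M.γ₀, M.θ₀)) *ᵥ v'|
        ≤ q * ‖η x - (M.γ₀, M.θ₀)‖ * eucl v * eucl v' := by
  have hκ : 0 ≤ κ₂ := zero_le_one.trans hE.one_le
  refine ⟨2 * √(2 * C ^ 2 * (κ₂ + 1 + 1)) * √(3 * (C ^ 2 * (κ₂ + 1) + (|M.θ₀| + 1) ^ 2 + (κ₂ + 1))),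
    by positivity, ?_⟩
  have hball : ∀ᶠ x in inProb μ, (η x).1 ∈ Metric.ball M.γ₀ ρ :=
    ((continuous_fst.tendsto _).comp hη).eventually_mem (Metric.ball_mem_nhds M.γ₀ hR.ρ_pos)
  have hsnd : Tendsto (fun x => (η x).2) (inProb μ) (𝓝 M.θ₀) := (continuous_snd.tendsto _).comp hη
  have hbd : ∀ᶠ x in inProb μ, |(η x).2| < |M.θ₀| + 1 :=
    hsnd.abs.eventually (gt_mem_nhds (lt_add_one _))
  filter_upwards [hball, hbd, hR.eventually_mem hS,
    hR.eventually_empBound hM hE hS hK hKN] with x h1 h2 h3 h4 v v'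
  exact hR.abs_Dhat_sub_le h3 h4 (by positivity) h1 h2.le (by linarith) v v'

/-- At consistent parameters, the sample second moment matrix is well-conditioned. -/
theorem Regular.eventually_eigIn_Dhat (hη : Tendsto η (inProb μ) (𝓝 (M.γ₀, M.θ₀))) :
    ∀ᶠ x in inProb μ, EigIn (M.Dhat (K x.1) x.1 (fun i => W i x.2) (η x)) (κ₁ / 2)
      (κ₂ + κ₁ / 2) := by
  have hκ := hE.pos
  obtain ⟨q, hq, h⟩ := hR.exists_abs_Dhat_sub_le hM hE hS hK hKN hη
  have hnorm : Tendsto (fun x => q * ‖η x - (M.γ₀, M.θ₀)‖) (inProb μ) (𝓝 0) := by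
    simpa using ((hη.sub_const (M.γ₀, M.θ₀)).norm).const_mul q
  -- Half of the spectral gap of D is given up: a quarter for evaluating at the estimated parameter,
  -- a quarter for sampling error at the truth.
  have h4 : 0 < κ₁ / 4 := by positivity
  filter_upwards [h, hnorm.eventually (gt_mem_nhds h4),
    hR.eventually_abs_Dhat_sub_D_le hM hE hS hK hKN h4,
    tendsto_fst_inProb.eventually (eventually_size (p := p) hK)] with x h1 h2 h3 ⟨_, hp, _⟩
  have key : ∀ v : Fin (K x.1) ⊕ Unit → ℝ,
      |v ⬝ᵥ M.Dhat (K x.1) x.1 (fun i => W i x.2) (η x) *ᵥ v - v ⬝ᵥ M.D (K x.1) *ᵥ v|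
        ≤ κ₁ / 2 * eucl v ^ 2 := by
    intro v
    have e1 := h1 v v
    have e2 := h3 v v
    rw [Matrix.sub_mulVec, dotProduct_sub] at e1 e2
    have e3 := mul_le_mul_of_nonneg_right h2.le (sq_nonneg (eucl v))
    have e4 : q * ‖η x - (M.γ₀, M.θ₀)‖ * eucl v * eucl v
      = q * ‖η x - (M.γ₀, M.θ₀)‖ * eucl v ^ 2 := by ring
    rw [e4] at e1
    rw [← sq] at e2
    rw [abs_le] at e1 e2 ⊢
    constructor <;> linarith [e1.1, e1.2, e2.1, e2.2]
  refine ⟨?_, fun v => ?_, fun v => ?_⟩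
  · rw [Dhat, Matrix.transpose_smul, Matrix.transpose_sum]
    simp [Matrix.transpose_vecMulVec]
  · have e1 := (abs_le.1 (key v)).1
    have e2 := (hE.eig_D _ hp).lower v
    linarith
  · have e1 := (abs_le.1 (key v)).2
    have e2 := (hE.eig_D _ hp).upper v
    linarith

/-- The feasible weighting matrix is close enough to `D` on the projected representers if the
first-step estimator has the rate of the sample moments. -/
theorem Regular.tendsto_eucl_fstBlock_Dhat (hη : Tendsto η (inProb μ) (𝓝 (M.γ₀, M.θ₀))) {q : ℝ}
    (hq : 0 ≤ q) (hrate : ∀ᶠ x in inProb μ, eucl (coord (η x - (M.γ₀, M.θ₀)))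
      ≤ q * eucl (M.gbar (K x.1) x.1 (fun i => W i x.2) (M.γ₀, M.θ₀))) (j : Fin p ⊕ Unit) :
    Tendsto (fun x : ℕ × Ω => √((x.1 : ℝ) / K x.1)
      * eucl (fstBlock ((M.Dhat (K x.1) x.1 (fun i => W i x.2) (η x) - M.D (K x.1))
        *ᵥ M.projCoef (K x.1) j)) ^ 2) (inProb μ) (𝓝 0) := by
  obtain ⟨s, hs, h⟩ := hR.exists_abs_Dhat_sub_le hM hE hS hK hKN hη
  obtain ⟨B, hB, hbB⟩ := hR.exists_eucl_projCoef_le hM hE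
  have l := ((hR.tendsto_eucl_fstBlock hM hE hS hK hKN j).const_mul 2).add
    ((hR.tendsto_eucl_gbar hM hE hS hK hKN).const_mul (2 * (s * q * B) ^ 2))
  simp only [mul_zero, add_zero] at l
  refine squeeze_zero_norm' ?_ l
  filter_upwards [h, hrate, tendsto_fst_inProb.eventually (eventually_size (p := p) hK),
    tendsto_fst_inProb.eventually (hK.eventually (hbB j))] with x h1 h2 ⟨hN, hp, hK1⟩ hb
  set b := M.projCoef (K x.1) j
  set d : ℕ → Obs r := fun i => W i x.2
  set G := eucl (M.gbar (K x.1) x.1 d (M.γ₀, M.θ₀)) with hG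
  have hG0 : 0 ≤ G := eucl_nonneg _
  have hb0 : 0 ≤ eucl b := eucl_nonneg _
  set y₀ := (M.Dhat (K x.1) x.1 d (M.γ₀, M.θ₀) - M.D (K x.1)) *ᵥ b with hy₀
  set y₁ := (M.Dhat (K x.1) x.1 d (η x) - M.Dhat (K x.1) x.1 d (M.γ₀, M.θ₀)) *ᵥ b with hy₁
  have hy : (M.Dhat (K x.1) x.1 d (η x) - M.D (K x.1)) *ᵥ b = y₀ + y₁ := by
    rw [hy₀, hy₁, ← Matrix.add_mulVec]
    congr 1
    abel
  have e1 : eucl y₁ ≤ s * q * B * G := by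
    have hδ : ‖η x - (M.γ₀, M.θ₀)‖ ≤ q * G := (norm_le_eucl_coord _).trans h2
    refine eucl_le_of_forall (fun v => (h1 v b).trans ?_) (by positivity)
    have hv := eucl_nonneg v
    calc _ ≤ s * (q * G) * eucl v * B := by gcongr
      _ = _ := by ring
  have e2 : eucl (fstBlock y₁) ≤ eucl y₁ := by
    refine le_of_sq_le_sq ?_ (eucl_nonneg _)
    rw [eucl_sq_sum_type y₁]
    linarith [sq_nonneg (y₁ (Sum.inr ()))]
  have e3 : eucl (fstBlock (y₀ + y₁)) ≤ eucl (fstBlock y₀) + eucl (fstBlock y₁) :=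
    eucl_add_le (fstBlock y₀) (fstBlock y₁)
  have e4 : eucl (fstBlock (y₀ + y₁)) ^ 2 ≤ 2 * eucl (fstBlock y₀) ^ 2
      + 2 * (s * q * B) ^ 2 * G ^ 2 := by
    have f0 := eucl_nonneg (fstBlock y₀)
    have f1 := eucl_nonneg (fstBlock (y₀ + y₁))
    have f2 : eucl (fstBlock (y₀ + y₁)) ^ 2 ≤ (eucl (fstBlock y₀) + s * q * B * G) ^ 2 :=
      pow_le_pow_left₀ f1 (e3.trans (by linarith)) 2
    nlinarith [sq_nonneg (eucl (fstBlock y₀) - s * q * B * G)]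
  have hK1' : (1 : ℝ) ≤ K x.1 := by exact_mod_cast hK1
  -- The error from the first-step estimator is of order G, and √(N/K) G² is dominated by √(NK) G²,
  -- which tends to zero; no √N rate of the first step is required.
  have e5 : √((x.1 : ℝ) / K x.1) ≤ √((x.1 : ℝ) * K x.1) := by
    refine Real.sqrt_le_sqrt ?_
    exact (div_le_self (Nat.cast_nonneg _) hK1').trans
      (le_mul_of_one_le_right (Nat.cast_nonneg _) hK1')
  rw [hy, Real.norm_eq_abs, abs_of_nonneg (by positivity)]
  calc √((x.1 : ℝ) / K x.1) * eucl (fstBlock (y₀ + y₁)) ^ 2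
      ≤ √((x.1 : ℝ) / K x.1) * (2 * eucl (fstBlock y₀) ^ 2 + 2 * (s * q * B) ^ 2 * G ^ 2) := by
        gcongr
    _ = 2 * (√((x.1 : ℝ) / K x.1) * eucl (fstBlock y₀) ^ 2)
        + 2 * (s * q * B) ^ 2 * (√((x.1 : ℝ) / K x.1) * G ^ 2) := by ring
    _ ≤ _ := by gcongr

omit hE hS hK hKN in
/-- The second moments of the efficient influence function. -/
lemma Regular.integral_influence_mul (a b : Fin p ⊕ Unit) :
    ∫ w, (-(M.effJac⁻¹ *ᵥ M.Seff w (M.γ₀, M.θ₀)) a) * (-(M.effJac⁻¹ *ᵥ M.Seff w (M.γ₀, M.θ₀)) b)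
      ∂M.P = M.Veff a b := by
  have h := integral_dotProduct_mul_dotProduct (P := M.P)
    (f := fun w => M.Seff w (M.γ₀, M.θ₀)) (fun k => hR.memLp_Seff hM k)
    (M.effJac⁻¹ a) (M.effJac⁻¹ b)
  simp only [neg_mul_neg]
  refine h.symm.trans ?_
  rw [Matrix.dotProduct_mulVec]
  rfl

omit hE hS hK hKN in
lemma Regular.memLp_influence (a : Fin p ⊕ Unit) :
    MemLp (fun w => -(M.effJac⁻¹ *ᵥ M.Seff w (M.γ₀, M.θ₀)) a) 2 M.P :=
  (memLp_finsetSum Finset.univ fun i _ => (hR.memLp_Seff hM i).const_mul (M.effJac⁻¹ a i)).neg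

omit hE hS hK hKN in
lemma Regular.integral_influence (a : Fin p ⊕ Unit) :
    ∫ w, -(M.effJac⁻¹ *ᵥ M.Seff w (M.γ₀, M.θ₀)) a ∂M.P = 0 := by
  have := hM.isProb
  simp only [Matrix.mulVec, dotProduct]
  rw [integral_neg, integral_finsetSum _ fun i _ =>
    ((hR.memLp_Seff hM i).integrable one_le_two).const_mul _]
  simp [integral_const_mul, hR.integral_Seff hM]

end Model

lemma norm_smul_stack_sub_le {p : ℕ} (s : ℝ) (η η' : EuclideanSpace ℝ (Fin p) × ℝ)
    (v : Fin p ⊕ Unit → ℝ) :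
    ‖s • (stack η - stack η') - WithLp.toLp 2 v‖ ≤ ∑ a, |s * coord (η - η') a - v a| := by
  have h : s • (stack η - stack η') - WithLp.toLp 2 v
      = WithLp.toLp 2 (fun a => s * coord (η - η') a - v a) := by
    ext a
    rcases a with a | _ <;> simp [stack, coord]
  rw [h, ← eucl_eq_norm]
  exact eucl_le_sum_abs _

lemma continuous_stack {p : ℕ} : Continuous (stack (p := p)) := by
  refine (PiLp.continuous_toLp 2 _).comp (continuous_pi fun a => ?_)
  rcases a with a | _ <;> simp only [Sum.elim_inl, Sum.elim_inr] <;> fun_prop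

end

end MNAR

/-! ### Equivalence and efficiency of the two-step estimator -/

theorem theorem4 {r p : ℕ} (M : MNAR.Model r p) (hM : M.Assumptions)
    {Ω : Type*} [MeasurableSpace Ω] (μ : Measure Ω) [IsProbabilityMeasure μ]
    (W : ℕ → Ω → MNAR.Obs r) (hW_meas : ∀ i, Measurable (W i))
    (hW_indep : iIndepFun W μ) (hW_law : ∀ i, μ.map (W i) = M.P)
    (K : ℕ → ℕ) (hK : Tendsto K atTop atTop)
    (hKN : Tendsto (fun N : ℕ => (K N : ℝ) ^ 3 / N) atTop (𝓝 0))
    (ηcheck ηbar ηhat : ℕ → Ω → EuclideanSpace ℝ (Fin p) × ℝ)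
    (hcheck_meas : ∀ N, AEMeasurable (ηcheck N) μ)
    (hbar_meas : ∀ N, AEMeasurable (ηbar N) μ)
    (hhat_meas : ∀ N, AEMeasurable (ηhat N) μ)
    (hcheck : ∀ N, ∀ᵐ ω ∂μ, M.IsGMM (K N) N (fun i => W i ω)
      (M.W0 (K N) N (fun i => W i ω)) (ηcheck N ω))
    (hbar : ∀ N, ∀ᵐ ω ∂μ, M.IsGMM (K N) N (fun i => W i ω) (M.D (K N)) (ηbar N ω))
    (hhat : ∀ N, ∀ᵐ ω ∂μ, M.IsGMM (K N) N (fun i => W i ω)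
      (M.Dhat (K N) N (fun i => W i ω) (ηcheck N ω)) (ηhat N ω)) :
    TendstoInMeasure μ
      (fun (N : ℕ) ω => Real.sqrt N • (MNAR.stack (ηbar N ω) - MNAR.stack (ηhat N ω)))
      atTop (fun _ => 0) ∧
    M.Veff.PosDef ∧
    TendstoInDistribution
      (fun (N : ℕ) ω => Real.sqrt N • (MNAR.stack (ηhat N ω) - MNAR.stack (M.γ₀, M.θ₀)))
      atTop id (fun _ => μ) (multivariateGaussian 0 M.Veff) := by
  open MNAR MNAR.Model in
  obtain ⟨S, c, C, ρ, hR⟩ := hM.exists_regular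
  obtain ⟨κ₁, κ₂, hE⟩ := hR.exists_uniformEig hM
  have hS : IsIIDSample μ M.P W := ⟨hW_meas, hW_indep, hW_law⟩
  have hκ₁ := hE.pos
  have hκ₂ : 0 < κ₂ := zero_lt_one.trans_le hE.one_le
  have gcheck := eventually_inProb_of_ae (μ := μ) (p := fun x => M.IsGMM (K x.1) x.1
    (fun i => W i x.2) (M.W0 (K x.1) x.1 (fun i => W i x.2)) (ηcheck x.1 x.2))
    (Eventually.of_forall hcheck)
  have gbar := eventually_inProb_of_ae (μ := μ) (p := fun x => M.IsGMM (K x.1) x.1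
    (fun i => W i x.2) (M.D (K x.1)) (ηbar x.1 x.2)) (Eventually.of_forall hbar)
  have ghat := eventually_inProb_of_ae (μ := μ) (p := fun x => M.IsGMM (K x.1) x.1
    (fun i => W i x.2) (M.Dhat (K x.1) x.1 (fun i => W i x.2) (ηcheck x.1 x.2)) (ηhat x.1 x.2))
    (Eventually.of_forall hhat)
  have eW := hR.eventually_eigIn_W0 hM hE hS hK hKN
  have hW1 : 0 < min (κ₁ / 2) 1 := lt_min (half_pos hκ₁) one_pos
  have hW2 : 0 < κ₂ + κ₁ / 2 := by positivity
  have ccheck := hR.tendsto_gmm hM hE hS hK hKN hW1 hW2 eW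
    (η := fun x => ηcheck x.1 x.2) gcheck
  obtain ⟨q, hq, hrate⟩ := hR.exists_rate hM hE hS hK hKN hW1 hW2 eW
    (η := fun x => ηcheck x.1 x.2) gcheck
  have eD := hR.eventually_eigIn_Dhat hM hE hS hK hKN ccheck
  have xhat := hR.tendsto_linear_expansion hM hE hS hK hKN (half_pos hκ₁) hW2 eD
    (η := fun x => ηhat x.1 x.2) ghat
    (hR.tendsto_eucl_fstBlock_Dhat hM hE hS hK hKN ccheck hq.le hrate)
  have xbar := hR.tendsto_linear_expansion hM hE hS hK hKN hκ₁ hκ₂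
    (A := fun x => M.D (K x.1)) (by
      filter_upwards [tendsto_fst_inProb.eventually (hK.eventually_ge_atTop p)] with x hx
      exact hE.eig_D _ hx) (η := fun x => ηbar x.1 x.2) gbar
    -- With A = D the weighting error is zero, so the expansion needs nothing further.
    (fun j => by
      refine tendsto_const_nhds.congr fun x => ?_
      have : fstBlock (0 : Fin (K x.1) ⊕ Unit → ℝ) = 0 := rfl
      rw [sub_self, Matrix.zero_mulVec, this, eucl]
      simp)
  have hV := hR.Veff_posDef hM
  refine ⟨?_, hV, ?_⟩
  · rw [tendstoInMeasure_iff_inProb, tendsto_zero_iff_norm_tendsto_zero]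
    -- Both expansions have the same leading term, which cancels in the difference.
    have h := tendsto_finsetSum Finset.univ fun a (_ : a ∈ Finset.univ) =>
      ((xbar a).sub (xhat a)).abs
    simp only [sub_zero, abs_zero, Finset.sum_const_zero] at h
    refine squeeze_zero (fun _ => norm_nonneg _) (fun x => ?_) h
    have h1 := norm_smul_stack_sub_le √(x.1 : ℝ) (ηbar x.1 x.2) (ηhat x.1 x.2) 0
    rw [WithLp.toLp_zero, sub_zero] at h1
    refine h1.trans (le_of_eq (Finset.sum_congr rfl fun a _ => ?_))
    congr 1
    rcases a with a | _ <;> simp [coord] <;> ring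
  · have hclt := hS.tendstoInDistribution_toLp (fun a => hR.memLp_influence hM a)
      (fun a => hR.integral_influence hM a) hV.posSemidef
      (fun a b => hR.integral_influence_mul hM a b)
    -- Slutsky: the normalized estimator differs by o_p(1) from the normalized mean of the influence
    -- function -J⁻¹ S_eff, whose second moment matrix is `Veff`.
    refine tendstoInDistribution_of_tendstoInMeasure_sub _ _ hclt ?_ fun N => ?_
    · refine tendstoInMeasure_iff_inProb.2 (tendsto_zero_iff_norm_tendsto_zero.2 ?_)
      have h := tendsto_finsetSum Finset.univ fun a (_ : a ∈ Finset.univ) => (xhat a).abs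
      simp only [abs_zero, Finset.sum_const_zero] at h
      refine squeeze_zero (fun _ => norm_nonneg _) (fun x => ?_) h
      refine (norm_smul_stack_sub_le √(x.1 : ℝ) (ηhat x.1 x.2) (M.γ₀, M.θ₀) _).trans
        (le_of_eq (Finset.sum_congr rfl fun a _ => ?_))
      congr 1
      have h2 : (emp x.1 (fun i => W i x.2) fun w => -(M.effJac⁻¹ *ᵥ M.Seff w (M.γ₀, M.θ₀)) a)
          = -(emp x.1 (fun i => W i x.2) fun w => (M.effJac⁻¹ *ᵥ M.Seff w (M.γ₀, M.θ₀)) a) := by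
        simp [emp]
      rw [h2]
      ring
    · exact ((continuous_stack.measurable.comp_aemeasurable (hhat_meas N)).sub_const _).const_smul (√(N : ℝ))
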